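/- Let $k$ be a field of characteristic $0$. For a $\mathbb Z$-graded vector space $V$ let $V[1]$ be the shifted space ($V[1]^p=V^{p+1}$), $\mathrm T(V)=\bigoplus_{n\ge 0}V^{\otimes n}$ the tensor coalgebra, and let $\mathrm{Hom}^n(V,W)$ be the space of all linear maps of degree $n$. An $A_\infty$-algebra is a $\mathbb Z$-graded vector space $A$ with a coderivation $\mathrm d_A$ of degree $1$ of $\mathrm T(A[1])$ with $\mathrm d_A^2=0$; it is flat if $\mathrm d_A(1)=0$. An $A_\infty$-$A$-$B$-bimodule is a graded vector space $K$ with a codifferential $\mathrm d_K$ on the bicomodule $\mathrm T(A[1])\otimes K[1]\otimes \mathrm T(B[1])$ compatible with $\mathrm d_A,\mathrm d_B$; equivalently, it is an $A_\infty$-category $\mathtt{Cat}_\infty(A,B,K)$ with two objects $\mathbf a,\mathbf b$ whose morphism spaces are $A=\mathrm{Hom}(\mathbf a,\mathbf a)$, $K=\mathrm{Hom}(\mathbf a,\mathbf b)$, $B=\mathrm{Hom}(\mathbf b,\mathbf b)$ and $\mathrm{Hom}(\mathbf b,\mathbf a)=0$ (words being composed from left to right). The Taylor components of $\mathrm d_A,\mathrm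 d_B,\mathrm d_K$ may be nonzero in infinitely many arities. The (completed) Hochschild complexes are $\mathrm C^n(B,B)=\mathrm{Hom}^n(\mathrm T(B[1]),B[1])$, similarly for $A$, and $$\mathrm C^n(\mathtt{Cat}_\infty(A,B,K))=\mathrm{Hom}^n(\mathrm T(A[1]),A[1])\oplus\mathrm{Hom}^n(\mathrm T(A[1])\otimes K[1]\otimes\mathrm T(B[1]),K[1])\oplus\mathrm{Hom}^n(\mathrm T(B[1]),B[1]),$$ i.e. the spaces of coderivations, with differential the graded commutator with the codifferential; cochains have an arbitrary (possibly infinite) set of nonzero components, including those of arity $0$ in $A$ and $B$. Let $\mathrm p_A,\mathrm p_B$ be the projections from $\mathrm C^\bullet(\mathtt{Cat}_\infty(A,B,K))$ onto $\mathrm C^\bullet(A,A)$ and $\mathrm C^\bullet(B,B)$. Let $A$ and $B$ be flat and let $K$ be an $A_\infty$-$A$-$B$-bimodule. Let $\underline{\mathrm{End}}_{-B}(K)$ be the differential graded algebra of all endomorphisms of the right $\mathrm T(B[1])$-comodule $K[1]\otimes\mathrm T(B[1])$, so that $\underline{\mathrm{End}}^p_{-B}(K)=\mathrm{Hom}^p(K[1]\otimes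 \mathrm T(B[1]),K[1])$, with differential $\varphi\mapsto-[\mathrm d_{K,B},\varphi]$, where $\mathrm d_{K,B}$ is the restriction of $\mathrm d_K$. The derived left action $\mathrm L_A:A\to\underline{\mathrm{End}}_{-B}(K)$ is the $A_\infty$-morphism with components $\mathrm L_A^m(a_1|\cdots|a_m)(\kappa|b_1|\cdots|b_n)=\mathrm d_K(a_1|\cdots|a_m|\kappa|b_1|\cdots|b_n)$, $m\ge1$, $n\ge 0$. Symmetrically, $\mathrm R_B:B\to\underline{\mathrm{End}}_{A-}(K)^{\mathrm{op}}$ is the derived right action, where $\underline{\mathrm{End}}_{A-}(K)$ consists of all endomorphisms of the left $\mathrm T(A[1])$-comodule $\mathrm T(A[1])\otimes K[1]$. An $A_\infty$-morphism is called a quasi-isomorphism if its linear component is a quasi-isomorphism of complexes. Theorem. If $\mathrm L_A$ is a quasi-isomorphism, then $\mathrm p_B:\mathrm C^\bullet(\mathtt{Cat}_\infty(A,B,K))\to\mathrm C^\bullet(B,B)$ is a quasi-isomorphism. If $\mathrm R_B$ is a quasi-isomorphism, then $\mathrm p_A:\mathrm C^\bullet(\mathtt{Cat}_\infty(A,B,K))\to\mathrm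 C^\bullet(A,A)$ is a quasi-isomorphism. -/

import Mathlib

open CategoryTheory

universe u v

/-!
# A-infinity categories and their completed Hochschild complexes

All signs are Koszul signs for the suspended gradings: a morphism `c` of degree `p` has degree
`p - 1` as a letter of the tensor coalgebra `T(C[1])`.  A linear map out of `T(C[1])` is a function
on words that is linear in each letter, so it has one component in each number of inputs
(including zero), possibly infinitely many of them nonzero.
-/

namespace AInf

/-- A family `Hom i j` of `ℤ`-graded vector spaces indexed by pairs of objects;
`gr i j p` is the part of degree `p`. -/
structure GrQuiver (k : Type u) [Field k] (I : Type) where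
  Hom : I → I → Type v
  [grp : ∀ i j, AddCommGroup (Hom i j)]
  [mod : ∀ i j, Module k (Hom i j)]
  gr : ∀ i j, ℤ → Submodule k (Hom i j)
  [dec : ∀ i j, DirectSum.Decomposition (gr i j)]

attribute [instance] GrQuiver.grp GrQuiver.mod GrQuiver.dec

variable {k : Type u} [Field k] {I : Type}

/-- Composable words: a word from `i` to `l` is a pure tensor `c₁ ⊗ ⋯ ⊗ cₙ` (`n ≥ 0`) with
`c₁ : Hom i i₁`, `c₂ : Hom i₁ i₂`, ..., `cₙ : Hom iₙ₋₁ l`. -/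
inductive Word (Q : GrQuiver.{u, v} k I) : I → I → Type v
  | nil (i : I) : Word Q i i
  | cons {i j l : I} (c : Q.Hom i j) (w : Word Q j l) : Word Q i l

/-- `c ↦ (-1) ^ (n * (|c| - 1)) c`: the Koszul sign for moving an operator of degree `n`
past the suspended letter `c`. -/
noncomputable def GrQuiver.kos (Q : GrQuiver.{u, v} k I) (n : ℤ) {i j : I} : Q.Hom i j →ₗ[k] Q.Hom i j :=
  DirectSum.toModule k ℤ (Q.Hom i j)
      (fun p => ((-1 : k) ^ (n * (p - 1))) • (Q.gr i j p).subtype) ∘ₗ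
    (DirectSum.decomposeLinearEquiv (Q.gr i j)).toLinearMap

namespace Word
variable {Q : GrQuiver.{u, v} k I}

/-- Concatenation. -/
def append : ∀ {i j l : I}, Word Q i j → Word Q j l → Word Q i l
  | _, _, _, nil _, z => z
  | _, _, _, cons c w, z => cons c (append w z)

/-- The Koszul sign for moving an operator of degree `n` past a word. -/
noncomputable def kos (n : ℤ) : ∀ {i j : I}, Word Q i j → Word Q i j
  | _, _, nil i => nil i
  | _, _, cons c w => cons (Q.kos n c) (kos n w)

/-- The sum of `g y z` over all ways to write a word as a concatenation `y z`
(`y` and `z` may be empty), i.e. `g` applied to the deconcatenation coproduct. -/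
def splitSum {X : Type*} [AddCommGroup X] : ∀ {i l : I}, Word Q i l →
    (∀ m, Word Q i m → Word Q m l → X) → X
  | _, _, nil i, g => g i (nil i) (nil i)
  | _, _, cons (i := i) c w, g => g i (nil i) (cons c w) + splitSum w fun m y z => g m (cons c y) z

/-- A word of homogeneous letters, of total suspended degree `∑ (|cᵢ| - 1)`. -/
inductive IsHomog : ∀ {i j : I}, Word Q i j → ℤ → Prop
  | nil (i : I) : IsHomog (nil i) 0
  | cons {i j l : I} {c : Q.Hom i j} {w : Word Q j l} {p q : ℤ} (hc : c ∈ Q.gr i j p)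
      (hw : IsHomog w q) : IsHomog (cons c w) (p - 1 + q)

end Word

section
variable {Q : GrQuiver.{u, v} k I}

/-- `F ∘ D_Φ`, where `D_Φ` is the coderivation of degree `n` of the tensor coalgebra with Taylor
components `Φ`: the sum of `± F (x, Φ y, z)` over all decompositions `w = x y z`. -/
noncomputable def ins {X : Type*} [AddCommGroup X] (n : ℤ) (Φ : ∀ i j : I, Word Q i j → Q.Hom i j) {i l : I}
    (F : Word Q i l → X) (w : Word Q i l) : X :=
  w.splitSum fun a x u => u.splitSum fun b y z => F ((x.kos n).append (.cons (Φ a b y) z))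

/-- Linearity in each letter: `F` is a linear map on the space of tensors from `i` to `l`. -/
def IsMultilin {X : Type*} [AddCommGroup X] [Module k X] {i l : I} (F : Word Q i l → X) : Prop :=
  ∀ (a b : I) (x : Word Q i a) (z : Word Q b l),
    IsLinearMap k fun c : Q.Hom a b => F (x.append (.cons c z))

open Word

theorem neg_one_sq (n : ℤ) : (-1 : k) ^ n * (-1 : k) ^ n = 1 := by
  rw [← mul_zpow]; simp

theorem kos_of_mem (n : ℤ) {i j : I} {p : ℤ} {c : Q.Hom i j} (hc : c ∈ Q.gr i j p) :
    Q.kos n c = ((-1 : k) ^ (n * (p - 1))) • c := by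
  simp only [GrQuiver.kos, LinearMap.comp_apply, LinearEquiv.coe_coe,
    DirectSum.decomposeLinearEquiv_apply, DirectSum.decompose_of_mem _ hc]
  rw [← DirectSum.lof_eq_of k, DirectSum.toModule_lof]
  simp

theorem kos_mem (n : ℤ) {i j : I} {p : ℤ} {c : Q.Hom i j} (hc : c ∈ Q.gr i j p) :
    Q.kos n c ∈ Q.gr i j p := by
  rw [kos_of_mem n hc]; exact Submodule.smul_mem _ _ hc

theorem hom_induction {i j : I} {P : Q.Hom i j → Prop} (h0 : P 0)
    (hh : ∀ p c, c ∈ Q.gr i j p → P c) (ha : ∀ c d, P c → P d → P (c + d)) (c) : P c :=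
  DirectSum.Decomposition.inductionOn (Q.gr i j) h0 (fun {p} m => hh p m m.2) ha c

theorem kos_kos (n m : ℤ) {i j : I} (c : Q.Hom i j) : Q.kos n (Q.kos m c) = Q.kos (n + m) c := by
  induction c using hom_induction with
  | h0 => simp
  | hh p c hc =>
    rw [kos_of_mem m hc, map_smul, kos_of_mem n hc, kos_of_mem _ hc, smul_smul,
      ← zpow_add₀ (by simp)]
    congr 2; ring
  | ha c d hc hd => simp [hc, hd]

theorem word_kos_kos (n m : ℤ) {i j : I} (w : Word Q i j) : (w.kos m).kos n = w.kos (n + m) := by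
  induction w with
  | nil => rfl
  | cons c w ih => simp [Word.kos, kos_kos, ih]

section split
variable {X : Type*} [AddCommGroup X]

theorem splitSum_nil (i : I) (g : ∀ m, Word Q i m → Word Q m i → X) :
    (Word.nil i).splitSum g = g i (.nil i) (.nil i) := rfl

theorem splitSum_cons {i j l : I} (c : Q.Hom i j) (w : Word Q j l)
    (g : ∀ m, Word Q i m → Word Q m l → X) :
    (Word.cons c w).splitSum g = g i (.nil i) (.cons c w)
      + w.splitSum fun m y z => g m (.cons c y) z := rfl

theorem splitSum_add {i l : I} (w : Word Q i l) (g h : ∀ m, Word Q i m → Word Q m l → X) :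
    w.splitSum (fun m y z => g m y z + h m y z) = w.splitSum g + w.splitSum h := by
  induction w with
  | nil => rfl
  | cons c w ih => simp only [splitSum_cons, ih]; abel

theorem splitSum_map {Y : Type*} [AddCommGroup Y] (f : X →+ Y) {i l : I} (w : Word Q i l)
    (g : ∀ m, Word Q i m → Word Q m l → X) :
    f (w.splitSum g) = w.splitSum (fun m y z => f (g m y z)) := by
  induction w with
  | nil => rfl
  | cons c w ih => simp only [splitSum_cons, ih, map_add]

theorem splitSum_zero {i l : I} (w : Word Q i l) :
    w.splitSum (fun _ _ _ => (0 : X)) = 0 := by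
  induction w with
  | nil => rfl
  | cons c w ih => simp only [splitSum_cons, ih, add_zero]

theorem splitSum_neg {i l : I} (w : Word Q i l) (g : ∀ m, Word Q i m → Word Q m l → X) :
    w.splitSum (fun m y z => - g m y z) = - w.splitSum g :=
  (splitSum_map (-AddMonoidHom.id X) w g).symm

theorem splitSum_smul [Module k X] (r : k) {i l : I} (w : Word Q i l)
    (g : ∀ m, Word Q i m → Word Q m l → X) :
    w.splitSum (fun m y z => r • g m y z) = r • w.splitSum g :=
  (splitSum_map (DistribSMul.toAddMonoidHom X r) w g).symm

theorem splitSum_assoc {i l : I} (w : Word Q i l)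
    (G : ∀ a b, Word Q i a → Word Q a b → Word Q b l → X) :
    w.splitSum (fun a y v => v.splitSum fun b z u => G a b y z u) =
      w.splitSum (fun b p u => p.splitSum fun a y z => G a b y z u) := by
  induction w with
  | nil => rfl
  | cons c w ih =>
    simp only [splitSum_cons, splitSum_nil, splitSum_add, ih (fun a b y z u => G a b (.cons c y) z u)]
    abel

theorem splitSum_kos (n : ℤ) {i l : I} (w : Word Q i l)
    (g : ∀ m, Word Q i m → Word Q m l → X) :
    (w.kos n).splitSum g = w.splitSum fun m y z => g m (y.kos n) (z.kos n) := by
  induction w with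
  | nil => rfl
  | cons c w ih => simp only [Word.kos, splitSum_cons, ih]

variable (n m : ℤ) (Φ Ψ : ∀ i j : I, Word Q i j → Q.Hom i j)

theorem ins_nil (i : I) (F : Word Q i i → X) :
    ins n Φ F (.nil i) = F (.cons (Φ i i (.nil i)) (.nil i)) := rfl

theorem ins_cons {i j l : I} (F : Word Q i l → X) (c : Q.Hom i j) (w : Word Q j l) :
    ins n Φ F (.cons c w) =
      (Word.cons c w).splitSum (fun b y z => F (.cons (Φ i b y) z))
        + ins n Φ (fun u => F (.cons (Q.kos n c) u)) w := rfl

theorem ins_add {i l : I} (F G : Word Q i l → X) (w : Word Q i l) :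
    ins n Φ (fun w => F w + G w) w = ins n Φ F w + ins n Φ G w := by
  simp only [ins, splitSum_add]

theorem ins_map {Y : Type*} [AddCommGroup Y] (f : X →+ Y) {i l : I} (F : Word Q i l → X)
    (w : Word Q i l) : ins n Φ (fun w => f (F w)) w = f (ins n Φ F w) := by
  simp only [ins, splitSum_map]

theorem ins_neg {i l : I} (F : Word Q i l → X)
    (w : Word Q i l) : ins n Φ (fun w => - (F w)) w = - (ins n Φ F w) :=
  ins_map n Φ (-AddMonoidHom.id X) F w

theorem ins_sub {i l : I} (F G : Word Q i l → X) (w : Word Q i l) :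
    ins n Φ (fun w => F w - G w) w = ins n Φ F w - ins n Φ G w := by
  simp only [sub_eq_add_neg, ins_add, ins_neg]

theorem ins_smul [Module k X] (r : k) {i l : I} (F : Word Q i l → X)
    (w : Word Q i l) : ins n Φ (fun w => r • (F w)) w = r • (ins n Φ F w) :=
  ins_map n Φ (DistribSMul.toAddMonoidHom X r) F w

/-- Compatibility of a coderivation with deconcatenation. -/
theorem ins_splitSum {i l : I} (w : Word Q i l) (g : ∀ m, Word Q i m → Word Q m l → X) :
    ins m Ψ (fun w => w.splitSum g) w =
      w.splitSum fun j p u => ins m Ψ (fun p' => g j p' u) p + ins m Ψ (g j (p.kos m)) u := by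
  induction w with
  | nil i => simp only [splitSum_nil, ins_nil, splitSum_cons, Word.kos]; abel
  | cons c w ih =>
    have h := splitSum_assoc (.cons c w)
      (fun a b y z u => g b (.cons (Ψ _ a y) z) u)
    simp only [splitSum_cons, splitSum_nil, splitSum_add] at h
    simp only [ins_cons, ins_nil, splitSum_cons, splitSum_add, ins_add, ih,
      Word.kos]
    simp only [← add_assoc]
    linear_combination (norm := abel) h

end split

section multi
variable {X Y : Type*} [AddCommGroup X] [Module k X] [AddCommGroup Y] [Module k Y]

theorem isLinearMap_splitSum {Y : Type*} [AddCommGroup Y] [Module k Y] {i l : I} (w : Word Q i l)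
    (g : Y → ∀ m, Word Q i m → Word Q m l → X)
    (hg : ∀ m y z, IsLinearMap k fun c => g c m y z) : IsLinearMap k fun c => w.splitSum (g c) where
  map_add c d := by rw [← splitSum_add]; exact congrArg _ (by funext m y z; exact (hg m y z).map_add c d)
  map_smul r c := by rw [← splitSum_smul]; exact congrArg _ (by funext m y z; exact (hg m y z).map_smul r c)

theorem IsMultilin.cons {i j l : I} {F : Word Q i l → X} (hF : IsMultilin F) (c : Q.Hom i j) :
    IsMultilin fun w => F (.cons c w) :=
  fun a b x z => hF a b (.cons c x) z

theorem IsMultilin.head {i j l : I} {F : Word Q i l → X} (hF : IsMultilin F) (w : Word Q j l) :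
    IsLinearMap k fun c => F (.cons c w) := hF _ _ (.nil i) w

theorem isMultilin_of {i l : I} {F : Word Q i l → X}
    (h0 : ∀ j (w : Word Q j l), IsLinearMap k fun c => F (.cons c w))
    (h1 : ∀ j (c : Q.Hom i j), IsMultilin fun w => F (.cons c w)) : IsMultilin F
  | _, _, .nil _, z => h0 _ z
  | a, b, .cons d x, z => h1 _ d a b x z

theorem IsMultilin.add {i l : I} {F G : Word Q i l → X} (hF : IsMultilin F) (hG : IsMultilin G) :
    IsMultilin fun w => F w + G w :=
  fun a b x z => IsLinearMap.mk (fun c d => by simp only [(hF a b x z).map_add, (hG a b x z).map_add]; abel)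
    (fun r c => by simp only [(hF a b x z).map_smul, (hG a b x z).map_smul, smul_add])

theorem IsMultilin.comp_linear {i l : I} {F : Word Q i l → X} (hF : IsMultilin F) {f : X → Y}
    (hf : IsLinearMap k f) : IsMultilin fun w => f (F w) :=
  fun a b x z => ((hf.mk' f).comp ((hF a b x z).mk' _)).isLinear

theorem isMultilin_splitSum {i l : I} (g : ∀ m, Word Q i m → Word Q m l → X)
    (h1 : ∀ m u, IsMultilin fun y => g m y u) (h2 : ∀ m y, IsMultilin (g m y)) :
    IsMultilin fun w => w.splitSum g := by
  intro a b x z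
  induction x with
  | nil i =>
    exact ((((h2 _ (.nil i)).head z).mk' _) +
      (isLinearMap_splitSum z (fun c m y u => g m (.cons c y) u)
        (fun m y u => (h1 m u).head y)).mk' _).isLinear
  | cons d x ih =>
    exact ((((h2 _ (.nil _)).cons d _ _ _ z).mk' _) +
      (ih (fun m y u => g m (.cons d y) u) (fun m u => (h1 m u).cons d)
        (fun m y => h2 m _)).mk' _).isLinear

variable (n m : ℤ) (Φ Ψ : ∀ i j : I, Word Q i j → Q.Hom i j)

theorem isLinearMap_ins {i l : I} (w : Word Q i l)
    (F : Y → Word Q i l → X)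
    (hg : ∀ w, IsLinearMap k fun c => F c w) : IsLinearMap k fun c => ins n Φ (F c) w :=
  isLinearMap_splitSum _ _ fun _ _ _ => isLinearMap_splitSum _ _ fun _ _ _ => hg _

theorem isMultilin_ins (hΦ : ∀ i j, IsMultilin (Φ i j)) {i l : I} (F : Word Q i l → X)
    (hF : IsMultilin F) : IsMultilin (ins n Φ F) := by
  have H : ∀ {i : I} (F : Word Q i l → X), IsMultilin F →
      IsMultilin fun w => w.splitSum fun b y z => F (.cons (Φ i b y) z) := fun F hF =>
    isMultilin_splitSum _ (fun m u => (hΦ _ m).comp_linear (hF.head u)) (fun m y => hF.cons _)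
  intro a b x z
  induction x with
  | nil i =>
    exact (((H F hF _ _ (.nil _) z).mk' _) +
      ((isLinearMap_ins n Φ z (fun c u => F (.cons c u)) (fun w => hF.head w)).mk' _).comp
        (Q.kos n)).isLinear
  | cons d x ih =>
    exact (((H F hF _ _ (.cons d x) z).mk' _) + (ih _ (hF.cons (Q.kos n d))).mk' _).isLinear

theorem Word.IsHomog.append {i j l : I} {x : Word Q i j} {z : Word Q j l} {p q : ℤ} (hx : x.IsHomog p)
    (hz : z.IsHomog q) : (x.append z).IsHomog (p + q) := by
  induction hx with
  | nil => simpa [Word.append] using hz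
  | cons hc _ ih => rw [add_assoc]; exact .cons hc (ih hz)

theorem Word.IsHomog.kos {i j : I} {x : Word Q i j} {p : ℤ} (hx : x.IsHomog p) :
    (x.kos n).IsHomog p := by
  induction hx with
  | nil => exact .nil _
  | cons hc _ ih => exact .cons (kos_mem n hc) ih

theorem splitSum_mem {i l : I} {w : Word Q i l} {r : ℤ} (hw : w.IsHomog r)
    (g : ∀ m, Word Q i m → Word Q m l → X) (S : Submodule k X)
    (hg : ∀ m y z p q, y.IsHomog p → z.IsHomog q → p + q = r → g m y z ∈ S) :
    w.splitSum g ∈ S := by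
  induction hw with
  | nil i => exact hg _ _ _ 0 0 (.nil _) (.nil _) (by simp)
  | cons hc hw ih =>
    refine S.add_mem (hg _ _ _ 0 _ (.nil _) (.cons hc hw) (by simp)) (ih _ ?_)
    intro m y z p q hy hz h
    exact hg _ _ _ _ _ (.cons hc hy) hz (by omega)

theorem ins_mem (hΦ : ∀ i j w q, w.IsHomog q → Φ i j w ∈ Q.gr i j (q + n + 1))
    (G : ℤ → Submodule k X) (a : ℤ) {i l : I} (F : Word Q i l → X)
    (hF : ∀ w q, w.IsHomog q → F w ∈ G (q + a)) (w : Word Q i l) (q : ℤ) (hw : w.IsHomog q) :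
    ins n Φ F w ∈ G (q + n + a) := by
  refine splitSum_mem hw _ _ fun _ x u p r hx hu h => splitSum_mem hu _ _ fun _ y z s t hy hz h' => ?_
  have := hF _ _ (Word.IsHomog.append (Word.IsHomog.kos n hx) (.cons (hΦ _ _ _ _ hy) hz))
  convert this using 2
  omega

theorem kos_apply {J : Type} {Q' : GrQuiver.{u, v} k J} {i l : I} {a b : J} (F : Word Q i l → Q'.Hom a b)
    (hF : IsMultilin F) (hd : ∀ w q, w.IsHomog q → F w ∈ Q'.gr a b (q + m + 1)) (w : Word Q i l) :
    Q'.kos n (F w) = ((-1 : k) ^ (n * m)) • F (w.kos n) := by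
  induction w generalizing m with
  | nil i =>
    have := hd (.nil i) 0 (.nil i)
    rw [kos_of_mem n this]
    simp [Word.kos]
  | cons c w ih =>
    induction c using hom_induction with
    | h0 => simp [(hF.head _).map_zero, Word.kos]
    | hh p c hc =>
      rw [ih (m + p - 1) (fun w => F (.cons c w)) (hF.cons c) ?_, Word.kos, kos_of_mem n hc,
        (hF.head _).map_smul, smul_smul, ← zpow_add₀ (by simp)]
      · congr 2; ring
      · intro w q hw
        have := hd _ _ (.cons hc hw)
        convert this using 2; ring
    | ha c d hc hd =>
      simp only [Word.kos] at *
      simp only [(hF.head _).map_add, map_add, hc, hd, smul_add]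
end multi

section comm
variable {X : Type*} [AddCommGroup X] [Module k X]


variable (n m : ℤ) (Φ Ψ : ∀ i j : I, Word Q i j → Q.Hom i j)

theorem ins_kos {i l : I} (F : Word Q i l → X) (hF : IsMultilin F)
    (hΨ : ∀ i j w, Q.kos n (Ψ i j w) = ((-1 : k) ^ (n * m)) • Ψ i j (w.kos n)) (w : Word Q i l) :
    ins m Ψ F (w.kos n) = ((-1 : k) ^ (n * m)) • ins m Ψ (fun u => F (u.kos n)) w := by
  have h : ∀ i j w, Ψ i j (Word.kos n w) = ((-1 : k) ^ (n * m)) • Q.kos n (Ψ i j w) := by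
    intro i j w; rw [hΨ, smul_smul, neg_one_sq, one_smul]
  induction w with
  | nil i => simp only [Word.kos, ins_nil, ← (hF.head _).map_smul, ← h]
  | cons c w ih =>
    simp only [Word.kos, ins_cons, ih _ (hF.cons _), smul_add]
    congr 1
    · have := splitSum_kos n (.cons c w) (fun b y z => F (cons (Ψ _ b y) z))
      simp only [Word.kos] at this
      rw [this, ← splitSum_smul]
      simp only [← (hF.head _).map_smul, ← h]
    · simp only [kos_kos, add_comm]

/-- The part of `F ∘ D_Φ ∘ D_Ψ` where the output of `Φ` stands directly in front and `Ψ` acts behind it. -/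
noncomputable def defect {i l : I} (F : Word Q i l → X) (w : Word Q i l) : X :=
  w.splitSum fun b p v => ins m Ψ (fun z => F (.cons (Φ i b (p.kos m)) z)) v

theorem ins_head_add {i l : I} (F : Word Q i l → X) (hF : IsMultilin F)
    (hΨ : ∀ i j w, Q.kos n (Ψ i j w) = ((-1 : k) ^ (n * m)) • Ψ i j (w.kos n)) (w : Word Q i l) :
    ins m Ψ (fun w => w.splitSum fun b y z => F (.cons (Φ i b y) z)) w
      + w.splitSum (fun b y z => ins n Φ (fun u => F (.cons (Q.kos n (Ψ i b y)) u)) z) =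
    w.splitSum (fun b y z => F (.cons (ins m Ψ (Φ i b) y) z))
      + (defect m Φ Ψ F w + ((-1 : k) ^ (n * m)) • defect n Ψ Φ F w) := by
  rw [ins_splitSum, splitSum_add, defect, defect, ← splitSum_smul, add_assoc]
  congr 1
  · congr! 5 with b y z
    exact ins_map m Ψ (((hF.head z).mk' _).toAddMonoidHom) _ _
  · congr! 5 with b y z
    rw [← ins_smul]
    congr! 2 with u
    rw [hΨ, (hF.head _).map_smul]

theorem ins_ins_nil (i : I) (F : Word Q i i → X) (hF : IsMultilin F)
    (hΨ : ∀ i j w, Q.kos n (Ψ i j w) = ((-1 : k) ^ (n * m)) • Ψ i j (w.kos n)) :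
    ins m Ψ (ins n Φ F) (.nil i) = ins (n + m) (fun i j => ins m Ψ (Φ i j)) F (.nil i)
      + (defect m Φ Ψ F (.nil i) + ((-1 : k) ^ (n * m)) • defect n Ψ Φ F (.nil i)) :=
  ins_head_add n m Φ Ψ F hF hΨ (.nil i)

theorem ins_ins_cons {i j l : I}
    (F : Word Q i l → X) (hF : IsMultilin F)
    (hΨ : ∀ i j w, Q.kos n (Ψ i j w) = ((-1 : k) ^ (n * m)) • Ψ i j (w.kos n))
    (c : Q.Hom i j) (w : Word Q j l) :
    ins m Ψ (ins n Φ F) (.cons c w) =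
      (Word.cons c w).splitSum (fun b y z => F (.cons (ins m Ψ (Φ i b) y) z))
      + (defect m Φ Ψ F (.cons c w) + ((-1 : k) ^ (n * m)) • defect n Ψ Φ F (.cons c w))
      + ins m Ψ (ins n Φ (fun u => F (.cons (Q.kos (n + m) c) u))) w := by
  rw [← ins_head_add n m Φ Ψ F hF hΨ]
  rw [ins_cons, ins_cons]
  simp only [ins_cons, kos_kos, splitSum_add, ins_add]
  abel

/-- The Leibniz rule up to the defect, symmetric in the two coderivations. -/
theorem ins_comm {i l : I} (F : Word Q i l → X) (hF : IsMultilin F)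
    (hΦ : ∀ i j w, Q.kos m (Φ i j w) = ((-1 : k) ^ (m * n)) • Φ i j (w.kos m))
    (hΨ : ∀ i j w, Q.kos n (Ψ i j w) = ((-1 : k) ^ (n * m)) • Ψ i j (w.kos n)) (w : Word Q i l) :
    ins m Ψ (ins n Φ F) w - ins (n + m) (fun i j => ins m Ψ (Φ i j)) F w =
      ((-1 : k) ^ (n * m)) •
        (ins n Φ (ins m Ψ F) w - ins (n + m) (fun i j => ins n Φ (Ψ i j)) F w) := by
  have e := neg_one_sq (k := k) (n * m)
  induction w with
  | nil i =>
    rw [ins_ins_nil n m Φ Ψ i F hF hΨ, ins_ins_nil m n Ψ Φ i F hF hΦ, add_comm m n, mul_comm m n]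
    simp only [smul_add, smul_sub, smul_smul, e, one_smul]
    abel
  | cons c w ih =>
    have := ih _ (hF.cons (Q.kos (n + m) c))
    rw [ins_ins_cons n m Φ Ψ F hF hΨ, ins_ins_cons m n Ψ Φ F hF hΦ, ins_cons (n + m), ins_cons (n + m),
      add_comm m n, mul_comm m n]
    simp only [smul_add, smul_sub, smul_smul, e, one_smul] at this ⊢
    rw [sub_eq_sub_iff_add_eq_add] at this ⊢
    linear_combination (norm := abel) this

theorem ins_self {i l : I} (F : Word Q i l → X) (hF : IsMultilin F)
    (hΦ : ∀ i j w, Q.kos 1 (Φ i j w) = ((-1 : k) ^ (1 * 1 : ℤ)) • Φ i j (w.kos 1))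
    (w : Word Q i l) :
    ins 1 Φ (ins 1 Φ F) w = ins (1 + 1) (fun i j => ins 1 Φ (Φ i j)) F w := by
  induction w with
  | nil i => rw [ins_ins_nil 1 1 Φ Φ i F hF hΦ]; simp
  | cons c w ih =>
    rw [ins_ins_cons 1 1 Φ Φ F hF hΦ, ih _ (hF.cons _), ins_cons]; simp

theorem ins_self_eq_zero {i l : I} (F : Word Q i l → X) (hF : IsMultilin F)
    (hΦ : ∀ i j w, Q.kos 1 (Φ i j w) = ((-1 : k) ^ (1 * 1 : ℤ)) • Φ i j (w.kos 1))
    (h0 : ∀ i j w, ins 1 Φ (Φ i j) w = 0) (w : Word Q i l) :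
    ins 1 Φ (ins 1 Φ F) w = 0 := by
  rw [ins_self Φ F hF hΦ]
  have : ∀ (a b : I) (x : Word Q i a) (z : Word Q b l), F (x.append (.cons 0 z)) = 0 :=
    fun a b x z => (hF a b x z).map_zero
  rw [ins]
  simp only [h0, this, splitSum_zero]
end comm

section append
variable {X : Type*} [AddCommGroup X]

theorem append_assoc : ∀ {i j l r : I} (x : Word Q i j) (y : Word Q j l) (z : Word Q l r),
    (x.append y).append z = x.append (y.append z)
  | _, _, _, _, .nil _, _, _ => rfl
  | _, _, _, _, .cons c x, y, z => congrArg (Word.cons c) (append_assoc x y z)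

theorem kos_append (n : ℤ) : ∀ {i j l : I} (x : Word Q i j) (z : Word Q j l),
    (x.append z).kos n = (x.kos n).append (z.kos n)
  | _, _, _, .nil _, _ => rfl
  | _, _, _, .cons c x, z => congrArg (Word.cons (Q.kos n c)) (kos_append n x z)

theorem IsMultilin.append_left [Module k X] {i j l : I} {F : Word Q i l → X} (hF : IsMultilin F)
    (x : Word Q i j) : IsMultilin fun z => F (x.append z) := by
  intro a b y z
  simpa only [append_assoc] using hF a b (x.append y) z

theorem IsMultilin.append_right [Module k X] {i j l : I} {F : Word Q i l → X} (hF : IsMultilin F)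
    (z : Word Q j l) : IsMultilin fun x => F (x.append z) := by
  intro a b x y
  simp only [append_assoc, Word.append]
  exact hF a b x (y.append z)

theorem IsMultilin.kos [Module k X] {i l : I} {F : Word Q i l → X} (hF : IsMultilin F) (n : ℤ) :
    IsMultilin fun x => F (x.kos n) := by
  intro a b x z
  simp only [kos_append, Word.kos]
  exact (((hF a b (x.kos n) (z.kos n)).mk' _).comp (Q.kos n)).isLinear

theorem splitSum_append_cons {i j r l : I} (x : Word Q i j) (c : Q.Hom j r) (u : Word Q r l)
    (g : ∀ m, Word Q i m → Word Q m l → X) :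
    (x.append (.cons c u)).splitSum g =
      x.splitSum (fun m y z => g m y (z.append (.cons c u)))
      + u.splitSum (fun m y z => g m (x.append (.cons c y)) z) := by
  induction x with
  | nil i => simp only [Word.append, splitSum_cons, splitSum_nil]
  | cons e x ih => simp only [Word.append, splitSum_cons, ih]; abel

theorem ins_append_cons (n : ℤ) (Φ : ∀ i j : I, Word Q i j → Q.Hom i j) {i j r l : I}
    (F : Word Q i l → X) (x : Word Q i j) (c : Q.Hom j r) (u : Word Q r l) :
    ins n Φ F (x.append (.cons c u)) =
      ins n Φ (fun x => F (x.append (.cons c u))) x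
      + x.splitSum (fun _ x₁ x₂ => u.splitSum fun _ u₁ u₂ =>
          F ((x₁.kos n).append (.cons (Φ _ _ (x₂.append (.cons c u₁))) u₂)))
      + ins n Φ (fun u => F ((x.kos n).append (.cons (Q.kos n c) u))) u := by
  induction x with
  | nil i => simp only [Word.append, ins_cons, ins_nil, splitSum_cons, splitSum_nil, Word.kos]
  | cons d x ih =>
    simp only [Word.append, ins_cons, ih, splitSum_cons, Word.kos, splitSum_append_cons]
    abel
end append
end

section full
variable {J : Type}

/-- The full graded subquiver on a family of objects. -/
abbrev GrQuiver.full (Q : GrQuiver.{u, v} k I) (f : J → I) : GrQuiver.{u, v} k J where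
  Hom i j := Q.Hom (f i) (f j)
  gr i j := Q.gr (f i) (f j)

/-- A word in a full subquiver, seen as a word in the whole quiver. -/
def Word.incl {Q : GrQuiver.{u, v} k I} {f : J → I} :
    ∀ {i j : J}, Word (Q.full f) i j → Word Q (f i) (f j)
  | _, _, .nil i => .nil (f i)
  | _, _, .cons c w => .cons (Q := Q) c (incl w)

variable {Q : GrQuiver.{u, v} k I} {f : J → I} {X : Type*} [AddCommGroup X]

theorem full_kos (n : ℤ) {i j : J} (c : (Q.full f).Hom i j) :
    (Q.full f).kos n c = Q.kos (i := f i) (j := f j) n c := rfl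

theorem incl_append : ∀ {i j l : J} (x : Word (Q.full f) i j) (y : Word (Q.full f) j l),
    (x.append y).incl = x.incl.append y.incl
  | _, _, _, .nil _, _ => rfl
  | _, _, _, .cons c x, y => congrArg (Word.cons (Q := Q) c) (incl_append x y)

theorem incl_kos (n : ℤ) : ∀ {i j : J} (x : Word (Q.full f) i j), (x.kos n).incl = x.incl.kos n
  | _, _, .nil _ => rfl
  | _, _, .cons c x => congrArg (Word.cons (Q := Q) (Q.kos n c)) (incl_kos n x)

theorem incl_isHomog {i j : J} {x : Word (Q.full f) i j} {p : ℤ} (h : x.IsHomog p) :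
    x.incl.IsHomog p := by
  induction h with
  | nil => exact .nil _
  | cons hc _ ih => exact .cons hc ih

theorem splitSum_incl {i l : J} (w : Word (Q.full f) i l)
    (g : ∀ m, Word Q (f i) m → Word Q m (f l) → X) :
    w.incl.splitSum g = w.splitSum fun m y z => g (f m) y.incl z.incl := by
  induction w with
  | nil => rfl
  | cons c w ih => simp only [Word.incl, splitSum_cons, ih]

theorem ins_incl (n : ℤ) (Φ : ∀ i j : I, Word Q i j → Q.Hom i j) {i l : J}
    (F : Word Q (f i) (f l) → X) (w : Word (Q.full f) i l) :
    ins n Φ F w.incl =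
      ins (Q := Q.full f) n (fun i j w => Φ (f i) (f j) w.incl) (fun w => F w.incl) w := by
  simp only [ins, splitSum_incl, incl_append, incl_kos, Word.incl]

theorem IsMultilin.incl [Module k X] {i l : J} {F : Word Q (f i) (f l) → X} (hF : IsMultilin F) :
    IsMultilin fun w : Word (Q.full f) i l => F w.incl := by
  intro a b x z
  simp only [incl_append]
  exact hF (f a) (f b) x.incl z.incl
end full

section hoch

/-- A Hochschild cochain of (total) degree `n`: an element of `Homⁿ(T(C[1]), C[1])`, where `Hom` and
`T` are taken over the set of objects. -/
def GrQuiver.IsCochain (Q : GrQuiver.{u, v} k I) (n : ℤ) (Φ : ∀ i j : I, Word Q i j → Q.Hom i j) :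
    Prop :=
  (∀ i j, IsMultilin (Φ i j)) ∧ ∀ i j w p, w.IsHomog p → Φ i j w ∈ Q.gr i j (p + n + 1)

/-- The space of Hochschild cochains of degree `n`. -/
def GrQuiver.cochains (Q : GrQuiver.{u, v} k I) (n : ℤ) :
    Submodule k (∀ i j : I, Word Q i j → Q.Hom i j) where
  carrier := {Φ | Q.IsCochain n Φ}
  add_mem' h h' := ⟨fun i j => (h.1 i j).add (h'.1 i j),
    fun i j w p hw => Submodule.add_mem _ (h.2 i j w p hw) (h'.2 i j w p hw)⟩
  zero_mem' := ⟨fun _ _ _ _ _ _ => (0 : _ →ₗ[k] _).isLinear, fun _ _ _ _ _ => Submodule.zero_mem _⟩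
  smul_mem' r _ h := ⟨fun i j => (h.1 i j).comp_linear (f := fun c => r • c)
      ⟨fun _ _ => smul_add _ _ _, fun _ _ => smul_comm _ _ _⟩,
    fun i j w p hw => Submodule.smul_mem _ r (h.2 i j w p hw)⟩

/-- An A-infinity category with set of objects `I` (an A-infinity algebra if `I` has one element),
possibly curved: `d` is the family of Taylor components of a coderivation of degree `1`
of `T(C[1])` whose square is zero. -/
structure AInfCat (k : Type u) [Field k] (I : Type) extends GrQuiver.{u, v} k I where
  d : ∀ i j : I, Word toGrQuiver i j → Hom i j
  isCochain : toGrQuiver.IsCochain 1 d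
  d_sq : ∀ i j w, ins 1 d (d i j) w = 0

variable {Q : GrQuiver.{u, v} k I}

section
variable {Y : Type*} [AddCommGroup Y] [Module k Y] (n : ℤ) (Φ Ψ : ∀ i j : I, Word Q i j → Q.Hom i j)
  (r : k) {i l : I} (F : Word Q i l → Y)

theorem ins_add_cochain (hF : IsMultilin F) (w : Word Q i l) :
    ins n (fun i j w => Φ i j w + Ψ i j w) F w = ins n Φ F w + ins n Ψ F w := by
  simp only [ins, ← splitSum_add, (hF _ _ _ _).map_add]

theorem ins_sub_cochain (hF : IsMultilin F) (w : Word Q i l) :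
    ins n (fun i j w => Φ i j w - Ψ i j w) F w = ins n Φ F w - ins n Ψ F w := by
  simp only [ins, sub_eq_add_neg, ← splitSum_add, ← splitSum_neg, (hF _ _ _ _).map_add, (hF _ _ _ _).map_neg]

theorem ins_smul_cochain (hF : IsMultilin F) (w : Word Q i l) :
    ins n (fun i j w => r • Φ i j w) F w = r • ins n Φ F w := by
  simp only [ins, ← splitSum_smul, (hF _ _ _ _).map_smul]
end

theorem isCochain {n : ℤ} (Φ : Q.cochains n) : Q.IsCochain n Φ.1 := Φ.2

theorem cochains_kos {m : ℤ} {Φ} (hΦ : Q.IsCochain m Φ) (n : ℤ) (i j w) :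
    Q.kos n (Φ i j w) = ((-1 : k) ^ (n * m)) • Φ i j (w.kos n) :=
  kos_apply n m (Q' := Q) _ (hΦ.1 i j) (fun w p hw => hΦ.2 i j w p hw) w

theorem ins_mem_cochains {n m : ℤ} {Φ Ψ} (hΦ : Q.IsCochain n Φ) (hΨ : Q.IsCochain m Ψ) :
    Q.IsCochain (n + m) (fun i j => ins m Ψ (Φ i j)) :=
  ⟨fun i j => isMultilin_ins m Ψ hΨ.1 _ (hΦ.1 i j), fun i j w p hw => by
    have := ins_mem m Ψ hΨ.2 (Q.gr i j) (n + 1) (Φ i j)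
      (fun w q hw => by have := hΦ.2 i j w q hw; rwa [add_assoc] at this) w p hw
    convert this using 2; ring⟩

namespace AInfCat
variable (X : AInfCat.{u, v} k I)

/-- The full A-infinity subcategory on a family of objects. -/
abbrev full {J : Type} (f : J → I) : AInfCat.{u, v} k J where
  toGrQuiver := X.toGrQuiver.full f
  d i j w := X.d (f i) (f j) w.incl
  isCochain := ⟨fun i j => (X.isCochain.1 _ _).incl, fun i j w p hw => X.isCochain.2 _ _ _ _ (incl_isHomog hw)⟩
  d_sq i j w := by rw [← ins_incl 1 X.d]; exact X.d_sq _ _ _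

theorem d_kos (n : ℤ) (i j w) : X.kos n (X.d i j w) = ((-1 : k) ^ (n * 1)) • X.d i j (w.kos n) :=
  cochains_kos X.isCochain n i j w

theorem ins_d_d {Y : Type*} [AddCommGroup Y] [Module k Y] {i l : I}
    (F : Word X.toGrQuiver i l → Y) (hF : IsMultilin F) (w) : ins 1 X.d (ins 1 X.d F) w = 0 :=
  ins_self_eq_zero X.d F hF (X.d_kos 1) X.d_sq w

/-- The Hochschild differential `[d, Φ] = d ∘ Φ - (-1)ⁿ Φ ∘ d`. -/
noncomputable def hochD (n : ℤ) : X.cochains n →ₗ[k] X.cochains (n + 1) where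
  toFun Φ := ⟨fun i j w => ins n Φ.1 (X.d i j) w - ((-1 : k) ^ n) • ins 1 X.d (Φ.1 i j) w, by
    refine Submodule.sub_mem _ ?_ (Submodule.smul_mem _ _ (ins_mem_cochains (AInf.isCochain Φ) X.isCochain))
    rw [add_comm n]
    exact ins_mem_cochains X.isCochain (AInf.isCochain Φ)⟩
  map_add' Φ Ψ := by
    ext i j w
    have h : ins n (fun i j w => Φ.1 i j w + Ψ.1 i j w) (X.d i j) w =
        ins n Φ.1 (X.d i j) w + ins n Ψ.1 (X.d i j) w := by
      rw [← ins_add_cochain n _ _ _ (X.isCochain.1 i j)]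
    exact (congrArg₂ (· - ·) h (congrArg _ (ins_add 1 X.d (Φ.1 i j) (Ψ.1 i j) w))).trans
      (by simp only [smul_add]; exact add_sub_add_comm _ _ _ _)
  map_smul' r Φ := by
    ext i j w
    have h : ins n (fun i j w => r • Φ.1 i j w) (X.d i j) w = r • ins n Φ.1 (X.d i j) w :=
      ins_smul_cochain n _ r _ (X.isCochain.1 i j) w
    exact (congrArg₂ (· - ·) h (congrArg _ (ins_smul 1 X.d r (Φ.1 i j) w))).trans
      (by rw [smul_comm, ← smul_sub]; rfl)

theorem hochD_hochD (n : ℤ) (Φ : X.cochains n) : X.hochD (n + 1) (X.hochD n Φ) = 0 := by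
  ext i j w
  have hs := neg_one_sq (k := k) n
  have hs' : (-1 : k) ^ (n + 1) = - (-1 : k) ^ n := by
    rw [zpow_add₀ (by simp)]; simp
  have h1 := ins_comm n 1 Φ.1 X.d (X.d i j) (X.isCochain.1 i j) (by simpa [mul_comm] using cochains_kos (AInf.isCochain Φ) 1)
    (X.d_kos n) w
  have h2 := X.ins_d_d (Φ.1 i j) ((AInf.isCochain Φ).1 i j) w
  have h3 : ins n Φ.1 (ins 1 X.d (X.d i j)) w = 0 := by
    have : ins 1 X.d (X.d i j) = fun _ => 0 := by funext w; exact X.d_sq i j w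
    rw [this]; simp only [ins, splitSum_zero]
  have h4 : ins (n + 1) (X.hochD n Φ).1 (X.d i j) w =
      ins (n + 1) (fun i j => ins n Φ.1 (X.d i j)) (X.d i j) w
       - ((-1 : k) ^ n) • ins (n + 1) (fun i j => ins 1 X.d (Φ.1 i j)) (X.d i j) w := by
    rw [← ins_smul_cochain _ _ _ _ (X.isCochain.1 i j), ← ins_sub_cochain _ _ _ _ (X.isCochain.1 i j)]
    rfl
  have h5 : ins 1 X.d ((X.hochD n Φ).1 i j) w =
      ins 1 X.d (ins n Φ.1 (X.d i j)) w - ((-1 : k) ^ n) • ins 1 X.d (ins 1 X.d (Φ.1 i j)) w := by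
    rw [← ins_smul, ← ins_sub]; rfl
  change ins (n + 1) (X.hochD n Φ).1 (X.d i j) w
    - ((-1 : k) ^ (n + 1)) • ins 1 X.d ((X.hochD n Φ).1 i j) w = 0
  rw [h4, h5, hs', h2]
  rw [h3, mul_one] at h1
  rw [sub_eq_iff_eq_add] at h1
  rw [h1]
  clear h1 h4 h5 hs'
  generalize (-1 : k) ^ n = s at *
  have hs2 : ∀ c : X.Hom i j, s • s • c = c := fun c => by rw [smul_smul, hs, one_smul]
  simp only [smul_add, smul_sub, neg_smul, smul_zero, zero_sub, smul_neg, hs2]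
  abel

/-- The (completed) Hochschild cochain complex of an A-infinity category. -/
noncomputable def hochschild : CochainComplex (ModuleCat.{v} k) ℤ :=
  CochainComplex.of (fun n => ModuleCat.of k (X.cochains n)) (fun n => ModuleCat.ofHom (X.hochD n))
    fun n => by
      ext Φ : 2
      exact X.hochD_hochD n Φ

/-- Restriction of cochains to a full subcategory. -/
noncomputable def restrictCochain {J : Type} (f : J → I) (n : ℤ) : X.cochains n →ₗ[k] (X.full f).cochains n where
  toFun Φ := ⟨fun i j w => Φ.1 (f i) (f j) w.incl,
    show (X.full f).IsCochain n _ from ⟨fun _ _ => ((AInf.isCochain Φ).1 _ _).incl,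
      fun _ _ _ _ hw => (AInf.isCochain Φ).2 _ _ _ _ (incl_isHomog hw)⟩⟩
  map_add' _ _ := rfl
  map_smul' _ _ := rfl

/-- The projection of the Hochschild complex to that of a full subcategory. -/
noncomputable def restrict {J : Type} (f : J → I) : X.hochschild ⟶ (X.full f).hochschild :=
  CochainComplex.ofHom (fun n => ModuleCat.ofHom (X.restrictCochain f n)) fun n => by
    ext Φ : 2
    simp only [hochschild, CochainComplex.of_d]
    refine Subtype.ext ?_
    funext i j w
    exact (congrArg₂ (fun a b : X.Hom (f i) (f j) => a - ((-1 : k) ^ n) • b) (ins_incl n Φ.1 (X.d (f i) (f j)) w)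
      (ins_incl 1 X.d (Φ.1 (f i) (f j)) w)).symm

/-- Flat: the curvature `d⁰` vanishes. -/
def IsFlat : Prop := ∀ i, X.d i i (.nil i) = 0

variable {X}

theorem IsFlat.d_d (hX : X.IsFlat) {i j : I} (c : X.Hom i j) :
    X.d i j (.cons (X.d i j (.cons c (.nil j))) (.nil j)) = 0 := by
  have h := X.d_sq i j (.cons c (.nil j))
  simpa only [ins_cons, ins_nil, splitSum_cons, splitSum_nil, hX i, hX j,
    ((X.isCochain.1 i j).head _).map_zero, ((X.isCochain.1 i j).cons _).head _ |>.map_zero, zero_add,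
    add_zero] using h

/-- The complex `Hom i j` of a flat A-infinity category, with differential `d¹`; for an
A-infinity algebra this is its underlying complex. -/
noncomputable def IsFlat.homComplex (hX : X.IsFlat) (i j : I) : CochainComplex (ModuleCat.{v} k) ℤ :=
  CochainComplex.of (fun n => ModuleCat.of k (X.gr i j n))
    (fun n => ModuleCat.ofHom
      { toFun := fun c => ⟨X.d i j (.cons c.1 (.nil j)), by
          have := X.isCochain.2 i j _ _ (.cons c.2 (.nil j))
          convert this using 2; ring⟩
        map_add' := fun c e => Subtype.ext (((X.isCochain.1 i j).head _).map_add c.1 e.1)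
        map_smul' := fun r c => Subtype.ext (((X.isCochain.1 i j).head _).map_smul r c.1) })
    fun n => by
      ext c : 2
      exact Subtype.ext (hX.d_d c.1)

end AInfCat
end hoch

/-- Two objects. -/
inductive TwoObj : Type
  | a
  | b

open TwoObj

/-- `Cat∞(A, B, K)`: an A-infinity category with two objects `a`, `b` and `Hom b a = 0`. This is the
same as two A-infinity algebras `A = Hom a a`, `B = Hom b b` and an A-infinity `A`-`B`-bimodule
`K = Hom a b`, the bimodule structure being the restriction of `d` to `A ⊗ ⋯ ⊗ A ⊗ K ⊗ B ⊗ ⋯ ⊗ B`. -/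
structure BimodCat (k : Type u) [Field k] extends AInfCat.{u, v} k TwoObj where
  hom_b_a : ∀ c : Hom b a, c = 0

namespace BimodCat
variable (X : BimodCat.{u, v} k)

/-- The A-infinity algebra `A`. -/
abbrev algA : AInfCat.{u, v} k Unit := X.full fun _ => a
/-- The A-infinity algebra `B`. -/
abbrev algB : AInfCat.{u, v} k Unit := X.full fun _ => b

/-- The bimodule `K`. -/
abbrev K : Type v := X.Hom a b
/-- Words in `A`. -/
abbrev TA : Type v := Word X.algA.toGrQuiver () ()
/-- Words in `B`. -/
abbrev TB : Type v := Word X.algB.toGrQuiver () ()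

abbrev inclA (x : X.TA) : Word X.toGrQuiver a a := Word.incl (f := fun _ : Unit => a) x
abbrev inclB (z : X.TB) : Word X.toGrQuiver b b := Word.incl (f := fun _ : Unit => b) z

/-- Taylor components of the codifferential `d_{K,B}` of `K[1] ⊗ T(B[1])`, the right module `K`. -/
def dKB (κ : X.K) (z : X.TB) : X.K := X.d a b (.cons κ (X.inclB z))
/-- Taylor components of the codifferential `d_{A,K}` of `T(A[1]) ⊗ K[1]`, the left module `K`. -/
def dAK (x : X.TA) (κ : X.K) : X.K := X.d a b ((X.inclA x).append (.cons κ (.nil b)))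

/-- Taylor components of an endomorphism of degree `p` of the cofree right `T(B[1])`-comodule
`K[1] ⊗ T(B[1])`: an element of `Homᵖ(K[1] ⊗ T(B[1]), K[1])`. -/
structure IsEndB (p : ℤ) (f : X.K → X.TB → X.K) : Prop where
  linear : ∀ z, IsLinearMap k fun κ => f κ z
  multilin : ∀ κ, IsMultilin (f κ)
  degree : ∀ κ z q r, κ ∈ X.gr a b q → z.IsHomog r → f κ z ∈ X.gr a b (q + r + p)

/-- Taylor components of an endomorphism of degree `p` of the cofree left `T(A[1])`-comodule
`T(A[1]) ⊗ K[1]`: an element of `Homᵖ(T(A[1]) ⊗ K[1], K[1])`. -/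
structure IsEndA (p : ℤ) (f : X.TA → X.K → X.K) : Prop where
  linear : ∀ x, IsLinearMap k (f x)
  multilin : ∀ κ, IsMultilin fun x => f x κ
  degree : ∀ x κ q r, x.IsHomog q → κ ∈ X.gr a b r → f x κ ∈ X.gr a b (q + r + p)

/-- The degree `p` part of `End_{-B}(K)`. -/
def endB (p : ℤ) : Submodule k (X.K → X.TB → X.K) where
  carrier := {f | X.IsEndB p f}
  add_mem' h h' := ⟨fun z => ((h.1 z).mk' _ + (h'.1 z).mk' _).isLinear, fun κ => (h.2 κ).add (h'.2 κ),
    fun κ z q r hκ hz => Submodule.add_mem _ (h.3 κ z q r hκ hz) (h'.3 κ z q r hκ hz)⟩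
  zero_mem' := ⟨fun _ => (0 : _ →ₗ[k] _).isLinear, fun _ _ _ _ _ => (0 : _ →ₗ[k] _).isLinear,
    fun _ _ _ _ _ _ => Submodule.zero_mem _⟩
  smul_mem' s _ h := ⟨fun z => (s • (h.1 z).mk' _).isLinear,
    fun κ => (h.2 κ).comp_linear (f := fun c => s • c)
      ⟨fun _ _ => smul_add _ _ _, fun _ _ => smul_comm _ _ _⟩,
    fun κ z q r hκ hz => Submodule.smul_mem _ s (h.3 κ z q r hκ hz)⟩

/-- The degree `p` part of `End_{A-}(K)`. -/
def endA (p : ℤ) : Submodule k (X.TA → X.K → X.K) where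
  carrier := {f | X.IsEndA p f}
  add_mem' h h' := ⟨fun z => ((h.1 z).mk' _ + (h'.1 z).mk' _).isLinear, fun κ => (h.2 κ).add (h'.2 κ),
    fun κ z q r hκ hz => Submodule.add_mem _ (h.3 κ z q r hκ hz) (h'.3 κ z q r hκ hz)⟩
  zero_mem' := ⟨fun _ => (0 : _ →ₗ[k] _).isLinear, fun _ _ _ _ _ => (0 : _ →ₗ[k] _).isLinear,
    fun _ _ _ _ _ _ => Submodule.zero_mem _⟩
  smul_mem' s _ h := ⟨fun z => (s • (h.1 z).mk' _).isLinear,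
    fun κ => (h.2 κ).comp_linear (f := fun c => s • c)
      ⟨fun _ _ => smul_add _ _ _, fun _ _ => smul_comm _ _ _⟩,
    fun κ z q r hκ hz => Submodule.smul_mem _ s (h.3 κ z q r hκ hz)⟩

/-- The differential `f ↦ -[d_{K,B}, f] = -(d_{K,B} ∘ f - (-1)ᵖ f ∘ d_{K,B})` of `End_{-B}(K)`, where
`f` and `d_{K,B}` stand for the endomorphism and the coderivation of `K[1] ⊗ T(B[1])`. -/
noncomputable def diffB (p : ℤ) (f : X.K → X.TB → X.K) (κ : X.K) (z : X.TB) : X.K :=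
  -(z.splitSum (fun _ z₁ z₂ => X.dKB (f κ z₁) z₂)
    - ((-1 : k) ^ p) • (z.splitSum (fun _ z₁ z₂ => f (X.dKB κ z₁) z₂)
        + ins 1 X.algB.d (f (X.kos 1 κ)) z))

/-- The differential `f ↦ -[d_{A,K}, f] = -(d_{A,K} ∘ f - (-1)ᵖ f ∘ d_{A,K})` of `End_{A-}(K)`; it is also the
differential of the opposite algebra. -/
noncomputable def diffA (p : ℤ) (f : X.TA → X.K → X.K) (x : X.TA) (κ : X.K) : X.K :=
  -(x.splitSum (fun _ x₁ x₂ => X.dAK (x₁.kos p) (f x₂ κ))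
    - ((-1 : k) ^ p) • (x.splitSum (fun _ x₁ x₂ => f (x₁.kos 1) (X.dAK x₂ κ))
        + ins 1 X.algA.d (fun x' => f x' κ) x))


variable {X}

theorem neg_one_succ (p : ℤ) : (-1 : k) ^ (p + 1) = -(-1 : k) ^ p := by
  rw [zpow_add₀ (by simp)]; simp

theorem d_multilin (i j : TwoObj) : IsMultilin (X.d i j) := X.isCochain.1 i j

theorem inclB_multilin {Y : Type*} [AddCommGroup Y] [Module k Y] {F : Word X.toGrQuiver b b → Y}
    (hF : IsMultilin F) : IsMultilin fun z : X.TB => F (X.inclB z) :=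
  IsMultilin.incl (f := fun _ : Unit => b) (i := ()) (l := ()) hF

theorem inclA_multilin {Y : Type*} [AddCommGroup Y] [Module k Y] {F : Word X.toGrQuiver a a → Y}
    (hF : IsMultilin F) : IsMultilin fun z : X.TA => F (X.inclA z) :=
  IsMultilin.incl (f := fun _ : Unit => a) (i := ()) (l := ()) hF

theorem isEndB_dKB : X.IsEndB 1 X.dKB where
  linear z := (d_multilin a b).head _
  multilin κ := inclB_multilin ((d_multilin a b).cons κ)
  degree κ z q r hκ hz := by
    have := X.isCochain.2 a b _ _ (.cons hκ (incl_isHomog hz))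
    have e : q - 1 + r + 1 + 1 = q + r + 1 := by ring
    rw [e] at this
    exact this

theorem isEndA_dAK : X.IsEndA 1 X.dAK where
  linear x := d_multilin a b _ _ (X.inclA x) (.nil b)
  multilin κ := inclA_multilin ((d_multilin a b).append_right (.cons κ (.nil b)))
  degree x κ q r hx hκ := by
    have := X.isCochain.2 a b _ _ ((incl_isHomog hx).append (.cons hκ (.nil b)))
    have e : q + (r - 1 + 0) + 1 + 1 = q + r + 1 := by ring
    rw [e] at this
    exact this

theorem dKB_dKB (hA : X.algA.IsFlat) (κ : X.K) (z : X.TB) :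
    z.splitSum (fun _ z₁ z₂ => X.dKB (X.dKB κ z₁) z₂) + ins 1 X.algB.d (X.dKB (X.kos 1 κ)) z = 0 := by
  have h := X.d_sq a b (.cons κ (X.inclB z))
  have h0 : X.d a a (.nil a) = 0 := hA ()
  have e1 := splitSum_incl (Q := X.toGrQuiver) (f := fun _ : Unit => b) (i := ()) (l := ()) z
    (fun m y u => X.d a b (.cons (X.d a m (.cons κ y)) u))
  have e2 := ins_incl 1 X.d (f := fun _ : Unit => b) (i := ()) (l := ())
    (fun u => X.d a b (.cons (X.kos 1 κ) u)) z
  rw [ins_cons, splitSum_cons, h0, ((d_multilin a b).head _).map_zero, zero_add] at h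
  exact (congrArg₂ (· + ·) e1 e2).symm.trans h

theorem dAK_dAK (hB : X.algB.IsFlat) (x : X.TA) (κ : X.K) :
    x.splitSum (fun _ x₁ x₂ => X.dAK (x₁.kos 1) (X.dAK x₂ κ)) + ins 1 X.algA.d (fun x => X.dAK x κ) x = 0 := by
  have h := X.d_sq a b ((X.inclA x).append (.cons κ (.nil b)))
  have h0 : X.d b b (.nil b) = 0 := hB ()
  rw [ins_append_cons, ins_nil, h0, (((d_multilin a b).append_left _).cons _ |>.head _).map_zero, add_zero] at h
  simp only [splitSum_nil] at h
  have e1 := splitSum_incl (Q := X.toGrQuiver) (f := fun _ : Unit => a) (i := ()) (l := ()) x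
    (fun m x₁ x₂ => X.d a b ((x₁.kos 1).append (.cons (X.d m b (x₂.append (.cons κ (.nil b)))) (.nil b))))
  have e2 := ins_incl 1 X.d (f := fun _ : Unit => a) (i := ()) (l := ())
    (fun u => X.d a b (u.append (.cons κ (.nil b)))) x
  simp only [← incl_kos] at e1
  rw [add_comm] at h
  exact (congrArg₂ (· + ·) e1 e2).symm.trans h

theorem IsEndB.kos {p : ℤ} {f : X.K → X.TB → X.K} (hf : X.IsEndB p f) (κ : X.K) (z : X.TB) :
    X.kos 1 (f κ z) = ((-1 : k) ^ p) • f (X.kos 1 κ) (z.kos 1) := by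
  induction κ using hom_induction with
  | h0 => simp [(hf.linear _).map_zero]
  | hh q κ hκ =>
    rw [kos_apply 1 (q + p - 1) (Q' := X.toGrQuiver) (f κ) (hf.multilin κ)
      (fun w r hw => by have := hf.degree κ w q r hκ hw; convert this using 2; ring),
      kos_of_mem _ hκ, (hf.linear _).map_smul, smul_smul, ← zpow_add₀ (by simp)]
    congr 2; ring
  | ha c e hc he => simp only [map_add, (hf.linear _).map_add, hc, he, smul_add]

theorem diffB_isEndB {p : ℤ} {f : X.K → X.TB → X.K} (hf : X.IsEndB p f) :
    X.IsEndB (p + 1) (X.diffB p f) := by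
  have hd := isEndB_dKB (X := X)
  have l1 : ∀ z : X.TB, IsLinearMap k fun κ => z.splitSum (fun _ z₁ z₂ => X.dKB (f κ z₁) z₂) := fun z =>
    isLinearMap_splitSum z _ fun m y u => (((hd.linear u).mk' _).comp ((hf.linear y).mk' _)).isLinear
  have l2 : ∀ z : X.TB, IsLinearMap k fun κ => z.splitSum (fun _ z₁ z₂ => f (X.dKB κ z₁) z₂) := fun z =>
    isLinearMap_splitSum z _ fun m y u => (((hf.linear u).mk' _).comp ((hd.linear y).mk' _)).isLinear
  have l3 : ∀ z : X.TB, IsLinearMap k fun κ => ins 1 X.algB.d (f (X.kos 1 κ)) z := fun z =>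
    isLinearMap_ins 1 X.algB.d z (fun κ => f (X.kos 1 κ)) fun w => (((hf.linear w).mk' _).comp (X.kos 1)).isLinear
  refine ⟨fun z => ?_, fun κ => ?_, fun κ z q r hκ hz => ?_⟩
  · exact (-((l1 z).mk' _ - ((-1 : k) ^ p) • ((l2 z).mk' _ + (l3 z).mk' _))).isLinear
  · have m1 : IsMultilin fun z : X.TB => z.splitSum (fun _ z₁ z₂ => X.dKB (f κ z₁) z₂) :=
      isMultilin_splitSum _ (fun m u => (hf.multilin κ).comp_linear (hd.linear u)) (fun m y => hd.multilin _)
    have m2 : IsMultilin fun z : X.TB => z.splitSum (fun _ z₁ z₂ => f (X.dKB κ z₁) z₂) :=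
      isMultilin_splitSum _ (fun m u => (hd.multilin κ).comp_linear (hf.linear u)) (fun m y => hf.multilin _)
    have m3 := isMultilin_ins 1 X.algB.d X.algB.isCochain.1 _ (hf.multilin (X.kos 1 κ))
    intro i j x z
    exact (-((m1 i j x z).mk' _ - ((-1 : k) ^ p) • ((m2 i j x z).mk' _ + (m3 i j x z).mk' _))).isLinear
  · refine Submodule.neg_mem _ (Submodule.sub_mem _ ?_ (Submodule.smul_mem _ _ (Submodule.add_mem _ ?_ ?_)))
    · refine splitSum_mem hz _ _ fun m y u s t hy hu h => ?_
      have := hd.degree _ _ _ _ (hf.degree _ _ _ _ hκ hy) hu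
      convert this using 2; omega
    · refine splitSum_mem hz _ _ fun m y u s t hy hu h => ?_
      have := hf.degree _ _ _ _ (hd.degree _ _ _ _ hκ hy) hu
      convert this using 2; omega
    · have := ins_mem 1 X.algB.d X.algB.isCochain.2 (X.gr a b) (q + p) (f (X.kos 1 κ))
        (fun w s hw => by
          have := hf.degree _ _ _ _ (kos_mem 1 hκ) hw
          convert this using 2; ring) z r hz
      convert this using 2; ring

theorem diffA_isEndA {p : ℤ} {f : X.TA → X.K → X.K} (hf : X.IsEndA p f) :
    X.IsEndA (p + 1) (X.diffA p f) := by
  have hd := isEndA_dAK (X := X)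
  have l1 : ∀ x : X.TA, IsLinearMap k fun κ => x.splitSum (fun _ z₁ z₂ => X.dAK (z₁.kos p) (f z₂ κ)) := fun z =>
    isLinearMap_splitSum z _ fun m y u => (((hd.linear _).mk' _).comp ((hf.linear _).mk' _)).isLinear
  have l2 : ∀ x : X.TA, IsLinearMap k fun κ => x.splitSum (fun _ z₁ z₂ => f (z₁.kos 1) (X.dAK z₂ κ)) := fun z =>
    isLinearMap_splitSum z _ fun m y u => (((hf.linear _).mk' _).comp ((hd.linear _).mk' _)).isLinear
  have l3 : ∀ x : X.TA, IsLinearMap k fun κ => ins 1 X.algA.d (fun x => f x κ) x := fun z =>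
    isLinearMap_ins 1 X.algA.d z (fun κ x => f x κ) fun w => hf.linear w
  refine ⟨fun z => ?_, fun κ => ?_, fun z κ r q hz hκ => ?_⟩
  · exact (-((l1 z).mk' _ - ((-1 : k) ^ p) • ((l2 z).mk' _ + (l3 z).mk' _))).isLinear
  · have m1 : IsMultilin fun x : X.TA => x.splitSum (fun _ z₁ z₂ => X.dAK (z₁.kos p) (f z₂ κ)) :=
      isMultilin_splitSum _ (fun m u => (hd.multilin _).kos p)
        (fun m y => (hf.multilin κ).comp_linear (hd.linear _))
    have m2 : IsMultilin fun x : X.TA => x.splitSum (fun _ z₁ z₂ => f (z₁.kos 1) (X.dAK z₂ κ)) :=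
      isMultilin_splitSum _ (fun m u => (hf.multilin _).kos 1)
        (fun m y => (hd.multilin κ).comp_linear (hf.linear _))
    have m3 := isMultilin_ins 1 X.algA.d X.algA.isCochain.1 _ (hf.multilin κ)
    intro i j x z
    exact (-((m1 i j x z).mk' _ - ((-1 : k) ^ p) • ((m2 i j x z).mk' _ + (m3 i j x z).mk' _))).isLinear
  · refine Submodule.neg_mem _ (Submodule.sub_mem _ ?_ (Submodule.smul_mem _ _ (Submodule.add_mem _ ?_ ?_)))
    · refine splitSum_mem hz _ _ fun m y u s t hy hu h => ?_
      have := hd.degree _ _ _ _ (hy.kos p) (hf.degree _ _ _ _ hu hκ)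
      convert this using 2; omega
    · refine splitSum_mem hz _ _ fun m y u s t hy hu h => ?_
      have := hf.degree _ _ _ _ (hy.kos 1) (hd.degree _ _ _ _ hu hκ)
      convert this using 2; omega
    · have := ins_mem 1 X.algA.d X.algA.isCochain.2 (X.gr a b) (q + p) (fun x => f x κ)
        (fun w s hw => by
          have := hf.degree _ _ _ _ hw hκ
          convert this using 2; ring) z r hz
      convert this using 2; ring


/-- `d_{K,B} ∘ f`, outer part. -/
noncomputable def rA (X : BimodCat.{u, v} k) (f : X.K → X.TB → X.K) (κ : X.K) (z : X.TB) : X.K :=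
  z.splitSum (fun _ z₁ z₂ => X.dKB (f κ z₁) z₂)
/-- `f ∘ d_{K,B}`, the part where `d` takes the letter of `K`. -/
noncomputable def rP (X : BimodCat.{u, v} k) (f : X.K → X.TB → X.K) (κ : X.K) (z : X.TB) : X.K :=
  z.splitSum (fun _ z₁ z₂ => f (X.dKB κ z₁) z₂)
/-- `f ∘ d_{K,B}`, the part where `d` takes letters of `B` only. -/
noncomputable def rQ (X : BimodCat.{u, v} k) (f : X.K → X.TB → X.K) (κ : X.K) (z : X.TB) : X.K :=
  ins 1 X.algB.d (f (X.kos 1 κ)) z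

theorem splitSum_linear {J : Type} {Q : GrQuiver.{u, v} k J} {Y Z : Type*} [AddCommGroup Y] [Module k Y]
    [AddCommGroup Z] [Module k Z] {f : Y → Z} (hf : IsLinearMap k f) {i l : J} (w : Word Q i l)
    (g : ∀ m, Word Q i m → Word Q m l → Y) :
    f (w.splitSum g) = w.splitSum (fun m y z => f (g m y z)) :=
  splitSum_map (hf.mk' f).toAddMonoidHom w g

theorem ins_linear {J : Type} {Q : GrQuiver.{u, v} k J} {Y Z : Type*} [AddCommGroup Y] [Module k Y]
    [AddCommGroup Z] [Module k Z] {f : Y → Z} (hf : IsLinearMap k f) {i l : J} (n : ℤ) (Φ)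
    (F : Word Q i l → Y) (w : Word Q i l) :
    ins n Φ (fun w => f (F w)) w = f (ins n Φ F w) :=
  ins_map n Φ (hf.mk' f).toAddMonoidHom F w

theorem diffB_diffB (hA : X.algA.IsFlat) {p : ℤ} {f : X.K → X.TB → X.K} (hf : X.IsEndB p f)
    (κ : X.K) (z : X.TB) : X.diffB (p + 1) (X.diffB p f) κ z = 0 := by
  have hd := isEndB_dKB (X := X)
  have hR := dKB_dKB hA
  have hR' : ∀ κ (z : X.TB), z.splitSum (fun _ z₁ z₂ => X.dKB (X.dKB κ z₁) z₂)
      = - ins 1 X.algB.d (X.dKB (X.kos 1 κ)) z := fun κ z => eq_neg_of_add_eq_zero_left (hR κ z)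
  have hs := neg_one_sq (k := k) p
  set T : X.K := z.splitSum fun _ y v => ins 1 X.algB.d (X.dKB (X.kos 1 (f κ y))) v with hT
  have hAA : X.rA (X.rA f) κ z = -T := by
    simp only [rA, splitSum_linear (hd.linear _)]
    rw [← splitSum_assoc z (fun _ _ y₁ y₂ u => X.dKB (X.dKB (f κ y₁) y₂) u), hT, ← splitSum_neg]
    exact congrArg _ (by funext m y v; exact hR' _ _)
  have hAP : X.rA (X.rP f) κ z = X.rP (X.rA f) κ z := by
    simp only [rA, rP, splitSum_linear (hd.linear _)]
    exact (splitSum_assoc z (fun _ _ y₁ y₂ u => X.dKB (f (X.dKB κ y₁) y₂) u)).symm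
  have hQA : X.rQ (X.rA f) κ z = X.rA (X.rQ f) κ z + ((-1 : k) ^ p) • T := by
    simp only [rA, rQ]
    have := ins_splitSum 1 X.algB.d z (fun _ y u => X.dKB (f (X.kos 1 κ) y) u)
    refine this.trans ?_
    rw [splitSum_add, hT, ← splitSum_smul]
    congr 1
    · exact congrArg _ (by funext m y v; exact ins_linear (hd.linear v) 1 X.algB.d _ _)
    · refine congrArg _ (by
        funext m y v
        rw [← ins_smul]
        refine congrArg (fun F => ins 1 X.algB.d F v) ?_
        funext u
        rw [hf.kos, (hd.linear u).map_smul, smul_smul, hs, one_smul])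
  have hPQ : X.rP (X.rP f) κ z + X.rP (X.rQ f) κ z + X.rQ (X.rP f) κ z + X.rQ (X.rQ f) κ z = 0 := by
    have hQQ : X.rQ (X.rQ f) κ z = 0 := X.algB.ins_d_d _ (hf.multilin _) z
    have e1 : X.rP (X.rP f) κ z = - z.splitSum fun _ y u => f (ins 1 X.algB.d (X.dKB (X.kos 1 κ)) y) u := by
      simp only [rP]
      refine (splitSum_assoc z (fun _ _ y₁ y₂ u => f (X.dKB (X.dKB κ y₁) y₂) u)).trans ?_
      rw [← splitSum_neg]
      refine congrArg _ ?_
      funext m y u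
      rw [← splitSum_linear (hf.linear u), hR', (hf.linear u).map_neg]
    have e2 : X.rQ (X.rP f) κ z = (z.splitSum fun _ y u => f (ins 1 X.algB.d (X.dKB (X.kos 1 κ)) y) u)
        - X.rP (X.rQ f) κ z := by
      simp only [rP, rQ]
      have := ins_splitSum 1 X.algB.d z (fun _ y u => f (X.dKB (X.kos 1 κ) y) u)
      refine this.trans ?_
      rw [splitSum_add, sub_eq_add_neg, ← splitSum_neg]
      congr 1
      · exact congrArg _ (by funext m y v; exact ins_linear (hf.linear v) 1 X.algB.d _ _)
      · refine congrArg _ (by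
          funext m y v
          rw [← ins_neg]
          refine congrArg (fun F => ins 1 X.algB.d F v) ?_
          funext u
          rw [hd.kos, (hf.linear u).map_smul]
          simp)
    rw [e1, e2, hQQ]; abel
  have lA : X.rA (X.diffB p f) κ z =
      -(X.rA (X.rA f) κ z - ((-1 : k) ^ p) • (X.rA (X.rP f) κ z + X.rA (X.rQ f) κ z)) := by
    simp only [rA]
    rw [← splitSum_add, ← splitSum_smul, sub_eq_add_neg, ← splitSum_neg, ← splitSum_add, ← splitSum_neg]
    refine congrArg _ ?_
    funext m y u
    have L := (hd.linear u).mk' _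
    change X.dKB (-(X.rA f κ y - _ • (X.rP f κ y + X.rQ f κ y))) u = _
    simp only [sub_eq_add_neg, (hd.linear u).map_neg, (hd.linear u).map_add, (hd.linear u).map_smul]
    rfl
  have lP : X.rP (X.diffB p f) κ z =
      -(X.rP (X.rA f) κ z - ((-1 : k) ^ p) • (X.rP (X.rP f) κ z + X.rP (X.rQ f) κ z)) := by
    simp only [rP]
    rw [← splitSum_add, ← splitSum_smul, sub_eq_add_neg, ← splitSum_neg, ← splitSum_add, ← splitSum_neg]
    simp only [← sub_eq_add_neg]
    rfl
  have lQ : X.rQ (X.diffB p f) κ z =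
      -(X.rQ (X.rA f) κ z - ((-1 : k) ^ p) • (X.rQ (X.rP f) κ z + X.rQ (X.rQ f) κ z)) := by
    simp only [rQ]
    rw [← ins_add, ← ins_smul, ← ins_sub, ← ins_neg]
    rfl
  change -(X.rA (X.diffB p f) κ z - ((-1 : k) ^ (p + 1)) • (X.rP (X.diffB p f) κ z + X.rQ (X.diffB p f) κ z)) = 0
  rw [lA, lP, lQ, hAA, hAP, hQA, neg_one_succ]
  generalize (-1 : k) ^ p = s at *
  have hs2 : ∀ c : X.K, s • s • c = c := fun c => by rw [smul_smul, hs, one_smul]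
  simp only [smul_add, smul_sub, neg_smul, smul_neg, hs2]
  rw [← neg_eq_zero, ← hPQ]
  abel

/-- `d_{A,K} ∘ f`, outer part. -/
noncomputable def lA (X : BimodCat.{u, v} k) (p : ℤ) (f : X.TA → X.K → X.K) (κ : X.K) (x : X.TA) : X.K :=
  x.splitSum (fun _ x₁ x₂ => X.dAK (x₁.kos p) (f x₂ κ))
/-- `f ∘ d_{A,K}`, the part where `d` takes the letter of `K`. -/
noncomputable def lP (X : BimodCat.{u, v} k)  (f : X.TA → X.K → X.K) (κ : X.K) (x : X.TA) : X.K :=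
  x.splitSum (fun _ x₁ x₂ => f (x₁.kos 1) (X.dAK x₂ κ))
/-- `f ∘ d_{A,K}`, the part where `d` takes letters of `A` only. -/
noncomputable def lQ (X : BimodCat.{u, v} k)  (f : X.TA → X.K → X.K) (κ : X.K) (x : X.TA) : X.K :=
  ins 1 X.algA.d (fun x' => f x' κ) x

theorem diffA_diffA (hB : X.algB.IsFlat) {p : ℤ} {f : X.TA → X.K → X.K} (hf : X.IsEndA p f)
    (x : X.TA) (κ : X.K) : X.diffA (p + 1) (X.diffA p f) x κ = 0 := by
  have hd := isEndA_dAK (X := X)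
  have hR' : ∀ κ (x : X.TA), x.splitSum (fun _ x₁ x₂ => X.dAK (x₁.kos 1) (X.dAK x₂ κ))
      = - ins 1 X.algA.d (fun x => X.dAK x κ) x := fun κ x => eq_neg_of_add_eq_zero_left (dAK_dAK hB x κ)
  have hs := neg_one_sq (k := k) p
  have hk : ∀ (n : ℤ) (F : X.TA → X.K), IsMultilin F → ∀ w : X.TA,
      ins 1 X.algA.d F (w.kos n) = ((-1 : k) ^ n) • ins 1 X.algA.d (fun u => F (u.kos n)) w := by
    intro n F hF w
    have := ins_kos n 1 X.algA.d F hF (X.algA.d_kos n) w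
    rwa [mul_one] at this
  set T : X.K := x.splitSum fun _ u v => ins 1 X.algA.d (fun y => X.dAK y (f v κ)) (u.kos p) with hT
  have hAA : X.lA (p + 1) (fun x κ => X.lA p f κ x) κ x = -T := by
    simp only [lA, splitSum_linear (hd.linear _)]
    refine (splitSum_assoc x
      (fun _ _ y₁ y₂ u => X.dAK (y₁.kos (p + 1)) (X.dAK (y₂.kos p) (f u κ)))).trans ?_
    rw [hT, ← splitSum_neg]
    refine congrArg _ ?_
    funext m y v
    have := hR' (f v κ) (y.kos p)
    rw [splitSum_kos] at this
    simpa only [word_kos_kos, add_comm 1 p] using this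
  have hAP : X.lA (p + 1) (fun x κ => X.lP f κ x) κ x = X.lP (fun x κ => X.lA p f κ x) κ x := by
    simp only [lA, lP, splitSum_linear (hd.linear _)]
    refine (splitSum_assoc x
      (fun _ _ y₁ y₂ u => X.dAK (y₁.kos (p + 1)) (f (y₂.kos 1) (X.dAK u κ)))).trans ?_
    refine congrArg _ ?_
    funext m y v
    rw [splitSum_kos]
    simp only [word_kos_kos]
  have hQA : X.lQ (fun x κ => X.lA p f κ x) κ x =
      X.lA (p + 1) (fun x κ => X.lQ f κ x) κ x + ((-1 : k) ^ p) • T := by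
    simp only [lA, lQ]
    have := ins_splitSum 1 X.algA.d x (fun _ y u => X.dAK (y.kos p) (f u κ))
    refine this.trans ?_
    rw [splitSum_add, hT, ← splitSum_smul, add_comm]
    congr 1
    · refine congrArg _ ?_
      funext m y v
      simp only [word_kos_kos, add_comm p 1]
      exact ins_linear (hd.linear _) 1 X.algA.d _ _
    · refine congrArg _ ?_
      funext m y v
      rw [hk p _ (hd.multilin _), smul_smul, hs, one_smul]
  have hPQ : X.lP (fun x κ => X.lP f κ x) κ x + X.lP (fun x κ => X.lQ f κ x) κ x
      + X.lQ (fun x κ => X.lP f κ x) κ x + X.lQ (fun x κ => X.lQ f κ x) κ x = 0 := by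
    have hQQ : X.lQ (fun x κ => X.lQ f κ x) κ x = 0 := X.algA.ins_d_d _ (hf.multilin _) x
    have e1 : X.lP (fun x κ => X.lP f κ x) κ x =
        - x.splitSum fun _ y u => f (y.kos 2) (ins 1 X.algA.d (fun x => X.dAK x κ) u) := by
      simp only [lP, splitSum_kos]
      refine (splitSum_assoc x
        (fun _ _ y₁ y₂ u => f ((y₁.kos 1).kos 1) (X.dAK (y₂.kos 1) (X.dAK u κ)))).symm.trans ?_
      rw [← splitSum_neg]
      refine congrArg _ ?_
      funext m y u
      rw [← splitSum_linear (hf.linear _), hR', (hf.linear _).map_neg, word_kos_kos]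
      rfl
    have e2 : X.lQ (fun x κ => X.lP f κ x) κ x =
        (x.splitSum fun _ y u => f (y.kos 2) (ins 1 X.algA.d (fun x => X.dAK x κ) u))
        - X.lP (fun x κ => X.lQ f κ x) κ x := by
      simp only [lP, lQ]
      have := ins_splitSum 1 X.algA.d x (fun _ y u => f (y.kos 1) (X.dAK u κ))
      refine this.trans ?_
      rw [splitSum_add, sub_eq_add_neg, ← splitSum_neg, add_comm]
      congr 1
      · refine congrArg _ ?_
        funext m y v
        rw [word_kos_kos]
        exact ins_linear (hf.linear _) 1 X.algA.d _ _
      · refine congrArg _ ?_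
        funext m y v
        rw [hk 1 _ (hf.multilin _)]
        simp
    rw [e1, e2, hQQ]; abel
  have eA : X.lA (p + 1) (X.diffA p f) κ x =
      -(X.lA (p + 1) (fun x κ => X.lA p f κ x) κ x
        - ((-1 : k) ^ p) • (X.lA (p + 1) (fun x κ => X.lP f κ x) κ x + X.lA (p + 1) (fun x κ => X.lQ f κ x) κ x)) := by
    simp only [lA]
    rw [← splitSum_add, ← splitSum_smul, sub_eq_add_neg, ← splitSum_neg, ← splitSum_add, ← splitSum_neg]
    refine congrArg _ ?_
    funext m y u
    change X.dAK _ (-(X.lA p f κ u - _ • (X.lP f κ u + X.lQ f κ u))) = _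
    simp only [sub_eq_add_neg, (hd.linear _).map_neg, (hd.linear _).map_add, (hd.linear _).map_smul]
    rfl
  have eP : X.lP (X.diffA p f) κ x =
      -(X.lP (fun x κ => X.lA p f κ x) κ x
        - ((-1 : k) ^ p) • (X.lP (fun x κ => X.lP f κ x) κ x + X.lP (fun x κ => X.lQ f κ x) κ x)) := by
    simp only [lP]
    rw [← splitSum_add, ← splitSum_smul, sub_eq_add_neg, ← splitSum_neg, ← splitSum_add, ← splitSum_neg]
    simp only [← sub_eq_add_neg]
    rfl
  have eQ : X.lQ (X.diffA p f) κ x =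
      -(X.lQ (fun x κ => X.lA p f κ x) κ x
        - ((-1 : k) ^ p) • (X.lQ (fun x κ => X.lP f κ x) κ x + X.lQ (fun x κ => X.lQ f κ x) κ x)) := by
    simp only [lQ]
    rw [← ins_add, ← ins_smul, ← ins_sub, ← ins_neg]
    rfl
  change -(X.lA (p + 1) (X.diffA p f) κ x
    - ((-1 : k) ^ (p + 1)) • (X.lP (X.diffA p f) κ x + X.lQ (X.diffA p f) κ x)) = 0
  rw [eA, eP, eQ, hAA, hAP, hQA, neg_one_succ]
  generalize (-1 : k) ^ p = s at *
  have hs2 : ∀ c : X.K, s • s • c = c := fun c => by rw [smul_smul, hs, one_smul]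
  simp only [smul_add, smul_sub, neg_smul, smul_neg, hs2]
  rw [← neg_eq_zero, ← hPQ]
  abel


theorem isEndB {p : ℤ} (f : X.endB p) : X.IsEndB p f.1 := f.2
theorem isEndA {p : ℤ} (f : X.endA p) : X.IsEndA p f.1 := f.2

theorem diffB_linear (p : ℤ) (κ : X.K) (z : X.TB) : IsLinearMap k fun f => X.diffB p f κ z := by
  have hd := isEndB_dKB (X := X)
  have l1 : IsLinearMap k fun f : X.K → X.TB → X.K => z.splitSum (fun _ z₁ z₂ => X.dKB (f κ z₁) z₂) :=
    isLinearMap_splitSum z _ fun m y u => ⟨fun f g => (hd.linear u).map_add _ _, fun r f => (hd.linear u).map_smul _ _⟩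
  have l2 : IsLinearMap k fun f : X.K → X.TB → X.K => z.splitSum (fun _ z₁ z₂ => f (X.dKB κ z₁) z₂) :=
    isLinearMap_splitSum z _ fun m y u => ⟨fun f g => rfl, fun r f => rfl⟩
  have l3 : IsLinearMap k fun f : X.K → X.TB → X.K => ins 1 X.algB.d (f (X.kos 1 κ)) z :=
    isLinearMap_ins 1 X.algB.d z (fun f : X.K → X.TB → X.K => f (X.kos 1 κ)) fun w => ⟨fun f g => rfl, fun r f => rfl⟩
  exact (-(l1.mk' _ - ((-1 : k) ^ p) • (l2.mk' _ + l3.mk' _))).isLinear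

theorem diffA_linear (p : ℤ) (x : X.TA) (κ : X.K) : IsLinearMap k fun f => X.diffA p f x κ := by
  have hd := isEndA_dAK (X := X)
  have l1 : IsLinearMap k fun f : X.TA → X.K → X.K => x.splitSum (fun _ x₁ x₂ => X.dAK (x₁.kos p) (f x₂ κ)) :=
    isLinearMap_splitSum x _ fun m y u => ⟨fun f g => (hd.linear _).map_add _ _, fun r f => (hd.linear _).map_smul _ _⟩
  have l2 : IsLinearMap k fun f : X.TA → X.K → X.K => x.splitSum (fun _ x₁ x₂ => f (x₁.kos 1) (X.dAK x₂ κ)) :=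
    isLinearMap_splitSum x _ fun m y u => ⟨fun f g => rfl, fun r f => rfl⟩
  have l3 : IsLinearMap k fun f : X.TA → X.K → X.K => ins 1 X.algA.d (fun x => f x κ) x :=
    isLinearMap_ins 1 X.algA.d x (fun (f : X.TA → X.K → X.K) x => f x κ) fun w => ⟨fun f g => rfl, fun r f => rfl⟩
  exact (-(l1.mk' _ - ((-1 : k) ^ p) • (l2.mk' _ + l3.mk' _))).isLinear

/-- The complex `End_{-B}(K)`. -/
noncomputable def endBComplex (hA : X.algA.IsFlat) : CochainComplex (ModuleCat.{v} k) ℤ :=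
  CochainComplex.of (fun p => ModuleCat.of k (X.endB p))
    (fun p => ModuleCat.ofHom
      { toFun := fun f => ⟨X.diffB p f.1, diffB_isEndB (isEndB f)⟩
        map_add' := fun f g => Subtype.ext <| by
          funext κ z; exact (diffB_linear p κ z).map_add f.1 g.1
        map_smul' := fun r f => Subtype.ext <| by
          funext κ z; exact (diffB_linear p κ z).map_smul r f.1 })
    fun p => by
      ext f : 2
      refine Subtype.ext ?_
      funext κ z
      exact diffB_diffB hA (isEndB f) κ z

/-- The complex `End_{A-}(K)`, also underlying `End_{A-}(K)ᵒᵖ`. -/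
noncomputable def endAComplex (hB : X.algB.IsFlat) : CochainComplex (ModuleCat.{v} k) ℤ :=
  CochainComplex.of (fun p => ModuleCat.of k (X.endA p))
    (fun p => ModuleCat.ofHom
      { toFun := fun f => ⟨X.diffA p f.1, diffA_isEndA (isEndA f)⟩
        map_add' := fun f g => Subtype.ext <| by
          funext x κ; exact (diffA_linear p x κ).map_add f.1 g.1
        map_smul' := fun r f => Subtype.ext <| by
          funext x κ; exact (diffA_linear p x κ).map_smul r f.1 })
    fun p => by
      ext f : 2
      refine Subtype.ext ?_
      funext x κ
      exact diffA_diffA hB (isEndA f) x κ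

/-- Taylor components of the derived left action:
`L_A(a₁ | ⋯ | aₘ)(κ | b₁ | ⋯ | bₙ) = d_K(a₁ | ⋯ | aₘ | κ | b₁ | ⋯ | bₙ)`. -/
def actL (x : X.TA) (κ : X.K) (z : X.TB) : X.K := X.d a b ((X.inclA x).append (.cons κ (X.inclB z)))

/-- A single letter of `A`. -/
def letterA (c : X.Hom a a) : X.TA := .cons (i := ()) (j := ()) c (.nil ())
/-- A single letter of `B`. -/
def letterB (c : X.Hom b b) : X.TB := .cons (i := ()) (j := ()) c (.nil ())

/-- Taylor components of the derived right action, on a word `y` in `B` of suspended degree `σ`: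
`R_B(y)(x | κ) = (-1) ^ (σ * |x | κ|) d_K(x | κ | y)`. -/
noncomputable def actR (σ : ℤ) (y : X.TB) (x : X.TA) (κ : X.K) : X.K :=
  X.d a b (((X.inclA x).kos σ).append (.cons (X.kos σ κ) (X.inclB y)))

theorem actL_isEndB {n : ℤ} {c : X.Hom a a} (hc : c ∈ X.gr a a n) :
    X.IsEndB n (X.actL (X.letterA c)) where
  linear z := d_multilin a b _ _ (X.inclA (X.letterA c)) (X.inclB z)
  multilin κ := inclB_multilin (((d_multilin a b).append_left _).cons κ)
  degree κ z q r hκ hz := by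
    have h := (incl_isHomog hz)
    have := X.isCochain.2 a b _ _ (.cons hc (.cons hκ (incl_isHomog hz)))
    have e : n - 1 + (q - 1 + r) + 1 + 1 = q + r + n := by ring
    rw [e] at this
    exact this

theorem actR_isEndA {n : ℤ} {c : X.Hom b b} (hc : c ∈ X.gr b b n) :
    X.IsEndA n (X.actR (n - 1) (X.letterB c)) where
  linear x := (((d_multilin a b _ _ ((X.inclA x).kos (n - 1)) (X.inclB (X.letterB c))).mk' _).comp (X.kos (n - 1))).isLinear
  multilin κ := inclA_multilin (((d_multilin a b).append_right _).kos (n - 1))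
  degree x κ q r hx hκ := by
    have := X.isCochain.2 a b _ _ (((incl_isHomog hx).kos (n - 1)).append
      (.cons (kos_mem (n - 1) hκ) (.cons hc (.nil b))))
    have e : q + (r - 1 + (n - 1 + 0)) + 1 + 1 = q + r + n := by ring
    rw [e] at this
    exact this

theorem actL_comm (hA : X.algA.IsFlat) {n : ℤ} {c : X.Hom a a} (hc : c ∈ X.gr a a n)
    (κ : X.K) (z : X.TB) :
    X.diffB n (X.actL (X.letterA c)) κ z = X.actL (X.letterA (X.d a a (.cons c (.nil a)))) κ z := by
  have h := X.d_sq a b (.cons c (.cons κ (X.inclB z)))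
  have h0 : X.d a a (.nil a) = 0 := hA ()
  have e1 := splitSum_incl (Q := X.toGrQuiver) (f := fun _ : Unit => b) (i := ()) (l := ()) z
    (fun m y u => X.d a b (.cons (X.d a m (.cons c (.cons κ y))) u))
  have e2 := splitSum_incl (Q := X.toGrQuiver) (f := fun _ : Unit => b) (i := ()) (l := ()) z
    (fun m y u => X.d a b (.cons c (.cons (X.d a m (.cons κ y)) u)))
  have e3 := ins_incl 1 X.d (f := fun _ : Unit => b) (i := ()) (l := ())
    (fun u => X.d a b (.cons c (.cons (X.kos 1 κ) u))) z
  have hk : X.kos 1 c = -((-1 : k) ^ n) • c := by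
    rw [kos_of_mem 1 hc, one_mul, sub_eq_add_neg, zpow_add₀ (by simp)]; simp
  rw [ins_cons, ins_cons] at h
  simp only [splitSum_cons, h0, hk, ((d_multilin a b).head _).map_zero,
    (((d_multilin a b).cons _).head _).map_zero, zero_add, ((d_multilin a b).head _).map_smul,
    splitSum_smul, ins_smul] at h
  have E1 : z.splitSum (fun _ z₁ z₂ => X.dKB (X.actL (X.letterA c) κ z₁) z₂) = _ := e1.symm
  have E2 : z.splitSum (fun _ z₁ z₂ => X.actL (X.letterA c) (X.dKB κ z₁) z₂) = _ := e2.symm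
  have E3 : ins 1 X.algB.d (X.actL (X.letterA c) (X.kos 1 κ)) z = _ := e3.symm
  rw [diffB, E1, E2, E3]
  rw [← sub_eq_zero]
  change _ - X.d a b (.cons (X.d a a (.cons c (.nil a))) (.cons κ (X.inclB z))) = 0
  rw [← neg_eq_zero, ← h, smul_add, neg_smul, neg_smul]
  change _ = _ + Word.splitSum (Word.incl (f := fun _ : Unit => b) z) _ + (-((-1 : k) ^ n • Word.splitSum (Word.incl (f := fun _ : Unit => b) z) _)
    + -((-1 : k) ^ n • ins 1 X.d _ (Word.incl (f := fun _ : Unit => b) z)))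
  abel


theorem actR_comm (hB : X.algB.IsFlat) {n : ℤ} {c : X.Hom b b}
    (x : X.TA) (κ : X.K) :
    X.diffA n (X.actR (n - 1) (X.letterB c)) x κ =
      X.actR (n + 1 - 1) (X.letterB (X.d b b (.cons c (.nil b)))) x κ := by
  have h0 : X.d b b (.nil b) = 0 := hB ()
  have hM := d_multilin (X := X) a b
  have hs : (-1 : k) ^ (n - 1) = -(-1 : k) ^ n := by
    rw [sub_eq_add_neg, zpow_add₀ (by simp)]; simp
  have h := X.d_sq a b (((X.inclA x).kos (n - 1)).append
    (.cons (X.kos (n - 1) κ) (.cons c (.nil b))))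
  rw [ins_append_cons, ins_kos (n - 1) 1 X.d _ (hM.append_right _) (X.d_kos _), ins_cons, ins_nil] at h
  simp only [splitSum_cons, splitSum_nil, h0, splitSum_add, mul_one,
    ((hM.append_left _).cons _ |>.head _).map_zero, (((hM.append_left _).cons _).cons _ |>.head _).map_zero,
    zero_add, add_zero, splitSum_kos, word_kos_kos, kos_kos] at h
  have e1 := ins_incl 1 X.d (f := fun _ : Unit => a) (i := ()) (l := ())
    (fun u => X.d a b ((u.kos (n - 1)).append (.cons (X.kos (n - 1) κ) (.cons c (.nil b))))) x
  have e2 := splitSum_incl (Q := X.toGrQuiver) (f := fun _ : Unit => a) (i := ()) (l := ()) x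
    (fun m y z => X.d a b ((y.kos (1 + (n - 1))).append
      (.cons (X.d m b ((z.kos (n - 1)).append (.cons (X.kos (n - 1) κ) (.nil b)))) (.cons c (.nil b)))))
  have e3 := splitSum_incl (Q := X.toGrQuiver) (f := fun _ : Unit => a) (i := ()) (l := ()) x
    (fun m y z => X.d a b ((y.kos (1 + (n - 1))).append
      (.cons (X.d m b ((z.kos (n - 1)).append (.cons (X.kos (n - 1) κ) (.cons c (.nil b))))) (.nil b))))
  have E1 : ins 1 X.algA.d (fun x' => X.actR (n - 1) (X.letterB c) x' κ) x =
      ins 1 X.d (fun u => X.d a b ((u.kos (n - 1)).append (.cons (X.kos (n - 1) κ) (.cons c (.nil b)))))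
        (X.inclA x) := e1.symm
  have E3 : x.splitSum (fun _ x₁ x₂ => X.dAK (x₁.kos n) (X.actR (n - 1) (X.letterB c) x₂ κ)) =
      (X.inclA x).splitSum (fun m y z => X.d a b ((y.kos (1 + (n - 1))).append
      (.cons (X.d m b ((z.kos (n - 1)).append (.cons (X.kos (n - 1) κ) (.cons c (.nil b))))) (.nil b)))) := by
    refine Eq.trans ?_ e3.symm
    refine congrArg _ ?_
    funext m y z
    have : (1 + (n - 1)) = n := by ring
    have e' : X.inclA (Word.kos n y) = (X.inclA y).kos n := incl_kos n y
    rw [this, dAK, e']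
    rfl
  have E2 : x.splitSum (fun _ x₁ x₂ => X.actR (n - 1) (X.letterB c) (x₁.kos 1) (X.dAK x₂ κ)) = 
      ((-1 : k) ^ (n - 1)) • (X.inclA x).splitSum (fun m y z => X.d a b ((y.kos (1 + (n - 1))).append
      (.cons (X.d m b ((z.kos (n - 1)).append (.cons (X.kos (n - 1) κ) (.nil b)))) (.cons c (.nil b))))) := by
    refine Eq.trans (Eq.trans ?_ (splitSum_smul _ _ _)) (congrArg (fun t => ((-1 : k) ^ (n - 1)) • t) e2.symm)
    refine congrArg _ ?_
    funext m y z
    have e : X.kos (n - 1) (X.dAK z κ) = ((-1 : k) ^ (n - 1)) •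
        X.d a b ((z.incl.kos (n - 1)).append (.cons (X.kos (n - 1) κ) (.nil b))) := by
      have := X.d_kos (n - 1) a b ((X.inclA z).append (.cons κ (.nil b)))
      rw [mul_one, kos_append] at this
      exact this
    have e' : X.inclA (Word.kos 1 y) = (X.inclA y).kos 1 := incl_kos 1 y
    rw [actR, e', e, word_kos_kos, add_comm (n - 1) 1]
    exact (hM _ _ _ _).map_smul _ _
  rw [diffA, E1, E2, E3, ← sub_eq_zero]
  have e4 : X.actR (n + 1 - 1) (X.letterB (X.d b b (.cons c (.nil b)))) x κ = 
      X.d a b (((X.inclA x).kos (1 + (n - 1))).append (.cons (X.kos (1 + (n - 1)) κ) 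
        (.cons (X.d b b (.cons c (.nil b))) (.nil b)))) := by
    rw [actR]
    have : n + 1 - 1 = 1 + (n - 1) := by ring
    rw [this]
    rfl
  rw [e4, ← neg_eq_zero, ← h, hs]
  have hs2 : ∀ c : X.K, ((-1 : k) ^ n) • ((-1 : k) ^ n) • c = c := fun c => by
    rw [smul_smul, neg_one_sq, one_smul]
  simp only [smul_add, neg_smul, smul_neg, hs2]
  abel

variable (X)

/-- The linear part `A → End_{-B}(K)` of the derived left action, a map of complexes. The
A-infinity morphism `L_A` is a quasi-isomorphism if and only if this map is one. -/
noncomputable def derivedLeft (hA : X.algA.IsFlat) :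
    hA.homComplex () () ⟶ X.endBComplex hA :=
  CochainComplex.ofHom
    (fun n => ModuleCat.ofHom
      { toFun := fun c => ⟨X.actL (X.letterA c.1), actL_isEndB c.2⟩
        map_add' := fun c e => Subtype.ext <| by
          funext κ z; exact ((d_multilin a b).head _).map_add c.1 e.1
        map_smul' := fun r c => Subtype.ext <| by
          funext κ z; exact ((d_multilin a b).head _).map_smul r c.1 })
    fun n => by
      ext c : 2
      simp only [AInfCat.IsFlat.homComplex, endBComplex, CochainComplex.of_d]
      refine Subtype.ext ?_
      funext κ z
      exact actL_comm hA c.2 κ z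

/-- The linear part `B → End_{A-}(K)ᵒᵖ` of the derived right action, a map of complexes. -/
noncomputable def derivedRight (hB : X.algB.IsFlat) :
    hB.homComplex () () ⟶ X.endAComplex hB :=
  CochainComplex.ofHom
    (fun n => ModuleCat.ofHom
      { toFun := fun c => ⟨X.actR (n - 1) (X.letterB c.1), actR_isEndA c.2⟩
        map_add' := fun c e => Subtype.ext <| by
          funext x κ
          exact (((d_multilin a b).append_left _).cons _ |>.head _).map_add c.1 e.1
        map_smul' := fun r c => Subtype.ext <| by
          funext x κ
          exact (((d_multilin a b).append_left _).cons _ |>.head _).map_smul r c.1 })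
    fun n => by
      ext c : 2
      simp only [AInfCat.IsFlat.homComplex, endAComplex, CochainComplex.of_d]
      refine Subtype.ext ?_
      funext x κ
      exact actR_comm hB x κ

/-- The projection of the Hochschild complex of `Cat∞(A, B, K)` to that of `A`. -/
noncomputable def projA : X.hochschild ⟶ X.algA.hochschild := X.restrict fun _ => a
/-- The projection of the Hochschild complex of `Cat∞(A, B, K)` to that of `B`. -/
noncomputable def projB : X.hochschild ⟶ X.algB.hochschild := X.restrict fun _ => b

end BimodCat
end AInf

/-! ### Quasi-isomorphisms of complexes of modules in terms of elements. -/

section criterion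
variable {R : Type u} [Ring R]

/-! Extension by zero makes `p_B` surjective in each degree, so it is enough that its kernel is
acyclic (`CochainComplex.quasiIso_of_surjective`). A cochain `Φ` in the kernel has values `Φ(x)` in
`A[1]` and `Φ(x | κ | z)` in `K[1]`. Reading both as functions of the word `x` in `A` identifies the
kernel, as a graded space, with the maps from `T(A[1])` to `N = A[1] ⊕ End_{-B}(K)`. With the
differential `(c, f) ↦ (d¹ c, L_A¹ c - ∂f)`, `N` is the cone of the linear part of `L_A`, so it is
acyclic when `L_A` is a quasi-isomorphism (`coneD_exact`).

The kernel is filtered by the length of `x`. If `Φ` has degree `n` and vanishes at all words shorter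
than `x`, then `[d, Φ](x) = d_N(Φ(x)) - (-1)ⁿ Φ(d_A x)` (`evalA_hochD`): every other term contains a
value of `Φ` at a shorter word or on `B`. Flatness of `A` means that `d_A` never lengthens a word,
so the differential respects the filtration.

Over a field `N` has a contracting homotopy `h`. For a cocycle `Φ` vanishing at words of length less
than `m`, put `Ψ(x) = h(Φ(x))`. At words of length `m` the cocycle condition turns `-(-1)ⁿ h(Φ(d_A
x))` into `h(d_N Φ(x))`, with `n` now the degree of `Ψ`, so that `[d, Ψ]` agrees with `Φ` there. The
successive corrections vanish at longer and longer words. Since cochains may have infinitely many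
components, their infinite sum is again a cochain, and it is a primitive of `Φ`. This argument is
`exists_primitive_of_values`.

The statement for `p_A` uses the same argument with words `z` in `B` and the cone of `R_B`. Now the
variable `z` stands to the right of the arguments `x` and `κ`, so that a Koszul sign depending on
the degree of `z` enters (`evalB`). For this reason the common argument allows evaluations that
depend on a degree, and `homogExt` is needed to build a cochain from values prescribed degree by
degree. -/

theorem ShortComplex.exists_iCycles_eq (S : ShortComplex (ModuleCat.{v} R)) {x : S.X₂}
    (hx : S.g x = 0) : ∃ c, S.iCycles c = x :=
  ⟨S.moduleCatCyclesIso.inv ⟨x, hx⟩, S.moduleCatCyclesIso_inv_iCycles_apply _⟩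

/-- Under the concrete model of homology as cycles modulo the range of `S.f`, this is the criterion
for a class in a quotient to vanish. -/
theorem ShortComplex.homologyπ_eq_zero_iff (S : ShortComplex (ModuleCat.{v} R)) (c : S.cycles) :
    S.homologyπ c = 0 ↔ ∃ y, S.f y = S.iCycles c := by
  have h1 : S.homologyπ c = 0 ↔ S.moduleCatHomologyIso.hom (S.homologyπ c) = 0 :=
    (map_eq_zero_iff _ ((ModuleCat.mono_iff_injective S.moduleCatHomologyIso.hom).1 inferInstance)).symm
  rw [h1, S.π_moduleCatCyclesIso_hom_apply]
  refine (Submodule.Quotient.mk_eq_zero (LinearMap.range S.moduleCatToCycles)).trans ?_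
  refine exists_congr fun y => ?_
  rw [← S.moduleCatCyclesIso_hom_i_apply c]
  exact Subtype.ext_iff

/-- Injectivity and surjectivity on homology, tested on cycles: each class is represented by a
cycle, and a cycle has zero class exactly when it is a boundary. It lets quasi-isomorphisms be both
used and proved without quotients. -/
theorem ShortComplex.quasiIso_iff_elements {S T : ShortComplex (ModuleCat.{v} R)} (φ : S ⟶ T) :
    ShortComplex.QuasiIso φ ↔
      (∀ x : S.X₂, S.g x = 0 → (∃ y, T.f y = φ.τ₂ x) → ∃ x', S.f x' = x) ∧
      (∀ y : T.X₂, T.g y = 0 → ∃ x : S.X₂, S.g x = 0 ∧ ∃ y', y = φ.τ₂ x + T.f y') := by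
  have hm : ∀ c, ShortComplex.homologyMap φ (S.homologyπ c) =
      T.homologyπ (ShortComplex.cyclesMap φ c) := fun c => by
    rw [← ConcreteCategory.comp_apply, ← ConcreteCategory.comp_apply,
      ShortComplex.homologyπ_naturality]
  have hi : ∀ c, T.iCycles (ShortComplex.cyclesMap φ c) = φ.τ₂ (S.iCycles c) := fun c => by
    rw [← ConcreteCategory.comp_apply, ← ConcreteCategory.comp_apply, ShortComplex.cyclesMap_i]
  have hc : ∀ (U : ShortComplex (ModuleCat.{v} R)) c, U.g (U.iCycles c) = 0 := fun U c => by
    rw [← ConcreteCategory.comp_apply, ShortComplex.iCycles_g]; rfl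
  have hs : ∀ U : ShortComplex (ModuleCat.{v} R), Function.Surjective U.homologyπ := fun U =>
    (ModuleCat.epi_iff_surjective _).1 inferInstance
  have hinj : ∀ U : ShortComplex (ModuleCat.{v} R), Function.Injective U.iCycles := fun U =>
    (ModuleCat.mono_iff_injective _).1 inferInstance
  rw [ShortComplex.quasiIso_iff, ConcreteCategory.isIso_iff_bijective, Function.Bijective]
  refine and_congr ⟨fun h x hx ⟨y, hy⟩ => ?_, fun h => ?_⟩ ⟨fun h y hy => ?_, fun h y => ?_⟩
  · obtain ⟨c, rfl⟩ := exists_iCycles_eq S hx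
    refine (homologyπ_eq_zero_iff S c).1 (h ?_)
    rw [hm, map_zero]
    exact (homologyπ_eq_zero_iff T _).2 ⟨y, hy.trans (hi c).symm⟩
  · refine (injective_iff_map_eq_zero (ShortComplex.homologyMap φ).hom).2 fun a ha => ?_
    obtain ⟨c, rfl⟩ := hs S a
    have ha : ShortComplex.homologyMap φ (S.homologyπ c) = 0 := ha
    rw [hm, homologyπ_eq_zero_iff, hi] at ha
    exact (homologyπ_eq_zero_iff S c).2 (h _ (hc S c) ha)
  · obtain ⟨c, rfl⟩ := exists_iCycles_eq T hy
    obtain ⟨a, ha⟩ := h (T.homologyπ c)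
    obtain ⟨e, rfl⟩ := hs S a
    rw [hm, ← sub_eq_zero, ← map_sub, homologyπ_eq_zero_iff, map_sub, hi] at ha
    obtain ⟨y', hy'⟩ := ha
    refine ⟨S.iCycles e, hc S e, -y', ?_⟩
    rw [map_neg, hy']; abel
  · obtain ⟨c, rfl⟩ := hs T y
    obtain ⟨x, hx, y', hy'⟩ := h _ (hc T c)
    obtain ⟨e, rfl⟩ := exists_iCycles_eq S hx
    refine ⟨S.homologyπ e, ?_⟩
    rw [hm, ← sub_eq_zero, ← map_sub, homologyπ_eq_zero_iff, map_sub, hi, hy']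
    exact ⟨-y', by rw [map_neg]; abel⟩

/-- The degrees are written `n`, `n + 1`, `n + 1 + 1` so that `CochainComplex.of_d` rewrites all the
differentials involved. -/
theorem CochainComplex.quasiIso_iff_elements {C D : CochainComplex (ModuleCat.{v} R) ℤ} (φ : C ⟶ D) :
    QuasiIso φ ↔ ∀ n : ℤ,
      (∀ x : C.X (n + 1), C.d (n + 1) (n + 1 + 1) x = 0 →
        (∃ y, D.d n (n + 1) y = φ.f (n + 1) x) → ∃ x', C.d n (n + 1) x' = x) ∧
      (∀ y : D.X (n + 1), D.d (n + 1) (n + 1 + 1) y = 0 →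
        ∃ x : C.X (n + 1), C.d (n + 1) (n + 1 + 1) x = 0 ∧ ∃ y', y = φ.f (n + 1) x + D.d n (n + 1) y') := by
  rw [_root_.quasiIso_iff]
  have h : ∀ n : ℤ, QuasiIsoAt φ (n + 1) ↔ _ := fun n =>
    (quasiIsoAt_iff' φ n (n + 1) (n + 1 + 1) (by simp) (by simp)).trans
      (ShortComplex.quasiIso_iff_elements _)
  refine ⟨fun H n => (h n).1 (H _), fun H n => ?_⟩
  obtain ⟨m, rfl⟩ : ∃ m, n = m + 1 := ⟨n - 1, by ring⟩
  exact (h m).2 (H m)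

/-- A degreewise surjective map with acyclic kernel is a quasi-isomorphism. -/
theorem CochainComplex.quasiIso_of_surjective {C D : CochainComplex (ModuleCat.{v} R) ℤ} (φ : C ⟶ D)
    (hs : ∀ n, Function.Surjective (φ.f n))
    (hk : ∀ n (x : C.X (n + 1)), φ.f (n + 1) x = 0 → C.d (n + 1) (n + 1 + 1) x = 0 →
      ∃ y : C.X n, φ.f n y = 0 ∧ C.d n (n + 1) y = x) : QuasiIso φ := by
  have hd : ∀ (E : CochainComplex (ModuleCat.{v} R) ℤ) (i j l : ℤ) x, E.d j l (E.d i j x) = 0 :=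
    fun E i j l x => by rw [← ConcreteCategory.comp_apply, HomologicalComplex.d_comp_d]; rfl
  have hφ : ∀ i j x, φ.f j (C.d i j x) = D.d i j (φ.f i x) := fun i j x => by
    rw [← ConcreteCategory.comp_apply, ← ConcreteCategory.comp_apply, HomologicalComplex.Hom.comm]
  refine (quasiIso_iff_elements φ).2 fun n => ⟨fun x hx ⟨y, hy⟩ => ?_, fun y hy => ?_⟩
  -- After lifting the primitive of the image to `x'`, the cocycle `x - d x'` lies in the kernel and
  -- is a boundary there.
  · obtain ⟨x', rfl⟩ := hs n y
    obtain ⟨z, -, hz⟩ := hk n (x - C.d n (n + 1) x') (by rw [map_sub, hφ, hy, sub_self])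
      (by rw [map_sub, hx, hd, sub_zero])
    exact ⟨z + x', by rw [map_add, hz, sub_add_cancel]⟩
  -- For a lift `x` of the cocycle, `d x` is a cocycle of the kernel, hence `d z` with `z` in the
  -- kernel; then `x - z` is a cocycle with the same image.
  · obtain ⟨x, rfl⟩ := hs _ y
    obtain ⟨z, hz, hz'⟩ := hk (n + 1) (C.d _ _ x) (by rw [hφ, hy]) (hd _ _ _ _ _)
    exact ⟨x - z, by rw [map_sub, hz', sub_self], 0, by rw [map_sub, hz, map_zero]; simp⟩

end criterion

/-! ### Lengths and degrees of the pieces of a word. -/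

namespace AInf
variable {k : Type u} [Field k] {I : Type} {Q : GrQuiver.{u, v} k I}

/-- The number of letters of a word. -/
def Word.len : ∀ {i j : I}, Word Q i j → ℕ
  | _, _, .nil _ => 0
  | _, _, .cons _ w => w.len + 1

theorem len_append : ∀ {i j l : I} (x : Word Q i j) (y : Word Q j l),
    (x.append y).len = x.len + y.len
  | _, _, _, .nil _, _ => (Nat.zero_add _).symm
  | _, _, _, .cons _ x, y => by
    simp only [Word.append, Word.len, len_append x y]; omega

theorem len_kos (n : ℤ) : ∀ {i j : I} (x : Word Q i j), (x.kos n).len = x.len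
  | _, _, .nil _ => rfl
  | _, _, .cons _ x => congrArg (· + 1) (len_kos n x)

section split
variable {X : Type*} [AddCommGroup X]

/-- The pieces of a homogeneous word are homogeneous, and their degrees and lengths add up. Keeping
both in the hypothesis supports arguments by length for functions known only on homogeneous words.
-/
theorem splitSum_congr_homog {i l : I} {w : Word Q i l} {r : ℤ} (hw : w.IsHomog r)
    {g g' : ∀ m, Word Q i m → Word Q m l → X}
    (h : ∀ m y z p q, Word.IsHomog y p → Word.IsHomog z q → p + q = r →
      y.len + z.len = w.len → g m y z = g' m y z) :
    w.splitSum g = w.splitSum g' := by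
  induction hw with
  | nil i => exact h _ _ _ 0 0 (.nil _) (.nil _) (by simp) rfl
  | cons hc hw ih =>
    rw [splitSum_cons, splitSum_cons, h _ _ _ 0 _ (.nil _) (.cons hc hw) (by simp) (Nat.zero_add _)]
    congr 1
    refine ih fun m y z p q hy hz e e' => h _ _ _ _ _ (.cons hc hy) hz (by omega) ?_
    simp only [Word.len]; omega

/-- Only the split with empty left piece has a right piece of full length. -/
theorem splitSum_eq_nil_left {i l : I} {w : Word Q i l} {r : ℤ} (hw : w.IsHomog r)
    {g : ∀ m, Word Q i m → Word Q m l → X}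
    (h : ∀ m y z p q, Word.IsHomog y p → Word.IsHomog z q → p + q = r →
      z.len < w.len → g m y z = 0) :
    w.splitSum g = g i (.nil i) w := by
  cases hw with
  | nil i => rfl
  | @cons _ _ _ c w p q hc hw =>
    rw [splitSum_cons, splitSum_congr_homog hw (g' := fun _ _ _ => 0), splitSum_zero, add_zero]
    intro m y z p q hy hz e e'
    exact h _ _ _ _ _ (.cons hc hy) hz (by omega) (by simp only [Word.len]; omega)

theorem splitSum_eq_nil_right {i l : I} {w : Word Q i l} {r : ℤ} (hw : w.IsHomog r)
    {g : ∀ m, Word Q i m → Word Q m l → X}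
    (h : ∀ m y z p q, Word.IsHomog y p → Word.IsHomog z q → p + q = r →
      y.len < w.len → g m y z = 0) :
    w.splitSum g = g l w (.nil l) := by
  induction hw with
  | nil i => rfl
  | @cons _ _ _ c w p q hc hw ih =>
    rw [splitSum_cons, h _ _ _ 0 _ (.nil _) (.cons hc hw) (by simp) (by simp [Word.len]), zero_add]
    refine ih fun m y z p q hy hz e e' => h _ _ _ _ _ (.cons hc hy) hz (by omega) ?_
    simp only [Word.len]; omega

theorem splitSum_eq_zero {i l : I} {w : Word Q i l} {r : ℤ} (hw : w.IsHomog r)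
    {g : ∀ m, Word Q i m → Word Q m l → X}
    (h : ∀ m y z p q, Word.IsHomog y p → Word.IsHomog z q → p + q = r →
      y.len + z.len = w.len → g m y z = 0) : w.splitSum g = 0 :=
  (splitSum_congr_homog hw h).trans (splitSum_zero w)

/-- A cochain of degree `n` inserted into a word of degree `r` produces words of degree `r + n`
only. This matters because values of cochains are prescribed one degree at a time. -/
theorem ins_congr_homog {n : ℤ} {Φ : ∀ i j : I, Word Q i j → Q.Hom i j} (hΦ : Q.IsCochain n Φ)
    {i l : I} {F G : Word Q i l → X} {w : Word Q i l} {r : ℤ} (hw : w.IsHomog r)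
    (h : ∀ u, u.IsHomog (r + n) → F u = G u) :
    ins n Φ F w = ins n Φ G w := by
  refine splitSum_congr_homog hw fun a x u p q hx hu e _ =>
    splitSum_congr_homog hu fun b y z s t hy hz e' _ => h _ ?_
  have := (hx.kos n).append (Word.IsHomog.cons (hΦ.2 _ _ _ _ hy) hz)
  convert this using 1; omega

variable [Module k X]

/-- If `Φ` has no component of arity `0`, inserting it does not raise the length. -/
theorem ins_eq_zero_of_len {n : ℤ} {Φ : ∀ i j : I, Word Q i j → Q.Hom i j} (hΦ : Q.IsCochain n Φ)
    (h0 : ∀ i, Φ i i (.nil i) = 0) {i l : I} {F : Word Q i l → X} (hF : IsMultilin F)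
    {w : Word Q i l} {r : ℤ} (hw : w.IsHomog r)
    (h : ∀ u, u.IsHomog (r + n) → u.len ≤ w.len → F u = 0) :
    ins n Φ F w = 0 := by
  refine splitSum_eq_zero hw fun a x u p q hx hu e e1 =>
    splitSum_eq_zero hu fun b y z s t hy hz e' e2 => ?_
  -- Only the insertion at an empty `y` lengthens the word, and it contributes zero; a nonempty `y`
  -- is replaced by a single letter.
  cases hy with
  | nil => rw [h0]; exact (hF _ _ _ _).map_zero
  | cons hc hy =>
    refine h _ ?_ ?_
    · have := (hx.kos n).append (Word.IsHomog.cons (hΦ.2 _ _ _ _ (.cons hc hy)) hz)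
      convert this using 1; omega
    · simp only [len_append, len_kos, Word.len] at *
      omega
end split

/-! ### Multilinear functions prescribed on homogeneous words. -/

section homog
variable {X Y : Type*} [AddCommGroup X] [Module k X] [AddCommGroup Y] [Module k Y]

theorem isMultilin_zero {i l : I} : IsMultilin (fun _ : Word Q i l => (0 : X)) :=
  fun _ _ _ _ => (0 : _ →ₗ[k] X).isLinear

open Classical in
/-- The value at `w` of the multilinear function which is `G q` on homogeneous words of degree `q`. -/
noncomputable def homogExt : ∀ {i l : I}, Word Q i l → (ℤ → Word Q i l → X) → X
  | _, _, .nil i, G => G 0 (.nil i)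
  | _, _, .cons (i := i) (j := j) c w, G =>
      (DirectSum.decompose (Q.gr i j) c).support.sum fun p =>
        homogExt w fun q w => G (p - 1 + q) (.cons (DirectSum.decompose (Q.gr i j) c p : Q.Hom i j) w)

omit [Module k X] in
theorem homogExt_zero {i l : I} (w : Word Q i l) : homogExt w (fun _ _ => (0 : X)) = 0 := by
  induction w with
  | nil => rfl
  | cons c w ih => simp only [homogExt, ih, Finset.sum_const_zero]

theorem homogExt_linear {i l : I} (w : Word Q i l) (G : Y → ℤ → Word Q i l → X)
    (hG : ∀ q w, IsLinearMap k fun y => G y q w) : IsLinearMap k fun y => homogExt w (G y) := by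
  induction w with
  | nil => exact hG _ _
  | cons c w ih =>
    have := fun p : ℤ => ih (fun y q w => G y (p - 1 + q) (.cons (DirectSum.decompose (Q.gr _ _) c p : Q.Hom _ _) w))
      (fun q w => hG _ _)
    refine ⟨fun y z => ?_, fun r y => ?_⟩
    · simp only [homogExt, (this _).map_add, Finset.sum_add_distrib]
    · simp only [homogExt, (this _).map_smul, Finset.smul_sum]

/-- The sum over the homogeneous components of the first letter is a linear map out of the direct
sum, composed with the decomposition. In this form linearity needs no comparison of supports. -/
theorem homogExt_head {i j l : I} {G : ℤ → Word Q i l → X} (hG : ∀ q, IsMultilin (G q))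
    (w : Word Q j l) : IsLinearMap k fun c => homogExt (.cons c w) G := by
  classical
  have hlin : ∀ p : ℤ, IsLinearMap k fun c : Q.Hom i j =>
      homogExt w (fun q w => G (p - 1 + q) (.cons c w)) := fun p =>
    homogExt_linear w (fun c q w => G (p - 1 + q) (.cons c w)) fun q w => (hG _).head w
  have e : (fun c => homogExt (.cons c w) G) =
      (DirectSum.toModule k ℤ X (fun p => ((hlin p).mk' _).comp (Q.gr i j p).subtype)) ∘ₗ
        (DirectSum.decomposeLinearEquiv (Q.gr i j)).toLinearMap := by
    funext c
    refine Eq.trans ?_ (DFinsupp.sumAddHom_apply (fun p =>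
      (((hlin p).mk' _).comp (Q.gr i j p).subtype).toAddMonoidHom) (DirectSum.decompose (Q.gr i j) c)).symm
    exact Finset.sum_congr (by congr!) fun p _ => rfl
  rw [e]
  exact LinearMap.isLinear _

theorem homogExt_multilin {i l : I} {G : ℤ → Word Q i l → X} (hG : ∀ q, IsMultilin (G q)) :
    IsMultilin fun w => homogExt w G := by
  intro a b x z
  induction x with
  | nil i => exact homogExt_head hG z
  | cons d x ih =>
    have := fun p : ℤ => ih (G := fun q w => G (p - 1 + q)
      (.cons (DirectSum.decompose (Q.gr _ _) d p : Q.Hom _ _) w)) (fun q => (hG _).cons _)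
    refine ⟨fun y z => ?_, fun r y => ?_⟩
    · simp only [Word.append, homogExt, (this _).map_add, Finset.sum_add_distrib]
    · simp only [Word.append, homogExt, (this _).map_smul, Finset.smul_sum]

theorem homogExt_of_isHomog {i l : I} {G : ℤ → Word Q i l → X} (hG : ∀ q, IsMultilin (G q))
    {w : Word Q i l} {r : ℤ} (hw : w.IsHomog r) : homogExt w G = G r w := by
  induction hw with
  | nil i => rfl
  | @cons i j l c w p q hc hw ih =>
    classical
    rw [← ih (G := fun q w => G (p - 1 + q) (.cons c w)) fun q => (hG _).cons c]
    -- The zero letter is homogeneous of every degree and has empty support, so it is treated apart;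
    -- both sides vanish.
    by_cases h0 : c = 0
    · subst h0
      rw [(homogExt_head hG w).map_zero]
      simp only [((hG _).head _).map_zero, homogExt_zero]
    · have hs : (DirectSum.decompose (Q.gr i j) c).support = {p} := by
        rw [DirectSum.decompose_of_mem _ hc]
        exact DFinsupp.support_single (by simpa using h0)
      refine (Finset.sum_congr (s₂ := {p}) (by convert hs) fun _ _ => rfl).trans ?_
      rw [Finset.sum_singleton, DirectSum.decompose_of_mem_same _ hc]

/-- For properties of values that do not mention a degree: at a word with inhomogeneous letters the
value is a sum over homogeneous words of several degrees. -/
theorem homogExt_mem {i l : I} {G : ℤ → Word Q i l → X} (S : Submodule k X) (w : Word Q i l)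
    (h : ∀ q u, u.IsHomog q → G q u ∈ S) : homogExt w G ∈ S := by
  induction w with
  | nil i => exact h _ _ (.nil i)
  | cons c w ih =>
    exact Submodule.sum_mem _ fun p _ => ih fun q u hu => h _ _ (.cons (Subtype.mem _) hu)

/-- A multilinear function is determined by its values on homogeneous words. -/
theorem IsMultilin.ext_homog {i l : I} {F G : Word Q i l → X} (hF : IsMultilin F) (hG : IsMultilin G)
    (h : ∀ w q, w.IsHomog q → F w = G w) (w : Word Q i l) : F w = G w := by
  induction w with
  | nil i => exact h _ _ (.nil i)
  | cons c w ih =>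
    induction c using hom_induction with
    | h0 => rw [(hF.head w).map_zero, (hG.head w).map_zero]
    | hh p c hc => exact ih (hF.cons c) (hG.cons c) fun w q hw => h _ _ (.cons hc hw)
    | ha c d hc hd => rw [(hF.head w).map_add, (hG.head w).map_add, hc, hd]

/-- Moving an operator of even degree costs no sign; together with `kos_kos` this makes `kos n` an
involution. -/
theorem kos_two_mul (n : ℤ) {i j : I} (c : Q.Hom i j) : Q.kos (n + n) c = c := by
  induction c using hom_induction with
  | h0 => simp
  | hh p c hc =>
    rw [kos_of_mem _ hc, add_mul, zpow_add₀ (by simp), neg_one_sq, one_smul]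
  | ha c d hc hd => simp only [map_add, hc, hd]

theorem word_kos_two_mul (n : ℤ) {i j : I} (w : Word Q i j) : w.kos (n + n) = w := by
  induction w with
  | nil => rfl
  | cons c w ih => rw [Word.kos, ih, kos_two_mul]

/-- A multilinear function at `w.kos n`, for a homogeneous word `w`. -/
theorem IsMultilin.apply_kos {i l : I} {F : Word Q i l → X} (hF : IsMultilin F) (n : ℤ)
    {w : Word Q i l} {r : ℤ} (hw : w.IsHomog r) : F (w.kos n) = ((-1 : k) ^ (n * r)) • F w := by
  induction hw with
  | nil i => simp [Word.kos]
  | @cons i j l c w p q hc hw ih =>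
    rw [Word.kos, kos_of_mem n hc, (hF.head _).map_smul, ih (hF.cons c), smul_smul,
      ← zpow_add₀ (by simp), mul_add]
end homog
end AInf

/-! ### Acyclicity of cochains with values in an acyclic complex. -/

namespace AInf
variable {k : Type u} [Field k]

/-- An acyclic graded complex of vector spaces, with its parts `S p` sitting in one ambient space, has
a contracting homotopy. -/
theorem exists_contracting_homotopy {N : Type*} [AddCommGroup N] [Module k N] (S : ℤ → Submodule k N)
    (d : ℤ → N →ₗ[k] N) (hd : ∀ p, ∀ v ∈ S p, d p v ∈ S (p + 1))
    (hdd : ∀ p, ∀ v ∈ S p, d (p + 1) (d p v) = 0)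
    (hac : ∀ p, ∀ v ∈ S (p + 1), d (p + 1) v = 0 → ∃ u ∈ S p, d p u = v) :
    ∃ h : ℤ → N →ₗ[k] N, (∀ p, ∀ v ∈ S (p + 1), h (p + 1) v ∈ S p) ∧
      ∀ p, ∀ v ∈ S (p + 1), d p (h (p + 1) v) + h (p + 1 + 1) (d (p + 1) v) = v := by
  -- `s` is a linear section of `d p` over the cycles of degree `p + 1`, extended to all of `N` with
  -- values in `S p`. Both the section and the extension exist because `k` is a field.
  have hs : ∀ p, ∃ s : N →ₗ[k] N, (∀ v, s v ∈ S p) ∧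
      ∀ v ∈ S (p + 1), d (p + 1) v = 0 → d p (s v) = v := by
    intro p
    let Z : Submodule k N := S (p + 1) ⊓ LinearMap.ker (d (p + 1))
    let D : S p →ₗ[k] Z := ((d p).comp (S p).subtype).codRestrict Z fun v =>
      ⟨hd p v v.2, hdd p v v.2⟩
    have hD : LinearMap.range D = ⊤ := LinearMap.range_eq_top.2 fun z => by
      obtain ⟨u, hu, e⟩ := hac p z z.2.1 z.2.2
      exact ⟨⟨u, hu⟩, Subtype.ext e⟩
    obtain ⟨s, hs⟩ := D.exists_rightInverse_of_surjective hD
    obtain ⟨t, ht⟩ := LinearMap.exists_extend s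
    refine ⟨(S p).subtype.comp t, fun v => (t v).2, fun v hv hv' => ?_⟩
    have e1 : t v = s ⟨v, hv, hv'⟩ := LinearMap.congr_fun ht ⟨v, hv, hv'⟩
    have e2 := LinearMap.congr_fun hs ⟨v, hv, hv'⟩
    rw [LinearMap.comp_apply, e1]
    exact congrArg Subtype.val e2
  choose s hs hs' using hs
  -- On `S (p + 1)` the map `v ↦ v - s(d v)` takes values in cycles. Hence `d(h v) = v - s(d v)`,
  -- while `h(d v) = s(d v)` because `d(d v) = 0`.
  refine ⟨fun p => s (p - 1) ∘ₗ (LinearMap.id - s p ∘ₗ d p), fun p v _ => ?_, fun p v hv => ?_⟩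
  · rw [LinearMap.comp_apply]
    have : ∀ y, s (p + 1 - 1) y ∈ S p := by rw [add_sub_cancel_right]; exact hs p
    exact this _
  · have h1 := hs' (p + 1) (d (p + 1) v) (hd _ _ hv) (hdd _ _ hv)
    have h2 := hs' p (v - s (p + 1) (d (p + 1) v)) (Submodule.sub_mem _ hv (hs _ _))
      (by rw [map_sub, h1, sub_self])
    have h3 := hdd _ _ hv
    simp only [add_sub_cancel_right, LinearMap.comp_apply, LinearMap.sub_apply, LinearMap.id_apply, h2,
      h3, map_zero, sub_zero, sub_add_cancel]

/-- A complex `C` of cochains on the words of a flat A-infinity algebra `P`, with values in an acyclic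
complex `S`, is acyclic if its differential is that of `S` up to the terms that come from the
differential of `P` and from values at shorter words. -/
theorem exists_primitive_of_values {P : AInfCat.{u, v} k Unit} (hP : P.IsFlat)
    {N : Type*} [AddCommGroup N] [Module k N] (S : ℤ → Submodule k N)
    (d : ℤ → N →ₗ[k] N) (hd : ∀ p, ∀ v ∈ S p, d p v ∈ S (p + 1))
    (hdd : ∀ p, ∀ v ∈ S p, d (p + 1) (d p v) = 0)
    (hac : ∀ p, ∀ v ∈ S (p + 1), d (p + 1) v = 0 → ∃ u ∈ S p, d p u = v)
    {C : ℤ → Type*} [∀ n, AddCommGroup (C n)] [∀ n, Module k (C n)] (D : ∀ n, C n →ₗ[k] C (n + 1))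
    (hDD : ∀ n Φ, D (n + 1) (D n Φ) = 0)
    (ev : ∀ n, C n →ₗ[k] (ℤ → Word P.toGrQuiver () () → N))
    (ev_multilin : ∀ n Φ q, IsMultilin (ev n Φ q))
    (ev_mem : ∀ n Φ q x, x.IsHomog q → ev n Φ q x ∈ S (q + n))
    (exists_ev : ∀ n (G : ℤ → Word P.toGrQuiver () () → N), (∀ q, IsMultilin (G q)) →
      (∀ q x, x.IsHomog q → G q x ∈ S (q + n)) → ∃ Φ, ∀ q x, x.IsHomog q → ev n Φ q x = G q x)
    (ev_inj : ∀ n Φ, (∀ q x, x.IsHomog q → ev n Φ q x = 0) → Φ = 0)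
    (ev_D : ∀ n Φ q x, x.IsHomog q →
      (∀ r y, y.IsHomog r → y.len < x.len → ev n Φ r y = 0) →
      ev (n + 1) (D n Φ) q x =
        d (q + n) (ev n Φ q x) - ((-1 : k) ^ n) • ins 1 P.d (ev n Φ (q + 1)) x)
    (n : ℤ) (Φ : C (n + 1)) (hΦ : D (n + 1) Φ = 0) : ∃ Ψ, D n Ψ = Φ := by
  obtain ⟨h, hmem, hh⟩ := exists_contracting_homotopy S d hd hdd hac
  -- The decreasing filtration by the number of letters; `F n 0` is everything.
  let F : ∀ n, ℕ → Submodule k (C n) := fun n m =>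
    { carrier := {Φ | ∀ q x, x.IsHomog q → x.len < m → ev n Φ q x = 0}
      add_mem' := fun {Φ Ψ} h h' q x hx hl => by
        rw [map_add, Pi.add_apply, Pi.add_apply, h q x hx hl, h' q x hx hl, add_zero]
      zero_mem' := fun q x hx hl => by rw [map_zero]; rfl
      smul_mem' := fun r Φ h q x hx hl => by
        rw [map_smul, Pi.smul_apply, Pi.smul_apply, h q x hx hl, smul_zero] }
  -- Flatness enters here: inserting `P.d` cannot lengthen a word.
  have ins_zero : ∀ n m, ∀ Φ ∈ F n (m + 1), ∀ q x, x.IsHomog q → x.len ≤ m →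
      ins 1 P.d (ev n Φ (q + 1)) x = 0 := fun n m Φ hΦ q x hx hl =>
    ins_eq_zero_of_len P.isCochain hP (ev_multilin n Φ (q + 1)) hx
      fun u hu hul => hΦ _ u hu (by omega)
  have hDF : ∀ n m, ∀ Φ ∈ F n m, D n Φ ∈ F (n + 1) m := by
    intro n m Φ hΦ q x hx hl
    obtain ⟨m, rfl⟩ : ∃ l, m = l + 1 := ⟨m - 1, by omega⟩
    rw [ev_D n Φ q x hx fun r y hy hyl => hΦ r y hy (by omega), hΦ q x hx hl, map_zero,
      ins_zero n m Φ hΦ q x hx (by omega), smul_zero, sub_zero]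
  -- The leading term of a cocycle is removed by applying the homotopy to its values. The candidate
  -- is defined on words of every length, but is only controlled up to length `m`.
  have step : ∀ m, ∀ Φ ∈ F (n + 1) m, D (n + 1) Φ = 0 → ∃ Ψ ∈ F n m, Φ - D n Ψ ∈ F (n + 1) (m + 1) := by
    intro m Φ hΦ h0
    obtain ⟨Ψ, hΨ⟩ := exists_ev n (fun q x => h (q + n + 1) (ev (n + 1) Φ q x))
      (fun q => (ev_multilin _ Φ q).comp_linear (LinearMap.isLinear _))
      (fun q x hx => hmem _ _ (by have := ev_mem _ Φ q x hx; rwa [← add_assoc] at this))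
    have hΨF : Ψ ∈ F n m := fun q x hx hl => by
      rw [hΨ q x hx, hΦ q x hx hl, map_zero]
    refine ⟨Ψ, hΨF, fun q x hx hl => ?_⟩
    rw [map_sub, Pi.sub_apply, Pi.sub_apply, sub_eq_zero]
    rcases Nat.lt_succ_iff_lt_or_eq.1 hl with hl | hl
    · rw [hΦ q x hx hl, hDF n m Ψ hΨF q x hx hl]
    have hD := ev_D (n + 1) Φ q x hx fun r y hy hyl => hΦ r y hy (by omega)
    rw [ev_D n Ψ q x hx fun r y hy hyl => hΨF r y hy (by omega), hΨ q x hx]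
    have e : ins 1 P.d (ev n Ψ (q + 1)) x =
        h (q + n + 1 + 1) (ins 1 P.d (ev (n + 1) Φ (q + 1)) x) := by
      rw [← BimodCat.ins_linear (LinearMap.isLinear _)]
      refine ins_congr_homog P.isCochain hx fun u hu => ?_
      rw [hΨ _ u hu, show q + 1 + n + 1 = q + n + 1 + 1 by ring]
    -- Since `(-1)ⁿ⁺¹ = -(-1)ⁿ`, the cocycle condition at `x` reads `0 = d(Φ(x)) + (-1)ⁿ Φ(d x)`. It
    -- trades the insertion term for the missing half `h d` of the homotopy identity.
    rw [h0, map_zero, BimodCat.neg_one_succ, neg_smul, sub_neg_eq_add] at hD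
    have e2 : ((-1 : k) ^ n) • ins 1 P.d (ev (n + 1) Φ (q + 1)) x =
        -d (q + n + 1) (ev (n + 1) Φ q x) := by
      rw [← add_assoc] at hD
      exact (eq_neg_of_add_eq_zero_right hD.symm)
    rw [e, ← map_smul, e2, map_neg, sub_neg_eq_add]
    exact (hh _ _ (by have := ev_mem _ Φ q x hx; rwa [← add_assoc] at this)).symm
  choose! T hT hT' using step
  -- Partial sums of the corrections. The `m`-th correction lies in `F n m`, so the sums become
  -- stationary on each word.
  let A : ℕ → C n := fun m => Nat.rec 0 (fun m s => s + T m (Φ - D n s)) m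
  have hA : ∀ m, Φ - D n (A m) ∈ F (n + 1) m := by
    intro m
    induction m with
    | zero => exact fun q x hx hl => absurd hl (Nat.not_lt_zero _)
    | succ m ih =>
      have := hT' m _ ih (by rw [map_sub, hΦ, hDD, sub_zero])
      change Φ - D n (A m + T m (Φ - D n (A m))) ∈ _
      rwa [map_add, ← sub_sub]
  have hAA : ∀ m l, A (m + l) - A m ∈ F n m := by
    intro m l
    induction l with
    | zero => rw [add_zero, sub_self]; exact Submodule.zero_mem _
    | succ l ih =>
      have : A (m + (l + 1)) - A m = (A (m + l) - A m) + T (m + l) (Φ - D n (A (m + l))) :=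
        add_sub_right_comm _ _ _
      rw [this]
      refine Submodule.add_mem _ ih fun q x hx hl => ?_
      exact hT _ _ (hA _) (by rw [map_sub, hΦ, hDD, sub_zero]) q x hx (by omega)
  -- The limit: at a word of length `l` the sums are stationary from index `l + 1` on. This choice
  -- is linear in each letter because replacing a letter does not change the length.
  obtain ⟨Ψ, hΨ⟩ := exists_ev n (fun q x => ev n (A (x.len + 1)) q x)
    (fun q a b x z => by
      have : ∀ c : P.Hom a b, (x.append (.cons c z)).len = x.len + (z.len + 1) := fun c =>
        len_append _ _
      simp only [this]
      exact ev_multilin _ _ _ _ _ _ _)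
    (fun q x hx => ev_mem _ _ _ _ hx)
  have hΨA : ∀ m, Ψ - A m ∈ F n m := fun m q x hx hl => by
    have := hAA (x.len + 1) (m - (x.len + 1)) q x hx (Nat.lt_succ_self _)
    rw [Nat.add_sub_cancel' hl, map_sub, Pi.sub_apply, Pi.sub_apply, sub_eq_zero] at this
    rw [map_sub, Pi.sub_apply, Pi.sub_apply, hΨ q x hx, this, sub_self]
  refine ⟨Ψ, sub_eq_zero.1 (ev_inj _ _ fun q x hx => ?_)⟩
  have h1 := hDF n _ _ (hΨA (x.len + 1)) q x hx (Nat.lt_succ_self _)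
  have h2 := hA (x.len + 1) q x hx (Nat.lt_succ_self _)
  -- Both differences on the right lie in the filtration step `x.len + 1`, so they vanish at `x`.
  have : D n Ψ - Φ = D n (Ψ - A (x.len + 1)) - (Φ - D n (A (x.len + 1))) := by rw [map_sub]; abel
  rw [this, map_sub, Pi.sub_apply, Pi.sub_apply, h1, h2, sub_zero]

end AInf

/-! ### Cochains of the two-object category from their three components. -/

namespace AInf
variable {k : Type u} [Field k]

section extObj
variable {I : Type} {Q : GrQuiver.{u, v} k I} (o : I)
variable {X Y : Type*} [AddCommGroup X] [Module k X] [AddCommGroup Y] [Module k Y]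

open Classical in
/-- Extension of a function on the words in `Hom o o` by zero to all words. -/
noncomputable def extObj : ∀ {i l : I}, Word Q i l → (Word (Q.full fun _ : Unit => o) () () → X) → X
  | _, _, .nil i, F => if i = o then F (.nil ()) else 0
  | _, _, .cons (i := i) (j := j) c w, F =>
      if h : i = o ∧ j = o then
        extObj w fun z => F (.cons (i := ()) (j := ()) (cast (by rw [h.1, h.2]) c : Q.Hom o o) z)
      else 0

omit [Module k X] in
theorem extObj_cons {l : I} (c : Q.Hom o o) (w : Word Q o l)
    (F : Word (Q.full fun _ : Unit => o) () () → X) :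
    extObj o (.cons c w) F = extObj o w fun z => F (.cons (i := ()) (j := ()) c z) := by
  rw [extObj, dif_pos ⟨rfl, rfl⟩]; rfl

omit [Module k X] in
theorem extObj_cons_ne {i j l : I} (h : ¬(i = o ∧ j = o)) (c : Q.Hom i j) (w : Word Q j l)
    (F : Word (Q.full fun _ : Unit => o) () () → X) : extObj o (.cons c w) F = 0 := by
  rw [extObj, dif_neg h]

omit [Module k X] in
theorem extObj_incl {i l : Unit} (z : Word (Q.full fun _ : Unit => o) i l)
    (F : Word (Q.full fun _ : Unit => o) () () → X) : extObj o z.incl F = F z := by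
  induction z generalizing F with
  | nil i => exact if_pos rfl
  | cons c z ih => exact (extObj_cons o c z.incl F).trans (ih _)

theorem extObj_linear {i l : I} (w : Word Q i l) (F : Y → Word (Q.full fun _ : Unit => o) () () → X)
    (hF : ∀ z, IsLinearMap k fun y => F y z) : IsLinearMap k fun y => extObj o w (F y) := by
  induction w generalizing F with
  | nil i =>
    by_cases h : i = o
    · simp only [extObj, if_pos h]; exact hF _
    · simp only [extObj, if_neg h]; exact (0 : Y →ₗ[k] X).isLinear
  | @cons i j l c w ih =>
    by_cases h : i = o ∧ j = o
    · simp only [extObj, dif_pos h]; exact ih _ fun z => hF _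
    · simp only [extObj, dif_neg h]; exact (0 : Y →ₗ[k] X).isLinear

theorem extObj_multilin {i l : I} {F : Word (Q.full fun _ : Unit => o) () () → X} (hF : IsMultilin F) :
    IsMultilin fun w : Word Q i l => extObj o w F := by
  intro a b x z
  induction x generalizing F with
  | nil i =>
    by_cases h : i = o ∧ b = o
    · obtain ⟨rfl, rfl⟩ := h
      simp only [Word.append, extObj_cons]
      exact extObj_linear _ z _ fun z => hF.head z
    · simp only [Word.append, extObj_cons_ne o h]; exact (0 : _ →ₗ[k] X).isLinear
  | @cons i j l c w ih =>
    by_cases h : i = o ∧ j = o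
    · obtain ⟨rfl, rfl⟩ := h
      simp only [Word.append, extObj_cons]
      exact ih (hF.cons c)
    · simp only [Word.append, extObj_cons_ne o h]; exact (0 : _ →ₗ[k] X).isLinear

theorem extObj_mem {i l : I} {w : Word Q i l} {q : ℤ} (hw : w.IsHomog q)
    {F : Word (Q.full fun _ : Unit => o) () () → X} (S : Submodule k X)
    (hF : ∀ z, z.IsHomog q → F z ∈ S) : extObj o w F ∈ S := by
  induction hw generalizing F with
  | nil i =>
    by_cases h : i = o
    · simp only [extObj, if_pos h]; exact hF _ (.nil _)
    · simp only [extObj, if_neg h]; exact S.zero_mem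
  | @cons i j l c w p q hc hw ih =>
    by_cases h : i = o ∧ j = o
    · obtain ⟨rfl, rfl⟩ := h
      rw [extObj_cons]
      exact ih fun z hz => hF _ (.cons (i := ()) (j := ()) hc hz)
    · rw [extObj_cons_ne o h]; exact S.zero_mem
end extObj

namespace BimodCat
open TwoObj
variable {X : BimodCat.{u, v} k} {Y Z : Type*} [AddCommGroup Y] [Module k Y] [AddCommGroup Z] [Module k Z]

/-- Extension of a function on `T(A[1]) ⊗ K[1] ⊗ T(B[1])` by zero to all words from `a` to `b`. -/
noncomputable def extMid : Word X.toGrQuiver a b → (X.TA → X.K → X.TB → Y) → Y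
  | .cons (j := .a) c w, g => extMid w fun x => g (.cons (i := ()) (j := ()) c x)
  | .cons (j := .b) κ w, g => extObj b w (g (.nil ()) κ)

omit [Module k Y] in
theorem extMid_incl : ∀ (x : X.TA) (κ : X.K) (z : X.TB) (g : X.TA → X.K → X.TB → Y),
    extMid ((X.inclA x).append (.cons κ (X.inclB z))) g = g x κ z
  | .nil _, κ, z, g => by
    refine Eq.trans ?_ (extObj_incl b z (g (.nil ()) κ))
    exact extMid.eq_2 _ _ _
  | .cons c x, κ, z, g => (extMid.eq_1 _ _ _).trans (extMid_incl x κ z _)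

theorem extMid_linear : ∀ (w : Word X.toGrQuiver a b) (g : Z → X.TA → X.K → X.TB → Y),
    (∀ x κ z, IsLinearMap k fun y => g y x κ z) → IsLinearMap k fun y => extMid w (g y)
  | .cons (j := .a) c w, g, hg => by
    simp only [extMid]
    exact extMid_linear w _ fun x κ z => hg _ _ _
  | .cons (j := .b) κ w, g, hg => by
    simp only [extMid]
    exact extObj_linear b w _ fun z => hg _ _ _

/-- The letter that varies is in `A`, in `K` or behind the letter of `K`, and one hypothesis settles
each case. Outside the words of the form `x | κ | z` the extension is zero. -/
theorem extMid_multilin {g : X.TA → X.K → X.TB → Y} (h1 : ∀ κ z, IsMultilin fun x => g x κ z)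
    (h2 : ∀ x z, IsLinearMap k fun κ => g x κ z) (h3 : ∀ x κ, IsMultilin (g x κ)) :
    ∀ {i j : TwoObj} (x : Word X.toGrQuiver a i) (z : Word X.toGrQuiver j b),
      IsLinearMap k fun c : X.Hom i j => extMid (x.append (.cons c z)) g
  | .a, .a, .nil _, z => by
    simp only [Word.append, extMid]
    exact extMid_linear z _ fun x κ z => (h1 κ z).head x
  | .a, .b, .nil _, z => by
    simp only [Word.append, extMid]
    exact extObj_linear b z _ fun z => h2 _ z
  | _, _, .cons (j := .a) c x, z => by
    simp only [Word.append, extMid]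
    exact extMid_multilin (fun κ z => (h1 κ z).cons c) (fun x z => h2 _ z) (fun x κ => h3 _ κ) x z
  | _, _, .cons (j := .b) c x, z => by
    simp only [Word.append, extMid]
    exact extObj_multilin b (h3 _ c) _ _ x z

theorem extMid_mem (S : Submodule k Y) : ∀ {w : Word X.toGrQuiver a b} {r : ℤ}, w.IsHomog r →
    ∀ {g : X.TA → X.K → X.TB → Y}, (∀ x κ z p q s, x.IsHomog p → κ ∈ X.gr a b q → z.IsHomog s →
      p + (q - 1 + s) = r → g x κ z ∈ S) → extMid w g ∈ S
  | .cons (j := .a) c w, _, .cons hc hw, g, hg => by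
    rw [extMid]
    exact extMid_mem S hw fun x κ z p q s hx hκ hz e =>
      hg _ κ z _ q s (.cons (i := ()) (j := ()) hc hx) hκ hz (by omega)
  | .cons (j := .b) κ w, _, .cons hκ hw, g, hg => by
    rw [extMid]
    exact extObj_mem b hw S fun z hz => hg _ κ z 0 _ _ (.nil _) hκ hz (by omega)

/-- A path from `b` to `a` must use a letter of `Hom b a = 0`. -/
theorem eq_zero_of_b_a : ∀ (w : Word X.toGrQuiver b a) {F : Word X.toGrQuiver b a → Y},
    IsMultilin F → F w = 0
  | .cons (j := .a) c w, F, hF => by rw [X.hom_b_a c]; exact (hF.head w).map_zero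
  | .cons (j := .b) c w, F, hF => eq_zero_of_b_a w (hF.cons c)

/-- A word from `a` to `a` that leaves `a` returns through `Hom b a = 0`; all other such words are
words in `A`. -/
theorem eq_zero_of_inclA : ∀ (w : Word X.toGrQuiver a a) {F : Word X.toGrQuiver a a → Y},
    IsMultilin F → (∀ x : X.TA, F (X.inclA x) = 0) → F w = 0
  | .nil _, _, _, h => h (.nil ())
  | .cons (j := .a) c w, F, hF, h =>
    eq_zero_of_inclA w (hF.cons c) fun x => h (.cons (i := ()) (j := ()) c x)
  | .cons (j := .b) c w, _, hF, _ => eq_zero_of_b_a w (hF.cons c)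

theorem eq_zero_of_inclB : ∀ (w : Word X.toGrQuiver b b) {F : Word X.toGrQuiver b b → Y},
    IsMultilin F → (∀ z : X.TB, F (X.inclB z) = 0) → F w = 0
  | .nil _, _, _, h => h (.nil ())
  | .cons (j := .b) c w, F, hF, h =>
    eq_zero_of_inclB w (hF.cons c) fun x => h (.cons (i := ()) (j := ()) c x)
  | .cons (j := .a) c w, F, hF, _ => by rw [X.hom_b_a c]; exact (hF.head w).map_zero

/-- A path from `a` to `b` without a letter of `Hom b a` crosses exactly once: letters of `A`, one
letter of `K`, letters of `B`. -/
theorem eq_zero_of_incl_mid : ∀ (w : Word X.toGrQuiver a b) {F : Word X.toGrQuiver a b → Y},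
    IsMultilin F → (∀ (x : X.TA) κ (z : X.TB), F ((X.inclA x).append (.cons κ (X.inclB z))) = 0) →
      F w = 0
  | .cons (j := .a) c w, F, hF, h =>
    eq_zero_of_incl_mid w (hF.cons c) fun x => h (.cons (i := ()) (j := ()) c x)
  | .cons (j := .b) c w, F, hF, h => eq_zero_of_inclB w (hF.cons c) fun z => h (.nil ()) c z

/-- A Hochschild cochain of `Cat∞(A, B, K)` vanishes if its three components do. -/
theorem cochain_eq_zero {n : ℤ} (Φ : X.cochains n) (hA : ∀ x : X.TA, Φ.1 a a (X.inclA x) = 0)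
    (hB : ∀ z : X.TB, Φ.1 b b (X.inclB z) = 0)
    (hK : ∀ (x : X.TA) κ (z : X.TB), Φ.1 a b ((X.inclA x).append (.cons κ (X.inclB z))) = 0) : Φ = 0 := by
  have hΦ := (AInf.isCochain Φ).1
  refine Subtype.ext (funext fun i => funext fun j => funext fun w => ?_)
  cases i <;> cases j
  · exact eq_zero_of_inclA w (hΦ _ _) hA
  · exact eq_zero_of_incl_mid w (hΦ _ _) hK
  · exact X.hom_b_a _
  · exact eq_zero_of_inclB w (hΦ _ _) hB

/-- A Hochschild cochain of `Cat∞(A, B, K)` with given components. -/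
theorem exists_cochain (n : ℤ) {φA : X.TA → X.Hom a a} {φB : X.TB → X.Hom b b}
    {g : X.TA → X.K → X.TB → X.K} (hA : IsMultilin φA)
    (hA' : ∀ x q, x.IsHomog q → φA x ∈ X.gr a a (q + n + 1)) (hB : IsMultilin φB)
    (hB' : ∀ z q, z.IsHomog q → φB z ∈ X.gr b b (q + n + 1))
    (h1 : ∀ κ z, IsMultilin fun x => g x κ z)
    (h2 : ∀ x z, IsLinearMap k fun κ => g x κ z) (h3 : ∀ x κ, IsMultilin (g x κ))
    (hg : ∀ x κ z p q s, x.IsHomog p → κ ∈ X.gr a b q → z.IsHomog s →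
      g x κ z ∈ X.gr a b (p + q + s + n)) :
    ∃ Φ : X.cochains n, (∀ x : X.TA, Φ.1 a a (X.inclA x) = φA x) ∧
      (∀ z : X.TB, Φ.1 b b (X.inclB z) = φB z) ∧
      ∀ (x : X.TA) κ (z : X.TB), Φ.1 a b ((X.inclA x).append (.cons κ (X.inclB z))) = g x κ z := by
  let Φ : ∀ i j : TwoObj, Word X.toGrQuiver i j → X.Hom i j
    | .a, .a => fun w => extObj a w φA
    | .a, .b => fun w => extMid w g
    | .b, .a => fun _ => 0
    | .b, .b => fun w => extObj b w φB
  refine ⟨⟨Φ, fun i j => ?_, fun i j w p hw => ?_⟩, fun x => extObj_incl a x φA,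
    fun z => extObj_incl b z φB, fun x κ z => extMid_incl x κ z g⟩
  · cases i <;> cases j
    · exact extObj_multilin a hA
    · exact fun _ _ => extMid_multilin h1 h2 h3
    · exact isMultilin_zero
    · exact extObj_multilin b hB
  · cases i <;> cases j
    · exact extObj_mem a hw _ fun z hz => hA' z p hz
    · refine extMid_mem _ hw fun x κ z p' q s hx hκ hz e => ?_
      have := hg x κ z _ _ _ hx hκ hz
      convert this using 2; omega
    · exact Submodule.zero_mem _
    · exact extObj_mem b hw _ fun z hz => hB' z p hz

end BimodCat
end AInf

/-! ### Leading terms, cones, and kernels of restriction maps. -/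

namespace AInf
variable {k : Type u} [Field k]

section short
variable {I : Type} {Q : GrQuiver.{u, v} k I} {X : Type*} [AddCommGroup X] [Module k X]

/-- Inserting a cochain that vanishes at words shorter than `w`. -/
theorem ins_eq_of_short (n : ℤ) {Φ : ∀ i j : I, Word Q i j → Q.Hom i j} {i l : I} {F : Word Q i l → X}
    (hF : IsMultilin F) {w : Word Q i l} {r : ℤ} (hw : w.IsHomog r)
    (h : ∀ i' l' (y : Word Q i' l') s, y.IsHomog s → y.len < w.len → Φ i' l' y = 0) :
    ins n Φ F w = F (.cons (Φ i l w) (.nil l)) := by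
  -- The inserted cochain has to take the whole word, so the pieces on both sides of it are empty.
  refine (splitSum_eq_nil_left hw fun m x u p q _ hu _ hl =>
    splitSum_eq_zero hu fun m' y z s t hy _ _ e => ?_).trans
    (splitSum_eq_nil_right hw fun m y z p q hy _ _ hl => ?_)
  · rw [h _ _ y s hy (by omega)]; exact (hF _ _ _ _).map_zero
  · rw [h _ _ y p hy hl]; exact (hF _ _ _ _).map_zero

theorem ins_eq_zero (n : ℤ) {Φ : ∀ i j : I, Word Q i j → Q.Hom i j} {i l : I} {F : Word Q i l → X}
    (hF : IsMultilin F) (w : Word Q i l) (h : ∀ i' l' y, Φ i' l' y = 0) : ins n Φ F w = 0 := by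
  have : ∀ (a b : I) (x : Word Q i a) (z : Word Q b l), F (x.append (.cons 0 z)) = 0 :=
    fun a b x z => (hF a b x z).map_zero
  simp only [ins, h, this, splitSum_zero]
end short

section cone
variable {A E : Type*} [AddCommGroup A] [Module k A] [AddCommGroup E] [Module k E]
  (dA : A →ₗ[k] A) (dE : ℤ → E →ₗ[k] E) (L : ℤ → A →ₗ[k] E)

/-- The differential of the cone of a map of complexes. -/
def coneD (p : ℤ) : A × E →ₗ[k] A × E :=
  (dA ∘ₗ LinearMap.fst k A E).prod (L (p + 1) ∘ₗ LinearMap.fst k A E - dE p ∘ₗ LinearMap.snd k A E)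

variable (GA : ℤ → Submodule k A) (GE : ℤ → Submodule k E)

/-- The graded pieces of the cone. -/
def coneGr (p : ℤ) : Submodule k (A × E) := (GA (p + 1)).prod (GE p)

variable {dA dE L GA GE}

theorem coneD_mem (hA : ∀ n, ∀ c ∈ GA n, dA c ∈ GA (n + 1)) (hE : ∀ n, ∀ f ∈ GE n, dE n f ∈ GE (n + 1))
    (hL : ∀ n, ∀ c ∈ GA n, L n c ∈ GE n) (p : ℤ) (v : A × E) (hv : v ∈ coneGr GA GE p) :
    coneD dA dE L p v ∈ coneGr GA GE (p + 1) :=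
  ⟨hA _ _ hv.1, Submodule.sub_mem _ (hL _ _ hv.1) (hE _ _ hv.2)⟩

/-- The mixed terms cancel because `L` commutes with the differentials; this fixes the minus sign
before `dE` in `coneD`. -/
theorem coneD_coneD (hA : ∀ n, ∀ c ∈ GA n, dA (dA c) = 0)
    (hE : ∀ n, ∀ f ∈ GE n, dE (n + 1) (dE n f) = 0)
    (hL : ∀ n, ∀ c ∈ GA n, dE n (L n c) = L (n + 1) (dA c)) (p : ℤ) (v : A × E)
    (hv : v ∈ coneGr GA GE p) : coneD dA dE L (p + 1) (coneD dA dE L p v) = 0 := by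
  refine Prod.ext (hA _ _ hv.1) ?_
  change L (p + 1 + 1) (dA v.1) - dE (p + 1) (L (p + 1) v.1 - dE p v.2) = 0
  rw [map_sub, hL _ _ hv.1, hE _ _ hv.2, sub_zero, sub_self]

/-- The cone of a quasi-isomorphism is acyclic. -/
theorem coneD_exact (hLmem : ∀ n, ∀ c ∈ GA n, L n c ∈ GE n)
    (hL : ∀ n, ∀ c ∈ GA n, dE n (L n c) = L (n + 1) (dA c))
    (hinj : ∀ n, ∀ c ∈ GA (n + 1), dA c = 0 → ∀ f ∈ GE n, dE n f = L (n + 1) c → ∃ c' ∈ GA n, dA c' = c)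
    (hsurj : ∀ n, ∀ f ∈ GE (n + 1), dE (n + 1) f = 0 →
      ∃ c ∈ GA (n + 1), dA c = 0 ∧ ∃ f' ∈ GE n, f = L (n + 1) c + dE n f')
    (p : ℤ) (v : A × E) (hv : v ∈ coneGr GA GE (p + 1)) (h : coneD dA dE L (p + 1) v = 0) :
    ∃ w ∈ coneGr GA GE p, coneD dA dE L p w = v := by
  have h1 : dA v.1 = 0 := congrArg Prod.fst h
  have h2 : L (p + 1 + 1) v.1 - dE (p + 1) v.2 = 0 := congrArg Prod.snd h
  -- The second component of the cycle condition says that `L` maps `v.1` to the boundary of `v.2`,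
  -- so `v.1` is itself a boundary.
  obtain ⟨c, hc, hc'⟩ := hinj _ v.1 hv.1 h1 v.2 hv.2 (sub_eq_zero.1 h2).symm
  -- Subtracting `L c` from `v.2` leaves a cycle, hence `L e` plus a boundary. The cycle `e` can be
  -- added to `c` without changing the first component.
  obtain ⟨e, he, he', f, hf, hf'⟩ := hsurj p (v.2 - L (p + 1) c)
    (Submodule.sub_mem _ hv.2 (hLmem _ _ hc))
    (by rw [map_sub, hL _ _ hc, hc', ← neg_eq_zero, neg_sub, h2])
  refine ⟨(c + e, -f), ⟨Submodule.add_mem _ hc he, Submodule.neg_mem _ hf⟩, Prod.ext ?_ ?_⟩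
  · change dA (c + e) = v.1
    rw [map_add, he', add_zero, hc']
  · change L (p + 1) (c + e) - dE p (-f) = v.2
    rw [map_add, map_neg, sub_neg_eq_add, add_assoc, ← hf', add_sub_cancel]
end cone

namespace AInfCat
variable {I J : Type} (X : AInfCat.{u, v} k I)

theorem restrictCochain_hochD (f : J → I) (n : ℤ) (Φ : X.cochains n) :
    X.restrictCochain f (n + 1) (X.hochD n Φ) = (X.full f).hochD n (X.restrictCochain f n Φ) := by
  refine Subtype.ext ?_
  funext i j w
  exact congrArg₂ (fun a b : X.Hom (f i) (f j) => a - ((-1 : k) ^ n) • b) (ins_incl n Φ.1 (X.d (f i) (f j)) w)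
    (ins_incl 1 X.d (Φ.1 (f i) (f j)) w)

/-- The cochains that restrict to zero on a full subcategory. -/
noncomputable abbrev restrictKer (f : J → I) (n : ℤ) : Submodule k (X.cochains n) :=
  LinearMap.ker (X.restrictCochain f n)

/-- The Hochschild differential on the cochains that restrict to zero. -/
noncomputable def restrictKerD (f : J → I) (n : ℤ) : X.restrictKer f n →ₗ[k] X.restrictKer f (n + 1) :=
  (X.hochD n).restrict fun Φ hΦ => by
    rw [LinearMap.mem_ker, restrictCochain_hochD, LinearMap.mem_ker.1 hΦ, map_zero]

theorem quasiIso_restrict (f : J → I) (hs : ∀ n, Function.Surjective (X.restrictCochain f n))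
    (hk : ∀ n (Φ : X.restrictKer f (n + 1)), X.restrictKerD f (n + 1) Φ = 0 →
      ∃ Ψ, X.restrictKerD f n Ψ = Φ) : QuasiIso (X.restrict f) := by
  refine CochainComplex.quasiIso_of_surjective _ hs fun n Φ h1 h2 => ?_
  simp only [hochschild, CochainComplex.of_d] at h2
  obtain ⟨Ψ, hΨ⟩ := hk n ⟨Φ, h1⟩ (Subtype.ext h2)
  refine ⟨Ψ.1, Ψ.2, ?_⟩
  simp only [hochschild, CochainComplex.of_d]
  exact congrArg Subtype.val hΨ
end AInfCat
end AInf

/-! ### The projection to `B` and the derived left action. -/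

namespace AInf.BimodCat
open TwoObj
variable {k : Type u} [Field k] {X : BimodCat.{u, v} k}

theorem restrictKer_b {n : ℤ} (Φ : X.restrictKer (fun _ : Unit => b) n) (z : X.TB) :
    Φ.1.1 b b (X.inclB z) = 0 :=
  congrFun (congrFun (congrFun (congrArg Subtype.val Φ.2) ()) ()) z

section left

/-- The values `Φ(x)` and `Φ(x | κ | z)` of a cochain, as functions of a word `x` in `A`. -/
def evalA (Φ : ∀ i j : TwoObj, Word X.toGrQuiver i j → X.Hom i j) (x : X.TA) :
    X.Hom a a × (X.K → X.TB → X.K) :=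
  (Φ a a (X.inclA x), fun κ z => Φ a b ((X.inclA x).append (.cons κ (X.inclB z))))

theorem evalA_multilin {n : ℤ} (Φ : X.cochains n) : IsMultilin (evalA Φ.1) := by
  have h := (AInf.isCochain Φ).1
  intro i j x z
  have h1 := inclA_multilin (h a a) i j x z
  have h2 := fun κ y => inclA_multilin ((h a b).append_right (.cons κ (X.inclB y))) i j x z
  exact ⟨fun c e => Prod.ext (h1.map_add c e) (funext fun κ => funext fun y => (h2 κ y).map_add c e),
    fun r c => Prod.ext (h1.map_smul r c) (funext fun κ => funext fun y => (h2 κ y).map_smul r c)⟩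

/-- At `x` of suspended degree `q` the value in `A` has degree `q + n + 1`, and the value in
`End_{-B}(K)` has degree `q + n`. This is the shift built into the cone. -/
theorem evalA_mem {n : ℤ} (Φ : X.cochains n) {x : X.TA} {q : ℤ} (hx : x.IsHomog q) :
    evalA Φ.1 x ∈ coneGr (X.gr a a) X.endB (q + n) := by
  have h := AInf.isCochain Φ
  refine ⟨h.2 _ _ _ _ (incl_isHomog hx), fun z => h.1 _ _ _ _ _ _,
    fun κ => inclB_multilin (((h.1 a b).append_left _).cons κ), fun κ z r s hκ hz => ?_⟩
  have := h.2 a b _ _ ((incl_isHomog hx).append (.cons hκ (incl_isHomog hz)))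
  have e : q + (r - 1 + s) + n + 1 = r + s + (q + n) := by ring
  rw [e] at this
  exact this

/-- The leading part of the Hochschild differential on the kernel of `p_B` is the cone differential.
In `d ∘ Φ` the cochain must take all of `x`: alone it produces `L_A(Φ(x))`, together with `κ` it
produces `d_{K,B} ∘ f`. In `Φ ∘ d` a term where `d` takes `κ` survives only if it takes no letter of
`A`, which produces `f ∘ d_{K,B}`; the terms inside `x` are kept as `Φ(d_A x)`. -/
theorem evalA_hochD {n : ℤ} (Φ : X.cochains n) (hΦ : ∀ z : X.TB, Φ.1 b b (X.inclB z) = 0) {x : X.TA}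
    {q : ℤ} (hx : x.IsHomog q)
    (h : ∀ r (y : X.TA), y.IsHomog r → y.len < x.len → evalA Φ.1 y = 0) :
    evalA (X.hochD n Φ).1 x =
      (X.d a a (.cons (evalA Φ.1 x).1 (.nil a)),
        X.actL (X.letterA (evalA Φ.1 x).1) - X.diffB (q + n) (evalA Φ.1 x).2) -
      ((-1 : k) ^ n) • ins 1 X.algA.d (evalA Φ.1) x := by
  have hM := (AInf.isCochain Φ).1
  have hd := d_multilin (X := X)
  refine Prod.ext ?_ (funext fun κ => funext fun z => ?_)
  · refine congrArg₂ (fun s t : X.Hom a a => s - ((-1 : k) ^ n) • t) ?_ ?_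
    · refine (ins_incl n Φ.1 (f := fun _ : Unit => a) (i := ()) (l := ()) (X.d a a) x).trans ?_
      exact ins_eq_of_short n (inclA_multilin (hd a a)) hx
        fun _ _ y s hy hl => congrArg Prod.fst (h s y hy hl)
    · refine (ins_incl 1 X.d (f := fun _ : Unit => a) (i := ()) (l := ()) (Φ.1 a a) x).trans ?_
      exact ins_linear (LinearMap.isLinear (LinearMap.fst k (X.Hom a a) (X.K → X.TB → X.K))) _ _ (evalA Φ.1) x
  set f : X.K → X.TB → X.K := (evalA Φ.1 x).2 with hf
  have eT1 : ins n Φ.1 (fun y => X.d a b (y.append (.cons κ (X.inclB z)))) (X.inclA x) =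
      X.actL (X.letterA (evalA Φ.1 x).1) κ z := by
    refine (ins_incl n Φ.1 (f := fun _ : Unit => a) (i := ()) (l := ()) _ x).trans ?_
    exact ins_eq_of_short n (inclA_multilin ((hd a b).append_right _)) hx
      fun _ _ y s hy hl => congrArg Prod.fst (h s y hy hl)
  have eT2 : (X.inclA x).splitSum (fun _ x₁ x₂ => (X.inclB z).splitSum fun _ u₁ u₂ =>
      X.d a b ((x₁.kos n).append (.cons (Φ.1 _ _ (x₂.append (.cons κ u₁))) u₂))) =
      z.splitSum fun _ z₁ z₂ => X.dKB (f κ z₁) z₂ := by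
    refine (splitSum_incl (f := fun _ : Unit => a) (i := ()) (l := ()) x _).trans ?_
    refine (splitSum_eq_nil_left hx fun m y u p s hy hu _ hl => ?_).trans
      (splitSum_incl (f := fun _ : Unit => b) (i := ()) (l := ()) z _)
    refine (splitSum_incl (f := fun _ : Unit => b) (i := ()) (l := ()) z _).trans ?_
    refine Eq.trans (congrArg _ ?_) (splitSum_zero z)
    funext m u₁ u₂
    have e0 : Φ.1 a b ((X.inclA u).append (.cons κ (X.inclB u₁))) = 0 :=
      congrFun (congrFun (congrArg Prod.snd (h s u hu hl)) κ) u₁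
    refine Eq.trans (congrArg (fun c => X.d a b (((X.inclA y).kos n).append (.cons c (X.inclB u₂)))) e0) ?_
    exact (hd a b _ _ _ _).map_zero
  have eT3 : ins n Φ.1 (fun u => X.d a b (((X.inclA x).kos n).append (.cons (X.kos n κ) u))) (X.inclB z) = 0 := by
    refine (ins_incl n Φ.1 (f := fun _ : Unit => b) (i := ()) (l := ()) _ z).trans ?_
    exact ins_eq_zero n (inclB_multilin (((hd a b).append_left _).cons _)) z fun _ _ y => hΦ y
  have eU1 : ins 1 X.d (fun y => Φ.1 a b (y.append (.cons κ (X.inclB z)))) (X.inclA x) =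
      (ins 1 X.algA.d (evalA Φ.1) x).2 κ z := by
    refine (ins_incl 1 X.d (f := fun _ : Unit => a) (i := ()) (l := ()) _ x).trans ?_
    exact ins_linear (f := fun v : X.Hom a a × (X.K → X.TB → X.K) => v.2 κ z)
      ⟨fun _ _ => rfl, fun _ _ => rfl⟩ _ _ (evalA Φ.1) x
  -- The sign for moving `d` past all of `x`; multiplied by `(-1)ⁿ` it becomes the sign `(-1)^(q +
  -- n)` in `diffB (q + n)`.
  have hk : ∀ κ' (z' : X.TB), Φ.1 a b (((X.inclA x).kos 1).append (.cons κ' (X.inclB z'))) =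
      ((-1 : k) ^ q) • f κ' z' := fun κ' z' => by
    have := ((hM a b).append_right (.cons κ' (X.inclB z'))).apply_kos 1 (incl_isHomog hx)
    rwa [one_mul] at this
  have eU2 : (X.inclA x).splitSum (fun _ x₁ x₂ => (X.inclB z).splitSum fun _ u₁ u₂ =>
      Φ.1 a b ((x₁.kos 1).append (.cons (X.d _ _ (x₂.append (.cons κ u₁))) u₂))) =
      ((-1 : k) ^ q) • z.splitSum fun _ z₁ z₂ => f (X.dKB κ z₁) z₂ := by
    refine (splitSum_incl (f := fun _ : Unit => a) (i := ()) (l := ()) x _).trans ?_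
    -- If `d` takes letters of `A` along with `κ`, then `Φ` is evaluated at a shorter word of `A`
    -- and vanishes.
    refine (splitSum_eq_nil_right hx fun m y u p s hy hu _ hl => ?_).trans
      ((splitSum_incl (f := fun _ : Unit => b) (i := ()) (l := ()) z _).trans ?_)
    · refine (splitSum_incl (f := fun _ : Unit => b) (i := ()) (l := ()) z _).trans ?_
      refine Eq.trans (congrArg _ ?_) (splitSum_zero z)
      funext m u₁ u₂
      have e0 := h p (y.kos 1) (hy.kos 1) (by rwa [len_kos])
      have e1 := congrFun (congrFun (congrArg Prod.snd e0) (X.d a b ((X.inclA u).append (.cons κ (X.inclB u₁))))) u₂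
      rw [← incl_kos]
      exact e1
    · rw [← splitSum_smul]
      refine congrArg _ ?_
      funext m u₁ u₂
      exact hk _ _
  have eU3 : ins 1 X.d (fun u => Φ.1 a b (((X.inclA x).kos 1).append (.cons (X.kos 1 κ) u))) (X.inclB z) =
      ((-1 : k) ^ q) • ins 1 X.algB.d (f (X.kos 1 κ)) z := by
    refine (ins_incl 1 X.d (f := fun _ : Unit => b) (i := ()) (l := ()) _ z).trans ?_
    rw [← ins_smul]
    refine congrArg (fun F => ins 1 X.algB.d F z) ?_
    funext u
    exact hk _ _
  have e1 := ins_append_cons n Φ.1 (X.d a b) (X.inclA x) κ (X.inclB z)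
  have e2 := ins_append_cons 1 X.d (Φ.1 a b) (X.inclA x) κ (X.inclB z)
  rw [eT1, eT2, eT3, add_zero] at e1
  rw [eU1, eU2, eU3] at e2
  change ins n Φ.1 (X.d a b) _ - ((-1 : k) ^ n) • ins 1 X.d (Φ.1 a b) _ =
    X.actL (X.letterA (evalA Φ.1 x).1) κ z - X.diffB (q + n) f κ z -
      ((-1 : k) ^ n) • (ins 1 X.algA.d (evalA Φ.1) x).2 κ z
  rw [e1, e2, diffB, zpow_add₀ (by simp), mul_comm, mul_smul]
  simp only [smul_add]
  abel

/-- The prescribed values may depend on the degree, so they are first merged into one multilinear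
function of `x`; the component on `B` is set to zero. -/
theorem exists_evalA (n : ℤ) (G : ℤ → X.TA → X.Hom a a × (X.K → X.TB → X.K)) (hG : ∀ q, IsMultilin (G q))
    (hG' : ∀ q x, x.IsHomog q → G q x ∈ coneGr (X.gr a a) X.endB (q + n)) :
    ∃ Φ : X.restrictKer (fun _ : Unit => b) n, ∀ q x, x.IsHomog q → evalA Φ.1.1 x = G q x := by
  have hH := homogExt_multilin hG
  have hH' : ∀ x q, x.IsHomog q → homogExt x G ∈ coneGr (X.gr a a) X.endB (q + n) := fun x q hx => by
    rw [homogExt_of_isHomog hG hx]; exact hG' q x hx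
  -- At an inhomogeneous `x` the value need not lie in one graded piece of the cone, but linearity
  -- in `κ` and in the letters of `B` must hold there too.
  let S : Submodule k (X.Hom a a × (X.K → X.TB → X.K)) :=
    { carrier := {v | (∀ z, IsLinearMap k fun κ => v.2 κ z) ∧ ∀ κ, IsMultilin (v.2 κ)}
      add_mem' := fun h h' => ⟨fun z => ((h.1 z).mk' _ + (h'.1 z).mk' _).isLinear,
        fun κ => (h.2 κ).add (h'.2 κ)⟩
      zero_mem' := ⟨fun _ => (0 : _ →ₗ[k] _).isLinear, fun _ => isMultilin_zero⟩
      smul_mem' := fun s _ h => ⟨fun z => (s • (h.1 z).mk' _).isLinear,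
        fun κ => (h.2 κ).comp_linear (f := fun c => s • c)
          ⟨fun _ _ => smul_add _ _ _, fun _ _ => smul_comm _ _ _⟩⟩ }
  have hS : ∀ x : X.TA, homogExt x G ∈ S := fun x => homogExt_mem S x fun q u hu =>
    ⟨(hG' q u hu).2.linear, (hG' q u hu).2.multilin⟩
  obtain ⟨Φ, h1, h2, h3⟩ := exists_cochain n (X := X) (φA := fun x => (homogExt x G).1) (φB := fun _ => 0)
    (g := fun x κ z => (homogExt x G).2 κ z)
    (hH.comp_linear (LinearMap.isLinear (LinearMap.fst k (X.Hom a a) (X.K → X.TB → X.K))))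
    (fun x q hx => (hH' x q hx).1) isMultilin_zero (fun _ _ _ => Submodule.zero_mem _)
    (fun κ z => hH.comp_linear (f := fun v : X.Hom a a × (X.K → X.TB → X.K) => v.2 κ z)
      ⟨fun _ _ => rfl, fun _ _ => rfl⟩)
    (fun x => (hS x).1) (fun x => (hS x).2)
    (fun x _ _ p _ _ hx hκ hz => by
      have := (hH' x p hx).2.degree _ _ _ _ hκ hz
      convert this using 2; ring)
  refine ⟨⟨Φ, LinearMap.mem_ker.2 (Subtype.ext (funext fun _ => funext fun _ => funext h2))⟩, fun q x hx => ?_⟩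
  rw [← homogExt_of_isHomog hG hx]
  exact Prod.ext (h1 x) (funext fun κ => funext fun z => h3 x κ z)

theorem eq_zero_of_evalA {n : ℤ} (Φ : X.cochains n) (hΦ : ∀ z : X.TB, Φ.1 b b (X.inclB z) = 0)
    (h : ∀ q (x : X.TA), x.IsHomog q → evalA Φ.1 x = 0) : Φ = 0 := by
  have h' : ∀ x : X.TA, evalA Φ.1 x = 0 :=
    (evalA_multilin Φ).ext_homog isMultilin_zero fun x q => h q x
  exact cochain_eq_zero Φ (fun x => congrArg Prod.fst (h' x)) hΦ
    fun x κ z => congrFun (congrFun (congrArg Prod.snd (h' x)) κ) z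

/-- `diffB` as a linear map. -/
noncomputable def diffBₗ (p : ℤ) : (X.K → X.TB → X.K) →ₗ[k] (X.K → X.TB → X.K) where
  toFun := X.diffB p
  map_add' f g := funext fun κ => funext fun z => (diffB_linear p κ z).map_add f g
  map_smul' r f := funext fun κ => funext fun z => (diffB_linear p κ z).map_smul r f

/-- The linear part of the derived left action, on elements that need not be homogeneous. -/
def actLₗ : X.Hom a a →ₗ[k] (X.K → X.TB → X.K) where
  toFun c := X.actL (X.letterA c)
  map_add' c e := funext fun _ => funext fun _ => ((d_multilin a b).head _).map_add c e
  map_smul' r c := funext fun _ => funext fun _ => ((d_multilin a b).head _).map_smul r c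

variable (X)

/-- Extension by zero; only a splitting of graded spaces is needed, not one of complexes. -/
theorem projB_surjective (n : ℤ) : Function.Surjective (X.restrictCochain (fun _ : Unit => b) n) := by
  intro φ
  have h : X.algB.IsCochain n φ.1 := φ.2
  obtain ⟨Φ, -, hB, -⟩ := exists_cochain n (X := X) (φA := fun _ => 0) (φB := φ.1 () ())
    (g := fun _ _ _ => 0) isMultilin_zero (fun _ _ _ => Submodule.zero_mem _) (h.1 _ _)
    (fun z q hz => h.2 _ _ _ _ hz) (fun _ _ => isMultilin_zero) (fun _ _ => (0 : _ →ₗ[k] _).isLinear)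
    (fun _ _ => isMultilin_zero) (fun _ _ _ _ _ _ _ _ _ => Submodule.zero_mem _)
  exact ⟨Φ, Subtype.ext (funext fun _ => funext fun _ => funext hB)⟩

/-- The linear map `d¹` of `Hom i i`. -/
def dLetter (i : TwoObj) : X.Hom i i →ₗ[k] X.Hom i i :=
  ((d_multilin i i).head (.nil i)).mk' _

theorem dLetter_mem (i : TwoObj) (n : ℤ) (c : X.Hom i i) (hc : c ∈ X.gr i i n) :
    X.dLetter i c ∈ X.gr i i (n + 1) := by
  have := X.isCochain.2 i i _ _ (.cons hc (.nil i))
  have e : n - 1 + 0 + 1 + 1 = n + 1 := by ring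
  rw [e] at this
  exact this

variable {X}

/-- One half of the quasi-isomorphism hypothesis, stated in the ambient spaces in the form that
`coneD_exact` takes. -/
theorem derivedLeft_injective (hA : X.algA.IsFlat) (hq : QuasiIso (X.derivedLeft hA)) (n : ℤ)
    (c : X.Hom a a) (hc : c ∈ X.gr a a (n + 1)) (hdc : X.dLetter a c = 0) (f : X.K → X.TB → X.K)
    (hf : f ∈ X.endB n) (h : X.diffBₗ n f = X.actLₗ c) : ∃ c' ∈ X.gr a a n, X.dLetter a c' = c := by
  have := ((CochainComplex.quasiIso_iff_elements _).1 hq n).1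
  simp only [AInfCat.IsFlat.homComplex, endBComplex, CochainComplex.of_d] at this
  obtain ⟨c', h'⟩ := this ⟨c, hc⟩ (Subtype.ext hdc) ⟨⟨f, hf⟩, Subtype.ext h⟩
  exact ⟨c'.1, c'.2, congrArg Subtype.val h'⟩

theorem derivedLeft_surjective (hA : X.algA.IsFlat) (hq : QuasiIso (X.derivedLeft hA)) (n : ℤ)
    (f : X.K → X.TB → X.K) (hf : f ∈ X.endB (n + 1)) (hdf : X.diffBₗ (n + 1) f = 0) :
    ∃ c ∈ X.gr a a (n + 1), X.dLetter a c = 0 ∧ ∃ f' ∈ X.endB n, f = X.actLₗ c + X.diffBₗ n f' := by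
  have := ((CochainComplex.quasiIso_iff_elements _).1 hq n).2
  simp only [AInfCat.IsFlat.homComplex, endBComplex, CochainComplex.of_d] at this
  obtain ⟨c, hc, f', h'⟩ := this ⟨f, hf⟩ (Subtype.ext hdf)
  exact ⟨c.1, c.2, congrArg Subtype.val hc, f'.1, f'.2, congrArg Subtype.val h'⟩

/-- `evalA` as a linear map on cochains. -/
def evalAₗ (n : ℤ) : X.restrictKer (fun _ : Unit => b) n →ₗ[k] (ℤ → X.TA → X.Hom a a × (X.K → X.TB → X.K)) where
  toFun Φ _ := evalA Φ.1.1
  map_add' _ _ := rfl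
  map_smul' _ _ := rfl

theorem quasiIso_projB (hA : X.algA.IsFlat) (hq : QuasiIso (X.derivedLeft hA)) : QuasiIso X.projB := by
  have hL : ∀ n, ∀ c ∈ X.gr a a n, X.actLₗ c ∈ X.endB n := fun n c hc => actL_isEndB hc
  have hcomm : ∀ n, ∀ c ∈ X.gr a a n, X.diffBₗ n (X.actLₗ c) = X.actLₗ (X.dLetter a c) :=
    fun n c hc => funext fun κ => funext fun z => actL_comm hA hc κ z
  have h1 := coneD_mem (dA := X.dLetter a) (dE := X.diffBₗ) (L := fun _ => X.actLₗ)
    (GA := X.gr a a) (GE := X.endB) (X.dLetter_mem a) (fun n f hf => diffB_isEndB hf) hL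
  have h2 := coneD_coneD (dA := X.dLetter a) (dE := X.diffBₗ) (L := fun _ => X.actLₗ)
    (GA := X.gr a a) (GE := X.endB) (fun n c _ => hA.d_d (i := ()) (j := ()) c)
    (fun n f hf => funext fun κ => funext fun z => diffB_diffB hA hf κ z) hcomm
  have h3 := coneD_exact (dA := X.dLetter a) (dE := X.diffBₗ) (L := fun _ => X.actLₗ)
    (GA := X.gr a a) (GE := X.endB) hL hcomm (derivedLeft_injective hA hq) (derivedLeft_surjective hA hq)
  refine X.quasiIso_restrict _ (projB_surjective X) ?_
  -- The values are in the cone of `L_A`. Since `x` stands to the left of `κ` and `z`, the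
  -- evaluation needs no sign and ignores the degree of `x`.
  exact exists_primitive_of_values (P := X.algA) hA _ _ h1 h2 h3
    (C := fun n => X.restrictKer (fun _ : Unit => b) n)
    (X.restrictKerD fun _ : Unit => b) (fun n Φ => Subtype.ext (X.hochD_hochD n Φ.1))
    (fun n => evalAₗ n)
    (fun n Φ q => evalA_multilin Φ.1) (fun n Φ q x hx => evalA_mem Φ.1 hx) exists_evalA
    (fun n Φ h => Subtype.ext (eq_zero_of_evalA Φ.1 (restrictKer_b Φ) h))
    (fun n Φ q x hx h => evalA_hochD Φ.1 (restrictKer_b Φ) hx h)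

end left
end AInf.BimodCat

/-! ### The projection to `A` and the derived right action. -/

namespace AInf.BimodCat
open TwoObj
variable {k : Type u} [Field k] {X : BimodCat.{u, v} k}

theorem restrictKer_a {n : ℤ} (Φ : X.restrictKer (fun _ : Unit => a) n) (x : X.TA) :
    Φ.1.1 a a (X.inclA x) = 0 :=
  congrFun (congrFun (congrFun (congrArg Subtype.val Φ.2) ()) ()) x

section right

/-- The values `Φ(z)` and `± Φ(x | κ | z)` of a cochain, as functions of a word `z` in `B` of suspended
degree `q`. -/
noncomputable def evalB (Φ : ∀ i j : TwoObj, Word X.toGrQuiver i j → X.Hom i j) (q : ℤ) (z : X.TB) :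
    X.Hom b b × (X.TA → X.K → X.K) :=
  (Φ b b (X.inclB z), fun x κ => Φ a b (((X.inclA x).kos q).append (.cons (X.kos q κ) (X.inclB z))))

theorem evalB_multilin {n : ℤ} (Φ : X.cochains n) (q : ℤ) : IsMultilin (evalB Φ.1 q) := by
  have h := (AInf.isCochain Φ).1
  intro i j x z
  have h1 := inclB_multilin (h b b) i j x z
  have h2 := fun y κ => inclB_multilin
    (((h a b).append_left ((X.inclA y).kos q)).cons (X.kos q κ)) i j x z
  exact ⟨fun c e => Prod.ext (h1.map_add c e) (funext fun y => funext fun κ => (h2 y κ).map_add c e),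
    fun r c => Prod.ext (h1.map_smul r c) (funext fun y => funext fun κ => (h2 y κ).map_smul r c)⟩

theorem evalB_mem {n : ℤ} (Φ : X.cochains n) {z : X.TB} {q : ℤ} (hz : z.IsHomog q) :
    evalB Φ.1 q z ∈ coneGr (X.gr b b) X.endA (q + n) := by
  have h := AInf.isCochain Φ
  refine ⟨h.2 _ _ _ _ (incl_isHomog hz), fun x => ?_,
    fun κ => inclA_multilin (((h.1 a b).append_right _).kos q), fun x κ r s hx hκ => ?_⟩
  · exact (((h.1 a b _ _ ((X.inclA x).kos q) (X.inclB z)).mk' _).comp (X.kos q)).isLinear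
  have := h.2 a b _ _ (((incl_isHomog hx).kos q).append (.cons (kos_mem q hκ) (incl_isHomog hz)))
  have e : r + (s - 1 + q) + n + 1 = r + s + (q + n) := by ring
  rw [e] at this
  exact this

/-- The sign twist is an involution, so evaluating at twisted arguments removes it. -/
theorem evalB_zero {Φ : ∀ i j : TwoObj, Word X.toGrQuiver i j → X.Hom i j} {q : ℤ} {z : X.TB}
    (h : evalB Φ q z = 0) (x : X.TA) (κ : X.K) :
    Φ a b ((X.inclA x).append (.cons κ (X.inclB z))) = 0 := by
  have := congrFun (congrFun (congrArg Prod.snd h) (x.kos q)) (X.kos q κ)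
  simp only [evalB] at this
  rwa [kos_kos, kos_two_mul, inclA, incl_kos, word_kos_kos, word_kos_two_mul] at this

/-- Mirror image of `evalA_hochD`: in `d ∘ Φ` the cochain must take all of `z`, and in `Φ ∘ d` a
term where `d` takes `κ` survives only if it takes no letter of `B`. The twist by `q` in `evalB`
makes the remaining signs those of `diffA` and `actR`. -/
theorem evalB_hochD {n : ℤ} (Φ : X.cochains n) (hΦ : ∀ x : X.TA, Φ.1 a a (X.inclA x) = 0) {z : X.TB}
    {q : ℤ} (hz : z.IsHomog q)
    (h : ∀ r (y : X.TB), y.IsHomog r → y.len < z.len → evalB Φ.1 r y = 0) :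
    evalB (X.hochD n Φ).1 q z =
      (X.d b b (.cons (evalB Φ.1 q z).1 (.nil b)),
        X.actR (q + n + 1 - 1) (X.letterB (evalB Φ.1 q z).1) - X.diffA (q + n) (evalB Φ.1 q z).2) -
      ((-1 : k) ^ n) • ins 1 X.algB.d (evalB Φ.1 (q + 1)) z := by
  have hM := (AInf.isCochain Φ).1
  have hd := d_multilin (X := X)
  refine Prod.ext ?_ (funext fun x => funext fun κ => ?_)
  · refine congrArg₂ (fun s t : X.Hom b b => s - ((-1 : k) ^ n) • t) ?_ ?_
    · refine (ins_incl n Φ.1 (f := fun _ : Unit => b) (i := ()) (l := ()) (X.d b b) z).trans ?_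
      exact ins_eq_of_short n (inclB_multilin (hd b b)) hz
        fun _ _ y s hy hl => congrArg Prod.fst (h s y hy hl)
    · refine (ins_incl 1 X.d (f := fun _ : Unit => b) (i := ()) (l := ()) (Φ.1 b b) z).trans ?_
      exact ins_linear (LinearMap.isLinear (LinearMap.fst k (X.Hom b b) (X.TA → X.K → X.K))) _ _
        (evalB Φ.1 (q + 1)) z
  set f : X.TA → X.K → X.K := (evalB Φ.1 q z).2 with hf
  have eT1 : ins n Φ.1 (fun y => X.d a b (y.append (.cons (X.kos q κ) (X.inclB z))))
      (X.inclA (x.kos q)) = 0 := by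
    refine (ins_incl n Φ.1 (f := fun _ : Unit => a) (i := ()) (l := ()) _ (x.kos q)).trans ?_
    exact ins_eq_zero n (inclA_multilin ((hd a b).append_right _)) _ fun _ _ y => hΦ y
  have eT2 : (X.inclA (x.kos q)).splitSum (fun _ x₁ x₂ => (X.inclB z).splitSum fun _ u₁ u₂ =>
      X.d a b ((x₁.kos n).append (.cons (Φ.1 _ _ (x₂.append (.cons (X.kos q κ) u₁))) u₂))) =
      x.splitSum fun _ x₁ x₂ => X.dAK (x₁.kos (q + n)) (f x₂ κ) := by
    refine (splitSum_incl (f := fun _ : Unit => a) (i := ()) (l := ()) (x.kos q) _).trans ?_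
    refine (splitSum_kos q x _).trans (congrArg _ ?_)
    funext m x₁ x₂
    refine (splitSum_incl (f := fun _ : Unit => b) (i := ()) (l := ()) z _).trans ?_
    refine (splitSum_eq_nil_right hz fun m y u p s hy hu _ hl => ?_).trans ?_
    · refine Eq.trans (congrArg (fun c => X.d a b (((X.inclA (x₁.kos q)).kos n).append (.cons c (X.inclB u))))
        (evalB_zero (h p y hy hl) (x₂.kos q) _)) ?_
      exact (hd a b _ _ _ _).map_zero
    -- The letters of `x₁` carry the twist by `q` and the passage of `Φ`, of degree `n`; together
    -- this is the degree `q + n` of `f`.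
    · have e1 : X.inclA (x₁.kos (q + n)) = (X.inclA (x₁.kos q)).kos n := by
        rw [add_comm, ← word_kos_kos]; exact incl_kos n _
      have e2 : X.inclA (x₂.kos q) = (X.inclA x₂).kos q := incl_kos q x₂
      rw [dAK, e1]
      exact congrArg (fun y => X.d a b (((X.inclA (x₁.kos q)).kos n).append
        (.cons (Φ.1 a b (y.append (.cons (X.kos q κ) (X.inclB z)))) (.nil b)))) e2
  -- The letter `Φ(z)` has suspended degree `q + n`, which is the sign parameter of `actR` here.
  have eT3 : ins n Φ.1 (fun u => X.d a b (((X.inclA (x.kos q)).kos n).append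
      (.cons (X.kos n (X.kos q κ)) u))) (X.inclB z) =
      X.actR (q + n + 1 - 1) (X.letterB (evalB Φ.1 q z).1) x κ := by
    refine (ins_incl n Φ.1 (f := fun _ : Unit => b) (i := ()) (l := ()) _ z).trans ?_
    refine (ins_eq_of_short n (inclB_multilin (((hd a b).append_left _).cons _)) hz
      fun _ _ y s hy hl => congrArg Prod.fst (h s y hy hl)).trans ?_
    have e1 : (X.inclA (x.kos q)).kos n = (X.inclA x).kos (n + q) := by
      rw [inclA, incl_kos, word_kos_kos]
    rw [actR, add_sub_cancel_right, e1, kos_kos, add_comm q n]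
    rfl
  -- The factor `(-1)^q` comes from interchanging `d` with the twist by `q`; combined with `(-1)ⁿ`
  -- it is the sign in `diffA (q + n)`.
  have eU1 : ins 1 X.d (fun y => Φ.1 a b (y.append (.cons (X.kos q κ) (X.inclB z)))) (X.inclA (x.kos q)) =
      ((-1 : k) ^ q) • ins 1 X.algA.d (fun x' => f x' κ) x := by
    refine (ins_incl 1 X.d (f := fun _ : Unit => a) (i := ()) (l := ()) _ (x.kos q)).trans ?_
    refine (ins_kos q 1 X.algA.d _ (inclA_multilin ((hM a b).append_right _)) (X.algA.d_kos q) x).trans ?_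
    rw [mul_one]
    refine congrArg (fun F => ((-1 : k) ^ q) • ins 1 X.algA.d F x) ?_
    funext y
    exact congrArg (fun w => Φ.1 a b (w.append (.cons (X.kos q κ) (X.inclB z)))) (incl_kos q y)
  have eU2 : (X.inclA (x.kos q)).splitSum (fun _ x₁ x₂ => (X.inclB z).splitSum fun _ u₁ u₂ =>
      Φ.1 a b ((x₁.kos 1).append (.cons (X.d _ _ (x₂.append (.cons (X.kos q κ) u₁))) u₂))) =
      ((-1 : k) ^ q) • x.splitSum fun _ x₁ x₂ => f (x₁.kos 1) (X.dAK x₂ κ) := by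
    refine (splitSum_incl (f := fun _ : Unit => a) (i := ()) (l := ()) (x.kos q) _).trans ?_
    refine (splitSum_kos q x _).trans ?_
    rw [← splitSum_smul]
    refine congrArg _ ?_
    funext m x₁ x₂
    refine (splitSum_incl (f := fun _ : Unit => b) (i := ()) (l := ()) z _).trans ?_
    refine (splitSum_eq_nil_left hz fun m y u p s hy hu _ hl => ?_).trans ?_
    · have := evalB_zero (h s u hu hl) ((x₁.kos q).kos 1)
        (X.d a b ((X.inclA (x₂.kos q)).append (.cons (X.kos q κ) (X.inclB y))))
      rw [inclA, incl_kos] at this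
      exact this
    · have e1 : (X.inclA (x₁.kos q)).kos 1 = (X.inclA (x₁.kos 1)).kos q := by
        have e3 : X.inclA (x₁.kos q) = (X.inclA x₁).kos q := incl_kos q x₁
        have e4 : X.inclA (x₁.kos 1) = (X.inclA x₁).kos 1 := incl_kos 1 x₁
        rw [e3, e4, word_kos_kos, word_kos_kos, add_comm]
      have e2 : X.d a b ((X.inclA (x₂.kos q)).append (.cons (X.kos q κ) (.nil b))) =
          ((-1 : k) ^ q) • X.kos q (X.dAK x₂ κ) := by
        have := X.d_kos q a b ((X.inclA x₂).append (.cons κ (.nil b)))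
        rw [mul_one, kos_append] at this
        rw [dAK, this, smul_smul, neg_one_sq, one_smul, inclA, incl_kos]
        rfl
      refine Eq.trans (congrArg₂ (fun y c => Φ.1 a b (y.append (.cons c (X.inclB z)))) e1 e2) ?_
      exact (hM a b _ _ _ _).map_smul _ _
  -- Inserting `d` into `z` raises its degree by one, so the twist is now by `q + 1`.
  have eU3 : ins 1 X.d (fun u => Φ.1 a b (((X.inclA (x.kos q)).kos 1).append (.cons (X.kos 1 (X.kos q κ)) u)))
      (X.inclB z) = (ins 1 X.algB.d (evalB Φ.1 (q + 1)) z).2 x κ := by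
    refine (ins_incl 1 X.d (f := fun _ : Unit => b) (i := ()) (l := ()) _ z).trans ?_
    refine Eq.trans ?_ (ins_linear (f := fun v : X.Hom b b × (X.TA → X.K → X.K) => v.2 x κ)
      ⟨fun _ _ => rfl, fun _ _ => rfl⟩ _ _ (evalB Φ.1 (q + 1)) z)
    refine congrArg (fun F => ins 1 X.algB.d F z) ?_
    funext u
    have e1 : (X.inclA (x.kos q)).kos 1 = (X.inclA x).kos (q + 1) := by
      rw [inclA, incl_kos, word_kos_kos, add_comm]
    rw [e1, kos_kos, add_comm 1 q]
    rfl
  have e1 := ins_append_cons n Φ.1 (X.d a b) (X.inclA (x.kos q)) (X.kos q κ) (X.inclB z)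
  have e2 := ins_append_cons 1 X.d (Φ.1 a b) (X.inclA (x.kos q)) (X.kos q κ) (X.inclB z)
  rw [eT1, eT2, eT3, zero_add] at e1
  rw [eU1, eU2, eU3] at e2
  have e3 : X.inclA (x.kos q) = (X.inclA x).kos q := incl_kos q x
  rw [e3] at e1 e2
  change ins n Φ.1 (X.d a b) _ - ((-1 : k) ^ n) • ins 1 X.d (Φ.1 a b) _ =
    X.actR (q + n + 1 - 1) (X.letterB (evalB Φ.1 q z).1) x κ - X.diffA (q + n) f x κ -
      ((-1 : k) ^ n) • (ins 1 X.algB.d (evalB Φ.1 (q + 1)) z).2 x κ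
  rw [e1, e2, diffA, zpow_add₀ (by simp), mul_comm, mul_smul]
  simp only [smul_add]
  abel

/-- Moving an operator of degree `q` past the arguments. -/
noncomputable def twist (q : ℤ) :
    X.Hom b b × (X.TA → X.K → X.K) →ₗ[k] X.Hom b b × (X.TA → X.K → X.K) where
  toFun v := (v.1, fun x κ => v.2 (x.kos q) (X.kos q κ))
  map_add' _ _ := rfl
  map_smul' _ _ := rfl

theorem twist_mem (q p : ℤ) {v : X.Hom b b × (X.TA → X.K → X.K)} (hv : v ∈ coneGr (X.gr b b) X.endA p) :
    twist q v ∈ coneGr (X.gr b b) X.endA p :=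
  ⟨hv.1, fun x => (((hv.2.linear (x.kos q)).mk' _).comp (X.kos q)).isLinear,
    fun κ => (hv.2.multilin (X.kos q κ)).kos q,
    fun _ _ _ _ hx hκ => hv.2.degree _ _ _ _ (hx.kos q) (kos_mem q hκ)⟩

/-- The prescribed values are twisted before being merged by `homogExt`, so that the twist in
`evalB` restores them. -/
theorem exists_evalB (n : ℤ) (G : ℤ → X.TB → X.Hom b b × (X.TA → X.K → X.K)) (hG : ∀ q, IsMultilin (G q))
    (hG' : ∀ q z, z.IsHomog q → G q z ∈ coneGr (X.gr b b) X.endA (q + n)) :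
    ∃ Φ : X.restrictKer (fun _ : Unit => a) n, ∀ q z, z.IsHomog q → evalB Φ.1.1 q z = G q z := by
  have hT : ∀ q, IsMultilin fun z => twist q (G q z) := fun q => (hG q).comp_linear (twist q).isLinear
  have hH := homogExt_multilin hT
  have hH' : ∀ z q, z.IsHomog q → homogExt z (fun q z => twist q (G q z)) = twist q (G q z) :=
    fun z q hz => homogExt_of_isHomog hT hz
  have hm : ∀ z q, z.IsHomog q → homogExt z (fun q z => twist q (G q z)) ∈
      coneGr (X.gr b b) X.endA (q + n) := fun z q hz => by
    rw [hH' z q hz]; exact twist_mem q _ (hG' q z hz)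
  let S : Submodule k (X.Hom b b × (X.TA → X.K → X.K)) :=
    { carrier := {v | (∀ x, IsLinearMap k (v.2 x)) ∧ ∀ κ, IsMultilin fun x => v.2 x κ}
      add_mem' := fun h h' => ⟨fun z => ((h.1 z).mk' _ + (h'.1 z).mk' _).isLinear,
        fun κ => (h.2 κ).add (h'.2 κ)⟩
      zero_mem' := ⟨fun _ => (0 : _ →ₗ[k] _).isLinear, fun _ => isMultilin_zero⟩
      smul_mem' := fun s _ h => ⟨fun z => (s • (h.1 z).mk' _).isLinear,
        fun κ => (h.2 κ).comp_linear (f := fun c => s • c)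
          ⟨fun _ _ => smul_add _ _ _, fun _ _ => smul_comm _ _ _⟩⟩ }
  have hS : ∀ z : X.TB, homogExt z (fun q z => twist q (G q z)) ∈ S := fun z =>
    homogExt_mem S z fun q u hu =>
      have := twist_mem q _ (hG' q u hu)
      ⟨this.2.linear, this.2.multilin⟩
  obtain ⟨Φ, h1, h2, h3⟩ := exists_cochain n (X := X) (φA := fun _ => 0)
    (φB := fun z => (homogExt z fun q z => twist q (G q z)).1)
    (g := fun x κ z => (homogExt z fun q z => twist q (G q z)).2 x κ)
    isMultilin_zero (fun _ _ _ => Submodule.zero_mem _)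
    (hH.comp_linear (LinearMap.isLinear (LinearMap.fst k (X.Hom b b) (X.TA → X.K → X.K))))
    (fun z q hz => (hm z q hz).1)
    (fun κ z => (hS z).2 κ) (fun x z => (hS z).1 x)
    (fun x κ => hH.comp_linear (f := fun v : X.Hom b b × (X.TA → X.K → X.K) => v.2 x κ)
      ⟨fun _ _ => rfl, fun _ _ => rfl⟩)
    (fun _ _ z _ _ s hx hκ hz => by
      have := (hm z s hz).2.degree _ _ _ _ hx hκ
      convert this using 2; ring)
  refine ⟨⟨Φ, LinearMap.mem_ker.2 (Subtype.ext (funext fun _ => funext fun _ => funext h1))⟩, fun q z hz => ?_⟩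
  refine Prod.ext ((h2 z).trans (congrArg Prod.fst (hH' z q hz) : _ = (twist q (G q z)).1)) (funext fun x => funext fun κ => ?_)
  -- At twisted arguments the two twists cancel and leave `G q z`.
  have e := h3 (x.kos q) (X.kos q κ) z
  rw [hH' z q hz] at e
  change _ = (G q z).2 ((x.kos q).kos q) (X.kos q (X.kos q κ)) at e
  rw [kos_kos, kos_two_mul, word_kos_kos, word_kos_two_mul, inclA, incl_kos] at e
  exact e

theorem eq_zero_of_evalB {n : ℤ} (Φ : X.cochains n) (hΦ : ∀ x : X.TA, Φ.1 a a (X.inclA x) = 0)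
    (h : ∀ q (z : X.TB), z.IsHomog q → evalB Φ.1 q z = 0) : Φ = 0 := by
  have hM := (AInf.isCochain Φ).1
  exact cochain_eq_zero Φ hΦ
    ((inclB_multilin (hM b b)).ext_homog isMultilin_zero fun z q hz => congrArg Prod.fst (h q z hz))
    fun x κ => (inclB_multilin (((hM a b).append_left (X.inclA x)).cons κ)).ext_homog isMultilin_zero
      fun z q hz => evalB_zero (h q z hz) x κ

/-- `diffA` as a linear map. -/
noncomputable def diffAₗ (p : ℤ) : (X.TA → X.K → X.K) →ₗ[k] (X.TA → X.K → X.K) where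
  toFun := X.diffA p
  map_add' f g := funext fun _ => funext fun _ => (diffA_linear p _ _).map_add f g
  map_smul' r f := funext fun _ => funext fun _ => (diffA_linear p _ _).map_smul r f

/-- The linear part of the derived right action, with the signs for elements of degree `n`. -/
noncomputable def actRₗ (n : ℤ) : X.Hom b b →ₗ[k] (X.TA → X.K → X.K) where
  toFun c := X.actR (n - 1) (X.letterB c)
  map_add' c e := funext fun _ => funext fun _ =>
    (((d_multilin a b).append_left _).cons _ |>.head _).map_add c e
  map_smul' r c := funext fun _ => funext fun _ =>
    (((d_multilin a b).append_left _).cons _ |>.head _).map_smul r c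

variable (X)

theorem projA_surjective (n : ℤ) : Function.Surjective (X.restrictCochain (fun _ : Unit => a) n) := by
  intro φ
  have h : X.algA.IsCochain n φ.1 := φ.2
  obtain ⟨Φ, hA, -, -⟩ := exists_cochain n (X := X) (φA := φ.1 () ()) (φB := fun _ => 0)
    (g := fun _ _ _ => 0) (h.1 _ _) (fun x q hx => h.2 _ _ _ _ hx) isMultilin_zero
    (fun _ _ _ => Submodule.zero_mem _)
    (fun _ _ => isMultilin_zero) (fun _ _ => (0 : _ →ₗ[k] _).isLinear)
    (fun _ _ => isMultilin_zero) (fun _ _ _ _ _ _ _ _ _ => Submodule.zero_mem _)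
  exact ⟨Φ, Subtype.ext (funext fun _ => funext fun _ => funext hA)⟩

variable {X}

theorem derivedRight_injective (hB : X.algB.IsFlat) (hq : QuasiIso (X.derivedRight hB)) (n : ℤ)
    (c : X.Hom b b) (hc : c ∈ X.gr b b (n + 1)) (hdc : X.dLetter b c = 0) (f : X.TA → X.K → X.K)
    (hf : f ∈ X.endA n) (h : X.diffAₗ n f = X.actRₗ (n + 1) c) :
    ∃ c' ∈ X.gr b b n, X.dLetter b c' = c := by
  have := ((CochainComplex.quasiIso_iff_elements _).1 hq n).1
  simp only [AInfCat.IsFlat.homComplex, endAComplex, CochainComplex.of_d] at this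
  obtain ⟨c', h'⟩ := this ⟨c, hc⟩ (Subtype.ext hdc) ⟨⟨f, hf⟩, Subtype.ext h⟩
  exact ⟨c'.1, c'.2, congrArg Subtype.val h'⟩

theorem derivedRight_surjective (hB : X.algB.IsFlat) (hq : QuasiIso (X.derivedRight hB)) (n : ℤ)
    (f : X.TA → X.K → X.K) (hf : f ∈ X.endA (n + 1)) (hdf : X.diffAₗ (n + 1) f = 0) :
    ∃ c ∈ X.gr b b (n + 1), X.dLetter b c = 0 ∧
      ∃ f' ∈ X.endA n, f = X.actRₗ (n + 1) c + X.diffAₗ n f' := by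
  have := ((CochainComplex.quasiIso_iff_elements _).1 hq n).2
  simp only [AInfCat.IsFlat.homComplex, endAComplex, CochainComplex.of_d] at this
  obtain ⟨c, hc, f', h'⟩ := this ⟨f, hf⟩ (Subtype.ext hdf)
  exact ⟨c.1, c.2, congrArg Subtype.val hc, f'.1, f'.2, congrArg Subtype.val h'⟩

/-- `evalB` as a linear map on cochains. -/
noncomputable def evalBₗ (n : ℤ) :
    X.restrictKer (fun _ : Unit => a) n →ₗ[k] (ℤ → X.TB → X.Hom b b × (X.TA → X.K → X.K)) where
  toFun Φ := evalB Φ.1.1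
  map_add' _ _ := rfl
  map_smul' _ _ := rfl

/-- Same argument as for `p_B`, with the cone of `R_B`. Here the map `L` of the cone depends on the
degree, because the sign in `actR` does. -/
theorem quasiIso_projA (hB : X.algB.IsFlat) (hq : QuasiIso (X.derivedRight hB)) : QuasiIso X.projA := by
  have hL : ∀ n, ∀ c ∈ X.gr b b n, X.actRₗ n c ∈ X.endA n := fun n c hc => actR_isEndA hc
  have hcomm : ∀ n, ∀ c ∈ X.gr b b n, X.diffAₗ n (X.actRₗ n c) = X.actRₗ (n + 1) (X.dLetter b c) :=
    fun n c hc => funext fun x => funext fun κ => actR_comm hB x κ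
  have h1 := coneD_mem (dA := X.dLetter b) (dE := X.diffAₗ) (L := X.actRₗ)
    (GA := X.gr b b) (GE := X.endA) (X.dLetter_mem b) (fun n f hf => diffA_isEndA hf) hL
  have h2 := coneD_coneD (dA := X.dLetter b) (dE := X.diffAₗ) (L := X.actRₗ)
    (GA := X.gr b b) (GE := X.endA) (fun n c _ => hB.d_d (i := ()) (j := ()) c)
    (fun n f hf => funext fun x => funext fun κ => diffA_diffA hB hf x κ) hcomm
  have h3 := coneD_exact (dA := X.dLetter b) (dE := X.diffAₗ) (L := X.actRₗ)
    (GA := X.gr b b) (GE := X.endA) hL hcomm (derivedRight_injective hB hq) (derivedRight_surjective hB hq)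
  refine X.quasiIso_restrict _ (projA_surjective X) ?_
  exact exists_primitive_of_values (P := X.algB) hB _ _ h1 h2 h3
    (C := fun n => X.restrictKer (fun _ : Unit => a) n)
    (X.restrictKerD fun _ : Unit => a) (fun n Φ => Subtype.ext (X.hochD_hochD n Φ.1))
    (fun n => evalBₗ n)
    (fun n Φ q => evalB_multilin Φ.1 q) (fun n Φ q x hx => evalB_mem Φ.1 hx) exists_evalB
    (fun n Φ h => Subtype.ext (eq_zero_of_evalB Φ.1 (restrictKer_a Φ) h))
    (fun n Φ q x hx h => evalB_hochD Φ.1 (restrictKer_a Φ) hx h)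

end right
end AInf.BimodCat

theorem mainTheorem3 {k : Type u} [Field k] [CharZero k] (X : AInf.BimodCat.{u, v} k)
    (hA : X.algA.IsFlat) (hB : X.algB.IsFlat) :
    (QuasiIso (X.derivedLeft hA) → QuasiIso X.projB) ∧
      (QuasiIso (X.derivedRight hB) → QuasiIso X.projA) :=
  ⟨AInf.BimodCat.quasiIso_projB hA, AInf.BimodCat.quasiIso_projA hB⟩
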